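/- Let $\mathfrak g=\mathfrak{sl}_2(\mathbb C)$ be the real vector space of trace-free complex $2\times2$ matrices with norm $|A|^2=\mathrm{tr}(AA^*)$, let $f=f_1+if_2:=\det:\mathfrak g\to\mathbb C$ and $\varphi:=df_1\wedge df_2$. Let $\Omega_0^n$ be the space of smooth real $n$-forms on $\mathfrak g$ all of whose partial derivatives vanish at $0$ ("flat forms"), and let $\mathcal C^p:=\varphi\wedge\Omega_0^p\subset\Omega_0^{p+2}$ for $p\ge0$, $\mathcal C^{p}:=0$ for $p<0$, with the exterior derivative $d$ (the flat foliated complex). A deformation retraction of a complex $(C^\bullet,d)$ is a pair $(p,h)$ of a cochain map $p:C^\bullet\to C^\bullet$ with $p\circ p=p$ and linear maps $h:C^{\bullet+1}\to C^{\bullet}$ with $p-\mathrm{id}=dh+hd$. For $r>0$, $n,k\in\mathbb N_0$ and a flat form $\alpha$ put $\|\alpha\|_{n,k,r}:=\sup_{|A|\le r}\sup_{j\le n}|A|^{-k}|D^j\alpha(A)|$. For spaces $\mathscr V,\mathscr W$ of flat forms, a linear operator $\ell:\mathscr V\to\mathscr W$ satisfies property SLB for $(a,b,c)\in\mathbb N_0^3$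 if for each $r>0$ it induces a linear operator from $\mathscr V|_{\overline B_r}$ to $\mathscr W|_{\overline B_r}$, where $\overline B_r=\{|A|\le r\}$, and if $\|\ell(\alpha)\|_{n,k,r}\le C(r,n,k)\,\|\alpha\|_{n+a,\,k+bn+c,\,r}$ for all $r>0$, $n,k\in\mathbb N_0$ and $\alpha\in\mathscr V$, where $C(r,n,k)$ depends continuously on $r>0$. Let $\mathfrak S=\{A\in\mathfrak g:[A,A^*]=0\}$ be the set of normal matrices, and define $r_{\mathfrak S}:\mathfrak g\to\mathfrak g$ by $r_{\mathfrak S}(A)=g^{-1}Ag$ with $g=\big(\mathbb 1+\tfrac1{|f(A)|}AA^*\big)^{1/2}$ (positive square root) if $f(A)\ne0$, and $r_{\mathfrak S}(A)=0$ if $f(A)=0$. Let $W_A=\frac14[A,[A,A^*]]$. Then the following hold. 1. The map $r_{\mathfrak S}$ is continuous, smooth on $\{f\neq0\}$, has image $\mathfrak S$ and restricts to the identity on $\mathfrak S$. For every $\alpha\in\Omega_0^n$ the form $r_{\mathfrak S}^*\alpha$ on $\{f\ne0\}$ extends to a form $p_{\mathfrak S}(\alpha)\in\Omega_0^n$, and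 $p_{\mathfrak S}$ is linear in $\alpha$. 2. The flow $\phi_t$ of $W$ exists and is smooth for all $t\ge0$. For $\alpha\in\Omega_0^{n+1}$ and $t\ge 0$ the form $h_t(\alpha)=\int_0^t i_W\phi_s^*(\alpha)\,ds$ lies in $\Omega_0^{n}$, and as $t\to\infty$ it converges in the compact-open $C^\infty$-topology to a form $h_{\mathfrak S}(\alpha)\in\Omega_0^n$, linear in $\alpha$. 3. $(p_{\mathfrak S},h_{\mathfrak S})$ is a deformation retraction of $(\Omega_0^\bullet,d)$, it restricts to a deformation retraction of $(\mathcal C^\bullet,d)$, and $h_{\mathfrak S}:\Omega_0^{n+1}\to\Omega_0^n$ satisfies property SLB for $(0,5,35)$ for every $n$. 4. Let $p_{SU(2)}(\alpha)=\int_{SU(2)}\mathrm{Ad}_U^*(\alpha)\,d\mu(U)$, with $\mu$ the normalized Haar measure and $\mathrm{Ad}_U(A)=UAU^{-1}$. Then $p_{SU(2)}$ preserves $\Omega_0^\bullet$, and there are operators $h_{SU(2)}$ such that $(p_{SU(2)},h_{SU(2)})$ is a deformation retraction of $(\Omega_0^\bullet,d)$ that restricts to a deformation retraction of $(\mathcal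 C^\bullet,d)$, both restricted operators satisfying property SLB for $(0,0,0)$, and such that, with $$p_{\mathcal F}:=p_{SU(2)}\circ p_{\mathfrak S},\qquad h_{\mathcal F}:=p_{SU(2)}\circ h_{\mathfrak S}+h_{SU(2)},$$ the pair $(p_{\mathcal F},h_{\mathcal F})$ is a deformation retraction of $(\mathcal C^\bullet,d)$, $d\circ p_{\mathcal F}=0$ on $\mathcal C^\bullet$, and $h_{\mathcal F}$ satisfies property SLB for $(0,5,35)$ on $\mathcal C^\bullet$. -/

import Mathlib

open scoped ContDiff Topology MatrixOrder ENNReal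
open Filter Set MeasureTheory

noncomputable section

namespace FlatSL2

section Space

attribute [local instance] Matrix.frobeniusNormedAddCommGroup Matrix.frobeniusNormedSpace

/-- The Lie algebra `sl₂(ℂ)` of trace-free complex `2 × 2` matrices, as a real vector space. -/
def sl2 : Submodule ℝ (Matrix (Fin 2) (Fin 2) ℂ) :=
  LinearMap.ker (Matrix.traceLinearMap (Fin 2) ℝ ℂ)

/-- The type of trace-free complex `2 × 2` matrices. -/
def SL : Type := ↥sl2

/-- `sl₂(ℂ)` carries the norm `|A| = tr (A A*) ^ (1/2)`. -/
instance instNormedAddCommGroupSL : NormedAddCommGroup SL := Submodule.normedAddCommGroup sl2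

/-- `sl₂(ℂ)` is a real (six-dimensional) normed space. -/
instance instNormedSpaceSL : NormedSpace ℝ SL := Submodule.normedSpace sl2

/-- The underlying matrix. -/
def SL.mat (A : SL) : Matrix (Fin 2) (Fin 2) ℂ := Subtype.val A

theorem SL.trace_mat (A : SL) : A.mat.trace = 0 := Subtype.property A

/-- A matrix of trace zero as an element of `sl₂(ℂ)`. -/
def SL.ofMat (M : Matrix (Fin 2) (Fin 2) ℂ) (h : M.trace = 0) : SL := Subtype.mk M h

theorem SL.mat_ofMat (M : Matrix (Fin 2) (Fin 2) ℂ) (h : M.trace = 0) : (SL.ofMat M h).mat = M :=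
  rfl

theorem SL.mat_add (A B : SL) : (A + B).mat = A.mat + B.mat := rfl

theorem SL.mat_smul (c : ℝ) (A : SL) : (c • A).mat = c • A.mat := rfl

/-- The norm on `sl₂(ℂ)` is the one given by `|A|² = tr (A A*)`. -/
theorem norm_sq_eq_trace (A : SL) : ((‖A‖ ^ 2 : ℝ) : ℂ) = (A.mat * A.mat.conjTranspose).trace := by
  change ((‖A.mat‖ ^ 2 : ℝ) : ℂ) = _
  rw [Matrix.frobenius_norm_def, ← Real.sqrt_eq_rpow, Real.sq_sqrt (by positivity)]
  simp [Matrix.trace, Matrix.mul_apply, Fin.sum_univ_two, Complex.mul_conj,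
    Complex.normSq_eq_norm_sq]

end Space

/-! ### Linear algebra on `sl₂(ℂ)` -/

/-- The complex Casimir function `f = det`. -/
def casimir (A : SL) : ℂ := A.mat.det

/-- The Lie bracket `[A, B] = A B - B A`. -/
def bracket (A B : SL) : SL :=
  SL.ofMat (A.mat * B.mat - B.mat * A.mat) (by
    rw [Matrix.trace_sub, Matrix.trace_mul_comm, sub_self])

/-- The conjugate transpose `A*` of a trace-free matrix. -/
def conjTr (A : SL) : SL :=
  SL.ofMat A.mat.conjTranspose (by
    rw [Matrix.trace_conjTranspose, A.trace_mat, star_zero])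

/-- The conjugate `g⁻¹ A g`. -/
def conjInv (g : Matrix (Fin 2) (Fin 2) ℂ) (A : SL) : SL :=
  SL.ofMat (g⁻¹ * A.mat * g) (by
    rw [Matrix.mul_assoc, Matrix.trace_mul_comm, Matrix.mul_assoc]
    by_cases hg : IsUnit g.det
    · rw [Matrix.mul_nonsing_inv g hg, Matrix.mul_one, A.trace_mat]
    · rw [Matrix.nonsing_inv_apply_not_isUnit g hg]; simp)

/-- The set of normal matrices in `sl₂(ℂ)`. -/
def skeleton : Set SL := {A | bracket A (conjTr A) = 0}

/-- `g_∞(A) = (1 + A A* / |f(A)|) ^ (1/2)`, with the positive square root of a positive definite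
matrix. -/
def gInfty (A : SL) : Matrix (Fin 2) (Fin 2) ℂ :=
  CFC.sqrt (1 + (‖casimir A‖⁻¹ : ℝ) • (A.mat * A.mat.conjTranspose))

open Classical in
/-- The retraction `r` of `sl₂(ℂ)` onto the normal matrices. -/
def retraction (A : SL) : SL :=
  if casimir A = 0 then 0 else conjInv (gInfty A) A

/-- The vector field `W_A = ¼ [A, [A, A*]]`. -/
def W (A : SL) : SL := (1 / 4 : ℝ) • bracket A (bracket A (conjTr A))

/-- `φ` is the (smooth) flow of the vector field `V`, for all nonnegative times. -/
structure IsForwardFlow (V : SL → SL) (φ : ℝ → SL → SL) : Prop where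
  zero : ∀ A, φ 0 A = A
  deriv : ∀ A, ∀ t, 0 ≤ t → HasDerivWithinAt (fun s => φ s A) (V (φ t A)) (Ici 0) t
  smooth : ContDiffOn ℝ ∞ (fun q : ℝ × SL => φ q.1 q.2) (Ici 0 ×ˢ univ)

/-! ### Differential forms on `sl₂(ℂ)`, flat at the origin -/

/-- Differential `n`-forms (no regularity imposed). -/
abbrev Form (n : ℕ) : Type := SL → SL [⋀^Fin n]→L[ℝ] ℝ

/-- The pullback `F^* α`. -/
def pullback {n : ℕ} (F : SL → SL) (α : Form n) : Form n := fun A =>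
  (α (F A)).compContinuousLinearMap (fderiv ℝ F A)

/-- The interior product `i_V α`. -/
def interiorProduct {n : ℕ} (V : SL → SL) (α : Form (n + 1)) : Form n := fun A =>
  (α A).curryLeft (V A)

/-- The exterior product `θ ∧ β` of a field of covectors and an `n`-form:
`(θ ∧ β)(v₀, …, vₙ) = ∑ i, (-1)ⁱ θ(vᵢ) β(v₀, …, v̂ᵢ, …, vₙ)`. -/
def wedge {n : ℕ} (θ : SL → SL →L[ℝ] ℝ) : Form n →ₗ[ℝ] Form (n + 1) where
  toFun β A := ContinuousAlternatingMap.alternatizeUncurryFin ((θ A).smulRight (β A))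
  map_add' β γ := by
    funext A
    have h : (θ A).smulRight ((β + γ) A) = (θ A).smulRight (β A) + (θ A).smulRight (γ A) := by
      ext1 v; simp
    rw [h, ContinuousAlternatingMap.alternatizeUncurryFin_add]; rfl
  map_smul' c β := by
    funext A
    have h : (θ A).smulRight ((c • β) A) = c • (θ A).smulRight (β A) := by
      ext1 v; exact smul_comm (θ A v) c (β A)
    rw [h, ContinuousAlternatingMap.alternatizeUncurryFin_smul]; rfl

/-- `e_φ(β) = φ ∧ β = df₁ ∧ df₂ ∧ β`, where `φ = df₁ ∧ df₂` and `f = f₁ + i f₂`. -/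
def ePhi (n : ℕ) : Form n →ₗ[ℝ] Form (n + 2) :=
  wedge (fderiv ℝ fun A => (casimir A).re) ∘ₗ wedge (fderiv ℝ fun A => (casimir A).im)

/-- The space `Ω₀ⁿ` of smooth `n`-forms on `sl₂(ℂ)` all of whose partial derivatives vanish at the
origin. -/
def flatForms (n : ℕ) : Submodule ℝ (Form n) where
  carrier := {α | ContDiff ℝ ∞ α ∧ ∀ k : ℕ, iteratedFDeriv ℝ k α 0 = 0}
  zero_mem' := ⟨contDiff_const, fun k => by
    have h : iteratedFDeriv ℝ k (0 : Form n) = 0 := iteratedFDeriv_fun_zero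
    rw [h]; rfl⟩
  add_mem' := by
    rintro α β ⟨hα, hα0⟩ ⟨hβ, hβ0⟩
    refine ⟨hα.add hβ, fun k => ?_⟩
    rw [iteratedFDeriv_add (hα.of_le (mod_cast le_top)) (hβ.of_le (mod_cast le_top))]
    simp [hα0 k, hβ0 k]
  smul_mem' := by
    rintro c α ⟨hα, hα0⟩
    refine ⟨hα.const_smul c, fun k => ?_⟩
    rw [iteratedFDeriv_const_smul_apply (hα.of_le (mod_cast le_top)).contDiffAt, hα0 k, smul_zero]

theorem extDeriv_mem_flatForms {n : ℕ} {α : Form n} (hα : α ∈ flatForms n) :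
    extDeriv α ∈ flatForms (n + 1) := by
  obtain ⟨h, h0⟩ := hα
  have hd : ContDiff ℝ ∞ (fderiv ℝ α) := h.fderiv_right (mod_cast le_rfl)
  have he : extDeriv α =
      (ContinuousAlternatingMap.alternatizeUncurryFinCLM ℝ SL ℝ (n := n)) ∘ fderiv ℝ α := rfl
  refine ⟨?_, fun k => ?_⟩
  · rw [he]
    exact (ContinuousAlternatingMap.alternatizeUncurryFinCLM ℝ SL ℝ (n := n)).contDiff.comp hd
  · rw [he, ContinuousLinearMap.iteratedFDeriv_comp_left _
      (hd.of_le (mod_cast le_top)).contDiffAt le_rfl]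
    have hz : iteratedFDeriv ℝ k (fderiv ℝ α) 0 = 0 := by
      rw [← norm_eq_zero, norm_iteratedFDeriv_fderiv, h0 (k + 1), norm_zero]
    rw [hz]
    ext1 v
    exact map_zero (ContinuousAlternatingMap.alternatizeUncurryFinCLM ℝ SL ℝ (n := n))

/-- The exterior derivative on flat forms. -/
def d (n : ℕ) : flatForms n →ₗ[ℝ] flatForms (n + 1) where
  toFun α := ⟨extDeriv α.1, extDeriv_mem_flatForms α.2⟩
  map_add' α β := by
    refine Subtype.ext (funext fun A => ?_)
    exact extDeriv_add (α.2.1.differentiable (by simp) A) (β.2.1.differentiable (by simp) A)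
  map_smul' c α := Subtype.ext (funext fun A => extDeriv_smul c α.1)

/-- The flat foliated complex, as a family of subspaces of `Ω₀ⁿ`: the piece in form degree `p + 2`
is `𝒞ᵖ = e_φ(Ω₀ᵖ)`, and the pieces in form degrees `0` and `1` are zero. -/
def foliated : ∀ n, Submodule ℝ (flatForms n)
  | 0 => ⊥
  | 1 => ⊥
  | n + 2 => ((flatForms n).map (ePhi n)).comap (flatForms (n + 2)).subtype

/-! ### Deformation retractions and property SLB -/

/-- The operators `(p, h)` on flat forms restrict to a deformation retraction of the subcomplex `S`:
`S` is preserved by `d`, `p` and `h`, and on `S` the map `p` is a cochain projection with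
`p - id = d h + h d`. -/
structure IsDeformationRetraction (S : ∀ n, Submodule ℝ (flatForms n))
    (p : ∀ n, flatForms n →ₗ[ℝ] flatForms n) (h : ∀ n, flatForms (n + 1) →ₗ[ℝ] flatForms n) :
    Prop where
  d_mem : ∀ n, ∀ α ∈ S n, d n α ∈ S (n + 1)
  p_mem : ∀ n, ∀ α ∈ S n, p n α ∈ S n
  h_mem : ∀ n, ∀ α ∈ S (n + 1), h n α ∈ S n
  cochain : ∀ n, ∀ α ∈ S n, p (n + 1) (d n α) = d n (p n α)
  idem : ∀ n, ∀ α ∈ S n, p n (p n α) = p n α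
  homotopy_zero : ∀ α ∈ S 0, p 0 α - α = h 0 (d 0 α)
  homotopy_succ : ∀ n, ∀ α ∈ S (n + 1),
    p (n + 1) α - α = d n (h n α) + h (n + 1) (d (n + 1) α)

/-- Restriction of (the coefficients of) flat forms to the closed ball of radius `r`. -/
def restrictBall (r : ℝ) (n : ℕ) :
    flatForms n →ₗ[ℝ] (Metric.closedBall (0 : SL) r → SL [⋀^Fin n]→L[ℝ] ℝ) where
  toFun α := fun A => α.1 A
  map_add' _ _ := rfl
  map_smul' _ _ := rfl

/-- The flat norm `sup_{|A| ≤ r} sup_{j ≤ n} |A|⁻ᵏ |Dʲα(A)|`, valued in `[0, ∞]`. The size of the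
`j`-th order partial derivatives is measured by the norm of the `j`-th Fréchet derivative; any other
choice of coordinates, trivialisation or normalisation changes this norm only by constant factors
depending on `n`. For a flat form the quotient is zero at the origin. -/
def flatNorm {m : ℕ} (n k : ℕ) (r : ℝ) (α : flatForms m) : ℝ≥0∞ :=
  ⨆ A ∈ Metric.closedBall (0 : SL) r, ⨆ j ≤ n, ‖iteratedFDeriv ℝ j α.1 A‖ₑ / ‖A‖ₑ ^ k

/-- Property SLB ("semi-local and bounded") for `(a, b, c)` of an operator `ℓ : 𝒱 → 𝒲` between
spaces of flat forms: `ℓ` induces linear operators between the restrictions to all closed balls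
around the origin, and `‖ℓ α‖_{n,k,r} ≤ C(r,n,k) ‖α‖_{n+a,k+bn+c,r}` with `C` continuous in `r`. -/
structure PropertySLB {m m' : ℕ} (𝒱 : Submodule ℝ (flatForms m)) (𝒲 : Submodule ℝ (flatForms m'))
    (ℓ : flatForms m →ₗ[ℝ] flatForms m') (a b c : ℕ) : Prop where
  maps : ∀ α ∈ 𝒱, ℓ α ∈ 𝒲
  semilocal : ∀ r : ℝ, 0 < r →
    ∃ ℓr : 𝒱.map (restrictBall r m) →ₗ[ℝ] 𝒲.map (restrictBall r m'),
      ∀ (α : flatForms m) (hα : α ∈ 𝒱),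
        (ℓr ⟨restrictBall r m α, Submodule.mem_map_of_mem hα⟩).1 = restrictBall r m' (ℓ α)
  bounded : ∃ C : ℝ → ℕ → ℕ → ℝ, (∀ n k, ContinuousOn (fun r => C r n k) (Ioi 0)) ∧
    ∀ (r : ℝ) (n k : ℕ), 0 < r → ∀ α ∈ 𝒱,
      flatNorm n k r (ℓ α) ≤ ENNReal.ofReal (C r n k) * flatNorm (n + a) (k + b * n + c) r α

/-! ### The homotopy operators at finite time and their limit -/

/-- `h_t(α) = ∫₀ᵗ i_W φ_s^*(α) ds`. -/
def homotopyAt {n : ℕ} (φ : ℝ → SL → SL) (t : ℝ) (α : Form (n + 1)) : Form n := fun A =>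
  ∫ s in (0 : ℝ)..t, interiorProduct W (pullback (φ s) α) A

/-- Convergence `α_t → β` as `t → ∞` in the compact-open `C^∞`-topology: all derivatives converge
uniformly on compact subsets. -/
def TendstoSmooth {n : ℕ} (α : ℝ → Form n) (β : Form n) : Prop :=
  ∀ (k : ℕ) (K : Set SL), IsCompact K →
    TendstoUniformlyOn (fun t => iteratedFDeriv ℝ k (α t)) (iteratedFDeriv ℝ k β) atTop K

/-! ### Averaging over `SU(2)` -/

/-- The group `SU(2)`. -/
abbrev SU2 : Type := ↥(Matrix.specialUnitaryGroup (Fin 2) ℂ)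

instance instIsTopologicalGroupSU2 : IsTopologicalGroup SU2 where
  continuous_inv := by
    refine Continuous.subtype_mk ?_ _
    exact continuous_star.comp continuous_subtype_val

instance instCompactSpaceSU2 : CompactSpace SU2 := by
  refine isCompact_iff_compactSpace.mp ?_
  have hK : IsCompact (Set.pi univ fun _ : Fin 2 => Set.pi univ fun _ : Fin 2 =>
      Metric.closedBall (0 : ℂ) 1) :=
    isCompact_univ_pi fun _ => isCompact_univ_pi fun _ => isCompact_closedBall _ _
  refine IsCompact.of_isClosed_subset (X := Matrix (Fin 2) (Fin 2) ℂ) hK ?_ ?_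
  · have h : ((Matrix.specialUnitaryGroup (Fin 2) ℂ : Set (Matrix (Fin 2) (Fin 2) ℂ))) =
        {U | U * star U = 1} ∩ {U | U.det = 1} := by
      ext U
      simp [Matrix.mem_specialUnitaryGroup_iff, Matrix.mem_unitaryGroup_iff]
    rw [h]
    refine IsClosed.inter (isClosed_eq ?_ continuous_const) (isClosed_eq ?_ continuous_const)
    · exact continuous_id.matrix_mul continuous_star
    · exact continuous_id.matrix_det
  · intro U hU i _ j _
    have := entry_norm_bound_of_unitary (Matrix.mem_specialUnitaryGroup_iff.mp hU).1 i j
    simpa using this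

instance instMeasurableSpaceSU2 : MeasurableSpace SU2 := borel SU2

instance instBorelSpaceSU2 : BorelSpace SU2 := ⟨rfl⟩

/-- The normalized Haar measure on `SU(2)`. -/
def haarSU2 : Measure SU2 := Measure.haarMeasure ⊤

/-- The action `Ad_U(A) = U A U⁻¹` of `SU(2)` on `sl₂(ℂ)`. -/
def Ad (U : SU2) (A : SL) : SL :=
  SL.ofMat (U.1 * A.mat * (U⁻¹ : SU2).1) (by
    rw [Matrix.mul_assoc, Matrix.trace_mul_comm, Matrix.mul_assoc, ← Submonoid.coe_mul,
      inv_mul_cancel, Submonoid.coe_one, Matrix.mul_one, A.trace_mat])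

/-- The average `∫_{SU(2)} Ad_U^*(α) dμ(U)`. -/
def haarAverage {n : ℕ} (α : Form n) : Form n := fun A =>
  ∫ U, pullback (Ad U) α A ∂haarSU2

end FlatSL2

end

open FlatSL2

noncomputable section

namespace FlatSL2

/-! ### Linear algebra of trace-free matrices -/

/-! By Cayley-Hamilton, `W A = -(|A|²/2) A - f(A) A*`. Inside the real span of `A` and `f(A) A*` the
function `f` changes only by a real factor, and the flow is explicit: with `c = cosh (t|f|)`, `s =
sinh (t|f|)/|f|` and `y = c² + |f|² s² + |A|² c s` it is `φ_t(A) = y^(-1/2) (c A - s f(A) A*)`. It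
preserves `f`. Off the cone `f = 0` it converges, with its first derivative, to the retraction `r`,
because `s/c = tanh (t|f|)/|f|` tends to `1/|f|`; the square root of a positive `2 × 2` matrix gives
the same closed form for `r` (`retraction_eq`).

The analytic core is the convergence of `∫₀^∞ i_W φ_s^* α ds` within flat forms. Each derivative of
the flow costs a factor `(1 + s)²` (`jet_flow`). The contracted slot carries `Dφ_s(W) = W ∘ φ_s`, of
size `c⁻²` (`jet_flowW`): exponential decay off the cone, none on it. Near the cone the flow itself
shrinks, `(1 + s)|φ_s(A)|² ≲ 1 + s|f(A)|` (`one_add_mul_rho_flow_le`), so flatness of `α` supplies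
powers of `1/(1 + s)`, while the powers of `1 + s|f|` are absorbed by `c²`. The balance is struck in
`exists_flow_decay`, where the exponent `5n + 35` appears.

Cartan's formula (`hasDerivAt_pullback_succ`) and the fundamental theorem of calculus identify `id +
dh + hd` with the limit of `φ_t^*`, which is `r^*` off the cone. The complement of the cone is
dense, so idempotence follows from `r ∘ r = r`. Since `φ_t` preserves `f` and `W` is tangent to its
fibres, the operators commute with the exterior product by `df₁ ∧ df₂` and preserve the foliated
complex.

For `SU(2)`, the identity is joined to `Ad U` by conjugation with the normalized segment from `1` to
`±U`, the sign making the trace nonnegative. Cartan's formula, integrated along these paths and over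
the group, gives the homotopy. The paths consist of linear isometries preserving `f`, so no power of
`|A|` is lost.

Finally, let `N = r(A)` with `f(A) ≠ 0`. A complex multiple of `N` lies in `SU(2)`; it fixes `N` and
acts by `-1` on `ker df_N` (`exists_unitary_stabilizer`). An invariant form of odd degree therefore
vanishes on `ker df_N`, and its product with `df₁ ∧ df₂` vanishes at `N`. So the combined retraction
is zero on `𝒞ⁿ` for odd `n`, and for even `n` its composite with `d` factors through odd degree. -/

theorem SL.mat_sub (A B : SL) : (A - B).mat = A.mat - B.mat := rfl
theorem SL.mat_neg (A : SL) : (-A).mat = -A.mat := rfl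
theorem SL.mat_zero : (0 : SL).mat = 0 := rfl

theorem SL.mat_one_one (A : SL) : A.mat 1 1 = -A.mat 0 0 := by
  have h := A.trace_mat
  rw [Matrix.trace_fin_two] at h
  linear_combination h

theorem SL.ext_entries {A B : SL} (h₀ : A.mat 0 0 = B.mat 0 0) (h₁ : A.mat 0 1 = B.mat 0 1)
    (h₂ : A.mat 1 0 = B.mat 1 0) : A = B := by
  refine Subtype.ext (?_ : A.mat = B.mat)
  ext i j
  fin_cases i <;> fin_cases j
  · exact h₀
  · exact h₁
  · exact h₂
  · exact (A.mat_one_one.trans (by rw [h₀])).trans B.mat_one_one.symm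

/-- The three independent entries of a trace-free matrix. -/
def entriesLM : SL →ₗ[ℝ] (Fin 3 → ℂ) where
  toFun A := ![A.mat 0 0, A.mat 0 1, A.mat 1 0]
  map_add' A B := by ext i; fin_cases i <;> rfl
  map_smul' c A := by ext i; fin_cases i <;> rfl

theorem entriesLM_injective : Function.Injective entriesLM := fun _ _ h =>
  SL.ext_entries (congrFun h 0) (congrFun h 1) (congrFun h 2)

instance instFiniteDimensionalSL : FiniteDimensional ℝ SL :=
  FiniteDimensional.of_injective entriesLM entriesLM_injective

/-- The dimension bound makes forms of degree above six vanish, which caps the number of factors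
`Dφ_s` in the decay estimates. -/
theorem finrank_SL_le : Module.finrank ℝ SL ≤ 6 := by
  have h := LinearMap.finrank_le_finrank_of_injective entriesLM_injective
  rw [Module.finrank_pi_fintype] at h
  simpa [Complex.finrank_real_complex] using h

/-- A matrix entry as a continuous linear function. -/
def entry (i j : Fin 2) : SL →L[ℝ] ℂ :=
  LinearMap.toContinuousLinearMap
    { toFun := fun A => A.mat i j
      map_add' := fun _ _ => rfl
      map_smul' := fun _ _ => rfl }

/-- The conjugate transpose as a continuous linear map. -/
def conjTrL : SL →L[ℝ] SL :=
  LinearMap.toContinuousLinearMap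
    { toFun := conjTr
      map_add' := fun A B => Subtype.ext (Matrix.conjTranspose_add A.mat B.mat)
      map_smul' := fun c A => Subtype.ext (by
        change (c • A.mat).conjTranspose = c • A.mat.conjTranspose
        rw [Matrix.conjTranspose_smul, star_trivial]) }

/-- Multiplication by complex scalars on `sl₂(ℂ)`, as a real bilinear map. -/
def cmulLM : ℂ →ₗ[ℝ] SL →ₗ[ℝ] SL :=
  LinearMap.mk₂ ℝ (fun z A => SL.ofMat (z • A.mat) (by rw [Matrix.trace_smul, A.trace_mat, smul_zero]))
    (fun z w A => Subtype.ext (add_smul z w A.mat))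
    (fun c z A => Subtype.ext (smul_assoc c z A.mat))
    (fun z A B => Subtype.ext (smul_add z A.mat B.mat))
    (fun c z A => Subtype.ext (smul_comm z c A.mat))

/-- Multiplication by complex scalars on `sl₂(ℂ)`, as a continuous real bilinear map. -/
def cmul : ℂ →L[ℝ] SL →L[ℝ] SL :=
  LinearMap.toContinuousLinearMap
    ((LinearMap.toContinuousLinearMap : (SL →ₗ[ℝ] SL) ≃ₗ[ℝ] (SL →L[ℝ] SL)).toLinearMap ∘ₗ cmulLM)

theorem mat_cmul (z : ℂ) (A : SL) : (cmul z A).mat = z • A.mat := rfl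

theorem mat_conjTr (A : SL) : (conjTr A).mat = A.mat.conjTranspose := rfl

/-- `|A|²` as a polynomial in the entries. -/
def rho (A : SL) : ℝ :=
  2 * Complex.normSq (A.mat 0 0) + Complex.normSq (A.mat 0 1) + Complex.normSq (A.mat 1 0)

theorem norm_sq_eq_rho (A : SL) : ‖A‖ ^ 2 = rho A := by
  have h := norm_sq_eq_trace A
  rw [Matrix.trace_fin_two, Matrix.mul_apply, Matrix.mul_apply] at h
  simp only [Fin.sum_univ_two, Matrix.conjTranspose_apply, A.mat_one_one, RCLike.star_def,
    Complex.mul_conj] at h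
  have h' := Complex.ofReal_injective (h.trans (by push_cast; rfl :
    _ = ((Complex.normSq (A.mat 0 0) + Complex.normSq (A.mat 0 1) +
      (Complex.normSq (A.mat 1 0) + Complex.normSq (-A.mat 0 0)) : ℝ) : ℂ)))
  rw [h', Complex.normSq_neg, rho]; ring

theorem casimir_eq (A : SL) : casimir A = -(A.mat 0 0) ^ 2 - A.mat 0 1 * A.mat 1 0 := by
  rw [casimir, Matrix.det_fin_two, A.mat_one_one]; ring

theorem rho_nonneg (A : SL) : 0 ≤ rho A := by rw [← norm_sq_eq_rho]; positivity

/-- The vector field `f(A) A*`. -/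
def casimirStar (A : SL) : SL := cmul (casimir A) (conjTr A)

/-- In this form `W` is visibly a combination of `A` and `f(A) A*`, which is why its flow stays in
their span and has a closed formula. -/
theorem W_eq (A : SL) : W A = -((rho A / 2) • A) - casimirStar A := by
  have h11 := A.mat_one_one
  apply SL.ext_entries <;>
  · simp only [W, SL.mat_smul, bracket, SL.mat_ofMat, SL.mat_sub, SL.mat_neg, mat_conjTr,
      Matrix.smul_apply, Matrix.sub_apply, Matrix.neg_apply, Matrix.mul_apply, Fin.sum_univ_two,
      Matrix.conjTranspose_apply, h11, casimirStar, mat_cmul, smul_eq_mul, Complex.real_smul, rho]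
    push_cast
    simp only [casimir_eq, RCLike.star_def, ← Complex.mul_conj, map_neg]
    ring

/-- The squared modulus of the Casimir function. -/
def esq (A : SL) : ℝ := Complex.normSq (casimir A)

theorem esq_eq (A : SL) : esq A = ‖casimir A‖ ^ 2 := Complex.normSq_eq_norm_sq _

theorem casimir_conjTr (A : SL) : casimir (conjTr A) = starRingEnd ℂ (casimir A) :=
  Matrix.det_conjTranspose A.mat

/-- `|f| ≤ |A|² / 2`. -/
theorem norm_casimir_le (A : SL) : 2 * ‖casimir A‖ ≤ rho A := by
  rw [casimir_eq, rho]
  simp only [Complex.normSq_eq_norm_sq]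
  have h1 : ‖-(A.mat 0 0) ^ 2 - A.mat 0 1 * A.mat 1 0‖
      ≤ ‖A.mat 0 0‖ ^ 2 + ‖A.mat 0 1‖ * ‖A.mat 1 0‖ := by
    refine (norm_sub_le _ _).trans ?_
    rw [norm_neg, norm_pow, norm_mul]
  nlinarith [sq_nonneg (‖A.mat 0 1‖ - ‖A.mat 1 0‖)]

theorem esq_le (A : SL) : 4 * esq A ≤ rho A ^ 2 := by
  have h := norm_casimir_le A
  rw [esq_eq]
  nlinarith [norm_nonneg (casimir A), rho_nonneg A]

/-- The squared norm of `p A - q f(A) A*`. -/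
theorem rho_comb (p q : ℝ) (A : SL) :
    rho (p • A - q • casimirStar A) = (p ^ 2 + q ^ 2 * esq A) * rho A + 4 * p * q * esq A := by
  have h11 := A.mat_one_one
  -- Over `ℂ`, with squared moduli written as `z * conj z`, the claim is a polynomial identity in
  -- the entries and their conjugates.
  apply Complex.ofReal_injective
  simp only [rho, esq, SL.mat_smul, SL.mat_sub, casimirStar, mat_cmul, mat_conjTr,
      Matrix.smul_apply, Matrix.sub_apply, Matrix.conjTranspose_apply, smul_eq_mul,
      Complex.real_smul]
  push_cast
  simp only [← Complex.mul_conj, casimir_eq, map_sub, map_mul, map_neg, map_pow, RCLike.star_def,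
    Complex.conj_conj, Complex.conj_ofReal]
  ring

/-- The factor is real, so where it is positive, division by its square root restores the value of
`f`. Both the flow and the retraction are normalized this way. -/
theorem casimir_comb (p q : ℝ) (A : SL) :
    casimir (p • A - q • casimirStar A)
      = (p ^ 2 + q ^ 2 * esq A + p * q * rho A : ℝ) * casimir A := by
  have h11 := A.mat_one_one
  rw [casimir_eq (p • A - q • casimirStar A)]
  simp only [rho, esq, SL.mat_smul, SL.mat_sub, casimirStar, mat_cmul, mat_conjTr,
      Matrix.smul_apply, Matrix.sub_apply, Matrix.conjTranspose_apply, smul_eq_mul,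
      Complex.real_smul]
  push_cast
  simp only [← Complex.mul_conj, casimir_eq, map_sub, map_mul, map_neg, map_pow, RCLike.star_def]
  ring

theorem conjTr_casimirStar (A : SL) :
    conjTr (casimirStar A) = cmul (starRingEnd ℂ (casimir A)) A := by
  apply SL.ext_entries <;>
  simp [mat_conjTr, casimirStar, mat_cmul]

theorem cmul_cmul (z w : ℂ) (A : SL) : cmul z (cmul w A) = cmul (z * w) A := by
  apply SL.ext_entries <;> simp [mat_cmul, mul_assoc]

theorem cmul_ofReal (c : ℝ) (A : SL) : cmul c A = c • A := by
  apply SL.ext_entries <;> simp [mat_cmul, SL.mat_smul]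

/-! ### Smoothness of the basic functions -/

theorem contDiff_casimir : ContDiff ℝ ∞ casimir := by
  have h : casimir = fun A => -(entry 0 0 A) ^ 2 - entry 0 1 A * entry 1 0 A := by
    funext A; exact casimir_eq A
  rw [h]
  fun_prop

theorem contDiff_normSq : ContDiff ℝ ∞ (fun z : ℂ => Complex.normSq z) := by
  have h : (fun z : ℂ => Complex.normSq z) = fun z => z.re * z.re + z.im * z.im := by
    funext z; exact Complex.normSq_apply z
  rw [h]
  exact ((Complex.reCLM.contDiff).mul (Complex.reCLM.contDiff)).add
    ((Complex.imCLM.contDiff).mul (Complex.imCLM.contDiff))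

theorem contDiff_esq : ContDiff ℝ ∞ esq := contDiff_normSq.comp contDiff_casimir

theorem contDiff_rho : ContDiff ℝ ∞ rho := by
  have h : rho = fun A => 2 * Complex.normSq (entry 0 0 A) + Complex.normSq (entry 0 1 A)
      + Complex.normSq (entry 1 0 A) := rfl
  rw [h]
  exact ((contDiff_const.mul (contDiff_normSq.comp (entry 0 0).contDiff)).add
    (contDiff_normSq.comp (entry 0 1).contDiff)).add (contDiff_normSq.comp (entry 1 0).contDiff)

theorem contDiff_casimirStar : ContDiff ℝ ∞ casimirStar :=
  (cmul.contDiff.comp contDiff_casimir).clm_apply conjTrL.contDiff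

section Retraction

open scoped ComplexOrder

/-! ### The retraction onto the normal matrices -/

theorem mat_mul_mat (A : SL) : A.mat * A.mat = -(casimir A • (1 : Matrix (Fin 2) (Fin 2) ℂ)) := by
  have h := A.mat_one_one
  ext i j
  fin_cases i <;> fin_cases j <;>
  simp [Matrix.mul_apply, Fin.sum_univ_two, h, casimir_eq] <;> ring

/-- The Cayley-Hamilton identity `A A* A = |A|² A + f(A) A*`. -/
theorem mat_mul_conj_mul (A : SL) : A.mat * A.mat.conjTranspose * A.mat
    = rho A • A.mat + casimir A • A.mat.conjTranspose := by
  have h := A.mat_one_one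
  ext i j
  fin_cases i <;> fin_cases j <;>
  · simp only [Matrix.mul_apply, Fin.sum_univ_two, h, casimir_eq, rho, Matrix.add_apply,
      Matrix.smul_apply, Matrix.conjTranspose_apply, smul_eq_mul, Complex.real_smul,
      RCLike.star_def, Fin.zero_eta, Fin.isValue, Fin.mk_one, map_neg]
    push_cast
    simp only [← Complex.mul_conj]
    ring

theorem conj_mul_conj (A : SL) : A.mat.conjTranspose * A.mat.conjTranspose
    = -(starRingEnd ℂ (casimir A) • (1 : Matrix (Fin 2) (Fin 2) ℂ)) := by
  have h := mat_mul_mat (conjTr A)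
  rwa [casimir_conjTr] at h

/-- A formula for the square root of `1 + A A* / |f(A)|`. -/
theorem gInfty_eq {A : SL} (hA : casimir A ≠ 0) {r s : ℝ} (hr0 : 0 ≤ r) (hs : 0 < s)
    (hr : r ^ 2 = 2 + rho A / ‖casimir A‖) (hsr : s ^ 2 = r ^ 2 + 2 * r) :
    gInfty A = s⁻¹ • (1 + (‖casimir A‖⁻¹ : ℝ) • (A.mat * A.mat.conjTranspose) + r • 1) := by
  set x := ‖casimir A‖ with hx
  have hx0 : 0 < x := norm_pos_iff.2 hA
  set E := A.mat * A.mat.conjTranspose with hE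
  have hEE : E * E = rho A • E - (x ^ 2) • 1 := by
    have h1 : E * E = (A.mat * A.mat.conjTranspose * A.mat) * A.mat.conjTranspose := by
      simp only [hE, Matrix.mul_assoc]
    rw [h1, mat_mul_conj_mul, add_mul, Matrix.smul_mul, Matrix.smul_mul, conj_mul_conj, smul_neg,
      smul_smul, Complex.mul_conj, Complex.normSq_eq_norm_sq, ← sub_eq_add_neg, ← hx]
    congr 1
  have hEpos : E.PosSemidef := Matrix.posSemidef_self_mul_conjTranspose A.mat
  -- For `M = 1 + E/x` the trace and the determinant both equal `r²`, so Cayley-Hamilton gives `(M +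
  -- r)² = (r² + 2r) M = s² M`.
  refine CFC.sqrt_unique ?_ ?_
  · have key : (1 + x⁻¹ • E + r • 1) * (1 + x⁻¹ • E + r • 1)
        = (s ^ 2) • (1 + x⁻¹ • E) := by
      have h2 : (1 + x⁻¹ • E + r • (1 : Matrix (Fin 2) (Fin 2) ℂ)) = (1 + r) • 1 + x⁻¹ • E := by
        module
      rw [h2, add_mul, mul_add, mul_add]
      simp only [Matrix.smul_mul, Matrix.mul_smul, one_mul, mul_one, hEE, smul_smul, smul_sub]
      have h3 : rho A = (r ^ 2 - 2) * x := by rw [hr]; field_simp; ring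
      rw [hsr, h3]
      have h4 : x⁻¹ * (x⁻¹ * ((r ^ 2 - 2) * x)) = x⁻¹ * (r ^ 2 - 2) := by field_simp
      have h5 : x⁻¹ * (x⁻¹ * x ^ 2) = 1 := by field_simp
      rw [h4, h5]
      module
    rw [Matrix.smul_mul, Matrix.mul_smul, key, smul_smul, smul_smul]
    have : s⁻¹ * s⁻¹ * s ^ 2 = 1 := by field_simp
    rw [this, one_smul]
  · refine Matrix.nonneg_iff_posSemidef.2 (Matrix.PosSemidef.smul ?_ (by positivity))
    exact (Matrix.PosSemidef.one.add (hEpos.smul (by positivity))).add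
      (Matrix.PosSemidef.one.smul hr0)

/-- An explicit formula for the retraction. -/
theorem retraction_eq {A : SL} (hA : casimir A ≠ 0) : retraction A =
    (√(2 + rho A / ‖casimir A‖))⁻¹ • (A - (‖casimir A‖⁻¹ : ℝ) • casimirStar A) := by
  have hx0 : 0 < ‖casimir A‖ := norm_pos_iff.2 hA
  have hD : 0 < 2 + rho A / ‖casimir A‖ := by have := rho_nonneg A; positivity
  rw [retraction, if_neg hA]
  set r := √(2 + rho A / ‖casimir A‖) with hr
  have hr0 : 0 < r := Real.sqrt_pos.2 hD
  have hr2 : r ^ 2 = 2 + rho A / ‖casimir A‖ := Real.sq_sqrt hD.le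
  set s := √(r ^ 2 + 2 * r) with hs
  have hs0 : 0 < s := Real.sqrt_pos.2 (by positivity)
  have hs2 : s ^ 2 = r ^ 2 + 2 * r := Real.sq_sqrt (by positivity)
  have hg := gInfty_eq hA hr0.le hs0 hr2 hs2
  set x := ‖casimir A‖ with hx
  set g := gInfty A
  set E := A.mat * A.mat.conjTranspose with hE
  have hEA : E * A.mat = rho A • A.mat + casimir A • A.mat.conjTranspose := mat_mul_conj_mul A
  have hAE : A.mat * E = -(casimir A • A.mat.conjTranspose) := by
    rw [hE, ← Matrix.mul_assoc, mat_mul_mat]; simp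
  have hEN : E * (casimir A • A.mat.conjTranspose) = -((x ^ 2) • A.mat) := by
    rw [Matrix.mul_smul, hE, Matrix.mul_assoc, conj_mul_conj, Matrix.mul_neg, Matrix.mul_smul,
      mul_one, smul_neg, smul_smul, Complex.mul_conj, Complex.normSq_eq_norm_sq]
    congr 1
  have hEE : E * E = rho A • E - (x ^ 2) • 1 := by
    have h1 : E * E = (E * A.mat) * A.mat.conjTranspose := by
      simp only [hE, Matrix.mul_assoc]
    rw [h1, hEA, add_mul, Matrix.smul_mul, Matrix.smul_mul, conj_mul_conj, smul_neg,
      smul_smul, Complex.mul_conj, Complex.normSq_eq_norm_sq, ← sub_eq_add_neg, ← hx]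
    congr 1
  have h3 : rho A = (r ^ 2 - 2) * x := by rw [hr2]; field_simp; ring
  have hunit : IsUnit g.det := by
    -- With `M = 1 + E/x`, the second factor is the adjugate of `M + r` (its first scalar collapses
    -- to `r²`), and the product is `det (M + r) = 2r² + r³`.
    have h1 : (1 + x⁻¹ • E + r • 1) * ((r ^ 2 - 1 - r ^ 2 + r + 1 + r ^ 2 - r) • 1
        - ((1 : Matrix (Fin 2) (Fin 2) ℂ) + x⁻¹ • E) + r • 1) = (2 * r ^ 2 + r ^ 3) • 1 := by
      have h2 : (1 + x⁻¹ • E + r • (1 : Matrix (Fin 2) (Fin 2) ℂ)) = (1 + r) • 1 + x⁻¹ • E := by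
        module
      have h4 : ((r ^ 2 - 1 - r ^ 2 + r + 1 + r ^ 2 - r) • 1
        - ((1 : Matrix (Fin 2) (Fin 2) ℂ) + x⁻¹ • E) + r • 1) = (r ^ 2 - 1 + r) • 1 - x⁻¹ • E := by
        module
      rw [h2, h4, add_mul, mul_sub, mul_sub]
      simp only [Matrix.smul_mul, Matrix.mul_smul, one_mul, mul_one, hEE, smul_smul, smul_sub]
      rw [h3]
      have h4 : x⁻¹ * (x⁻¹ * ((r ^ 2 - 2) * x)) = x⁻¹ * (r ^ 2 - 2) := by field_simp
      have h5 : x⁻¹ * (x⁻¹ * x ^ 2) = 1 := by field_simp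
      rw [h4, h5]
      module
    have h2 := congrArg Matrix.det h1
    rw [Matrix.det_mul, Matrix.det_fin_two ((2 * r ^ 2 + r ^ 3) • (1 : Matrix (Fin 2) (Fin 2) ℂ))]
      at h2
    have h6 : (1 + x⁻¹ • E + r • 1 : Matrix (Fin 2) (Fin 2) ℂ).det ≠ 0 := by
      intro h
      rw [h, zero_mul] at h2
      have h7 : (2 * r ^ 2 + r ^ 3 : ℝ) ≠ 0 := by positivity
      simp at h2
      exact h7 (by apply Complex.ofReal_injective; push_cast at h2 ⊢; exact h2)
    rw [hg, isUnit_iff_ne_zero]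
    have h8 : (s⁻¹ • (1 + x⁻¹ • E + r • 1) : Matrix (Fin 2) (Fin 2) ℂ)
        = ((s⁻¹ : ℝ) : ℂ) • (1 + x⁻¹ • E + r • 1) 
      := by ext i j; simp [mul_add]
    rw [h8, Matrix.det_smul]
    refine mul_ne_zero (pow_ne_zero _ ?_) h6
    exact_mod_cast inv_ne_zero hs0.ne'
  refine Subtype.ext (?_ : g⁻¹ * A.mat * g = r⁻¹ • (A.mat - x⁻¹ • (casimir A • A.mat.conjTranspose)))
  -- The inverse of `g` need not be computed: it suffices to check `A g = g r(A)`.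
  have hcomm : A.mat * g = g * (r⁻¹ • (A.mat - x⁻¹ • (casimir A • A.mat.conjTranspose))) := by
    rw [hg, Matrix.mul_smul, Matrix.smul_mul]
    congr 1
    generalize casimir A • A.mat.conjTranspose = N at hEA hAE hEN
    simp only [mul_add, add_mul, Matrix.mul_smul, Matrix.smul_mul, mul_one, one_mul, mul_sub, hEA,
      hAE, hEN, h3]
    match_scalars <;> field_simp <;> ring
  rw [Matrix.mul_assoc, hcomm, ← Matrix.mul_assoc, Matrix.nonsing_inv_mul g hunit, one_mul]

theorem retraction_of_casimir_eq_zero {A : SL} (hA : casimir A = 0) : retraction A = 0 := if_pos hA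

theorem retraction_eq_comb {A : SL} (hA : casimir A ≠ 0) : retraction A =
    (√(2 + rho A / ‖casimir A‖))⁻¹ • A
      - ((√(2 + rho A / ‖casimir A‖))⁻¹ * ‖casimir A‖⁻¹) • casimirStar A := by
  rw [retraction_eq hA, smul_sub, smul_smul]

/-- The norm of `r(A)` depends on `f(A)` alone and tends to zero at the cone; this is the continuity
of `r` there. -/
theorem rho_retraction (A : SL) : rho (retraction A) = 2 * ‖casimir A‖ := by
  by_cases hA : casimir A = 0
  · rw [retraction_of_casimir_eq_zero hA, hA, ← norm_sq_eq_rho]; simp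
  · have hx0 : 0 < ‖casimir A‖ := norm_pos_iff.2 hA
    have hD : 0 < 2 + rho A / ‖casimir A‖ := by have := rho_nonneg A; positivity
    rw [retraction_eq_comb hA, rho_comb, esq_eq]
    set r := √(2 + rho A / ‖casimir A‖) with hr
    have hr0 : 0 < r := Real.sqrt_pos.2 hD
    have hr2 : r ^ 2 = 2 + rho A / ‖casimir A‖ := Real.sq_sqrt hD.le
    have h3 : rho A = (r ^ 2 - 2) * ‖casimir A‖ := by rw [hr2]; field_simp; ring
    rw [h3]; field_simp; ring

theorem casimir_retraction (A : SL) : casimir (retraction A) = casimir A := by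
  by_cases hA : casimir A = 0
  · rw [retraction_of_casimir_eq_zero hA, hA, casimir_eq]; simp [SL.mat_zero]
  · have hx0 : 0 < ‖casimir A‖ := norm_pos_iff.2 hA
    have hD : 0 < 2 + rho A / ‖casimir A‖ := by have := rho_nonneg A; positivity
    rw [retraction_eq_comb hA, casimir_comb, esq_eq]
    set r := √(2 + rho A / ‖casimir A‖) with hr
    have hr0 : 0 < r := Real.sqrt_pos.2 hD
    have hr2 : r ^ 2 = 2 + rho A / ‖casimir A‖ := Real.sq_sqrt hD.le
    have h3 : rho A = (r ^ 2 - 2) * ‖casimir A‖ := by rw [hr2]; field_simp; ring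
    have h4 : (r⁻¹ ^ 2 + (r⁻¹ * ‖casimir A‖⁻¹) ^ 2 * ‖casimir A‖ ^ 2
        + r⁻¹ * (r⁻¹ * ‖casimir A‖⁻¹) * rho A) = 1 := by
      rw [h3]; field_simp; ring
    rw [h4]; simp

theorem conjTr_smul (c : ℝ) (A : SL) : conjTr (c • A) = c • conjTr A := conjTrL.map_smul c A

theorem conjTr_sub (A B : SL) : conjTr (A - B) = conjTr A - conjTr B := conjTrL.map_sub A B

theorem bracket_self_smul (z : ℂ) (A : SL) : bracket A (cmul z A) = 0 := by
  refine Subtype.ext (?_ : A.mat * (z • A.mat) - (z • A.mat) * A.mat = 0)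
  rw [Matrix.mul_smul, Matrix.smul_mul, sub_self]

/-- Proportionality to the adjoint is what makes `r(A)` normal; later it turns a complex multiple of
`r(A)` into an element of `SU(2)`. -/
theorem conjTr_retraction {A : SL} (hA : casimir A ≠ 0) : conjTr (retraction A) =
    cmul (-(starRingEnd ℂ (casimir A)) * (‖casimir A‖⁻¹ : ℝ)) (retraction A) := by
  have hx0 : 0 < ‖casimir A‖ := norm_pos_iff.2 hA
  have h1 : conjTr A = cmul ((starRingEnd ℂ (casimir A)) * ((‖casimir A‖ ^ 2)⁻¹ : ℝ))
      (casimirStar A) := by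
    rw [casimirStar, cmul_cmul]
    have : starRingEnd ℂ (casimir A) * ((‖casimir A‖ ^ 2)⁻¹ : ℝ) * casimir A = 1 := by
      rw [mul_right_comm, mul_comm (starRingEnd ℂ _), Complex.mul_conj, Complex.normSq_eq_norm_sq,
        ← Complex.ofReal_mul, mul_inv_cancel₀ (by positivity), Complex.ofReal_one]
    rw [this]
    simpa using (cmul_ofReal 1 (conjTr A)).symm
  rw [retraction_eq hA, conjTr_smul, conjTr_sub, conjTr_smul, conjTr_casimirStar, h1]
  simp only [← cmul_ofReal, cmul_cmul, map_sub, ← mul_assoc]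
  rw [sub_eq_add_neg, add_comm, sub_eq_add_neg]
  have e1 : ∀ (z : ℂ) (B : SL), -(cmul z B) = cmul (-z) B := by intro z B; simp
  simp only [e1]
  congr 3
  · ring
  · push_cast
    field_simp

theorem retraction_mem_skeleton (A : SL) : retraction A ∈ skeleton := by
  change bracket _ _ = 0
  by_cases hA : casimir A = 0
  · rw [retraction_of_casimir_eq_zero hA]
    refine Subtype.ext (?_ : (0 : SL).mat * _ - _ * (0 : SL).mat = 0)
    rw [SL.mat_zero, zero_mul, mul_zero, sub_self]
  · rw [conjTr_retraction hA, bracket_self_smul]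

theorem W_eq_zero_of_mem_skeleton {A : SL} (hA : A ∈ skeleton) : W A = 0 := by
  have h : bracket A (conjTr A) = 0 := hA
  rw [W, h]
  have : bracket A 0 = 0 := by
    refine Subtype.ext (?_ : _ * (0 : SL).mat - (0 : SL).mat * _ = 0)
    rw [SL.mat_zero, zero_mul, mul_zero, sub_self]
  rw [this, smul_zero]

/-- The squared norm of `W` is `ρ (ρ² - 4|f|²)/4`, and `W` vanishes on normal matrices. -/
theorem rho_of_mem_skeleton {A : SL} (hA : A ∈ skeleton) : rho A = 2 * ‖casimir A‖ := by
  have h := W_eq_zero_of_mem_skeleton hA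
  rw [W_eq] at h
  have h1 : rho ((rho A / 2) • A - (-1 : ℝ) • casimirStar A) = 0 := by
    have : (rho A / 2) • A - (-1 : ℝ) • casimirStar A = -(-((rho A / 2) • A) - casimirStar A) := by
      module
    rw [this, h, ← norm_sq_eq_rho]; simp
  rw [rho_comb, esq_eq] at h1
  have hr := rho_nonneg A
  have hle := norm_casimir_le A
  rcases hr.eq_or_lt with h0 | h0
  · have := norm_nonneg (casimir A); linarith
  · have h2 : rho A * ((rho A - 2 * ‖casimir A‖) * (rho A + 2 * ‖casimir A‖)) = 0 := by
      linear_combination 4 * h1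
    rcases mul_eq_zero.1 h2 with h3 | h3
    · exact absurd h3 h0.ne'
    · rcases mul_eq_zero.1 h3 with h4 | h4
      · linarith
      · have := norm_nonneg (casimir A); linarith

theorem retraction_of_mem_skeleton {A : SL} (hA : A ∈ skeleton) : retraction A = A := by
  have hr := rho_of_mem_skeleton hA
  by_cases hf : casimir A = 0
  · rw [retraction_of_casimir_eq_zero hf]
    rw [hf, ← norm_sq_eq_rho] at hr
    have h0 : A = 0 := by simpa using hr
    exact h0.symm
  · have hx0 : 0 < ‖casimir A‖ := norm_pos_iff.2 hf
    have h := W_eq_zero_of_mem_skeleton hA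
    rw [W_eq, hr] at h
    -- With `ρ = 2|f|`, the vanishing of `W` reads `f A* = -|f| A`. In the formula for `r` the
    -- bracket becomes `2A` and the square root becomes `2`.
    have h1 : casimirStar A = -(‖casimir A‖ • A) := by
      have h2 : casimirStar A = -((2 * ‖casimir A‖ / 2) • A) := by
        rw [← sub_eq_zero, ← neg_eq_zero]; rw [← h]; abel
      rw [h2]; congr 2; ring
    have h4 : √(2 + rho A / ‖casimir A‖) = 2 := by
      rw [hr]
      have : 2 + 2 * ‖casimir A‖ / ‖casimir A‖ = 2 ^ 2 := by field_simp; norm_num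
      rw [this]; exact Real.sqrt_sq (by norm_num)
    rw [retraction_eq hf, h1, h4, smul_neg, smul_smul, inv_mul_cancel₀ hx0.ne']
    module

theorem contDiffOn_retraction : ContDiffOn ℝ ∞ retraction {A | casimir A ≠ 0} := by
  have h : ∀ A ∈ {A | casimir A ≠ 0}, retraction A =
    (√(2 + rho A / ‖casimir A‖))⁻¹ • (A - (‖casimir A‖⁻¹ : ℝ) • casimirStar A) :=
    fun A hA => retraction_eq hA
  refine ContDiffOn.congr ?_ h
  intro A hA
  have hA : casimir A ≠ 0 := hA
  have hx0 : 0 < ‖casimir A‖ := norm_pos_iff.2 hA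
  have hn : ContDiffAt ℝ ∞ (fun A => ‖casimir A‖) A := contDiff_casimir.contDiffAt.norm ℝ hA
  have hD : 0 < 2 + rho A / ‖casimir A‖ := by have := rho_nonneg A; positivity
  refine ContDiffAt.contDiffWithinAt ?_
  have h1 : ContDiffAt ℝ ∞ (fun A => 2 + rho A / ‖casimir A‖) A :=
    contDiffAt_const.add (contDiff_rho.contDiffAt.div hn hx0.ne')
  refine ContDiffAt.smul ((h1.sqrt hD.ne').inv (Real.sqrt_pos.2 hD).ne') ?_
  exact contDiffAt_id.sub ((hn.inv hx0.ne').smul contDiff_casimirStar.contDiffAt)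

theorem isOpen_casimir_ne_zero : IsOpen {A : SL | casimir A ≠ 0} :=
  isOpen_ne_fun contDiff_casimir.continuous continuous_const

theorem contDiffAt_retraction {A : SL} (hA : casimir A ≠ 0) : ContDiffAt ℝ ∞ retraction A :=
  contDiffOn_retraction.contDiffAt (isOpen_casimir_ne_zero.mem_nhds hA)

theorem continuous_retraction : Continuous retraction := by
  rw [continuous_iff_continuousAt]
  intro A
  by_cases hA : casimir A = 0
  · have h0 : retraction A = 0 := retraction_of_casimir_eq_zero hA
    rw [ContinuousAt, h0, tendsto_zero_iff_norm_tendsto_zero]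
    have h1 : ∀ B, ‖retraction B‖ = √(2 * ‖casimir B‖) := fun B => by
      rw [← rho_retraction, ← norm_sq_eq_rho, Real.sqrt_sq (norm_nonneg _)]
    simp only [h1]
    have h2 : Continuous fun B => √(2 * ‖casimir B‖) :=
      (continuous_const.mul contDiff_casimir.continuous.norm).sqrt
    have := h2.tendsto A
    simpa [hA] using this
  · exact (contDiffAt_retraction hA).continuousAt

theorem range_retraction : range retraction = skeleton :=
  Subset.antisymm (range_subset_iff.2 retraction_mem_skeleton)
    fun A hA => ⟨A, retraction_of_mem_skeleton hA⟩

/-- Parallelogram identity for the quadratic form `f`. If `f(B) ≠ 0` and `s ≠ 0`, then `f` cannot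
vanish at both `A + sB` and `A - sB`, whence the density of its nonvanishing set. -/
theorem casimir_add_smul_sum (A B : SL) (s : ℝ) (hA : casimir A = 0) :
    casimir (A + s • B) + casimir (A + (-s) • B) = 2 * s ^ 2 * casimir B := by
  rw [casimir_eq] at hA
  simp only [casimir_eq, SL.mat_add, SL.mat_smul, Matrix.add_apply, Matrix.smul_apply,
    Complex.real_smul]
  push_cast
  linear_combination 2 * hA

theorem dense_casimir_ne_zero : Dense {A : SL | casimir A ≠ 0} := by
  set B : SL := SL.ofMat !![1, 0; 0, -1] (by simp [Matrix.trace_fin_two]) with hB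
  have hfB : casimir B ≠ 0 := by rw [casimir_eq, hB]; simp [SL.mat_ofMat]
  intro A
  by_cases hA : casimir A = 0
  · rw [mem_closure_iff_nhds]
    intro U hU
    have hc : ∀ c : ℝ, Tendsto (fun s : ℝ => A + (c * s) • B) (𝓝 0) (𝓝 A) := fun c => by
      have : Continuous fun s : ℝ => A + (c * s) • B := by fun_prop
      simpa using this.tendsto 0
    have h1 := (hc 1).eventually hU
    have h2 := (hc (-1)).eventually hU
    obtain ⟨s, ⟨hs1, hs2⟩, hs⟩ := ((h1.and h2).filter_mono nhdsWithin_le_nhds |>.and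
      (self_mem_nhdsWithin : {s : ℝ | s ≠ 0} ∈ 𝓝[≠] (0 : ℝ))).exists
    have hs : s ≠ 0 := hs
    rw [one_mul] at hs1
    rw [neg_one_mul] at hs2
    by_contra hne
    rw [Set.not_nonempty_iff_eq_empty] at hne
    have e1 : casimir (A + s • B) = 0 := by
      by_contra h; exact (hne.subset ⟨hs1, h⟩ : _ ∈ (∅ : Set SL))
    have e2 : casimir (A + (-s) • B) = 0 := by
      by_contra h; exact (hne.subset ⟨hs2, h⟩ : _ ∈ (∅ : Set SL))
    have h3 := casimir_add_smul_sum A B s hA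
    rw [e1, e2, add_zero] at h3
    have : (2 : ℂ) * s ^ 2 * casimir B ≠ 0 := by
      refine mul_ne_zero (mul_ne_zero two_ne_zero (pow_ne_zero _ ?_)) hfB
      exact_mod_cast hs
    exact this h3.symm
  · exact subset_closure hA

end Retraction

set_option maxSynthPendingDepth 3

/-! ### Algebra of forms -/

theorem minSmoothness_two_le : minSmoothness ℝ 2 ≤ (∞ : ℕ∞ω) := by
  rw [minSmoothness_of_isRCLikeNormedField]
  exact WithTop.coe_le_coe.2 le_top


open ContinuousAlternatingMap in
theorem wedge_apply {n : ℕ} (θ : SL → SL →L[ℝ] ℝ) (β : Form n) (A : SL) (v : Fin (n + 1) → SL) :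
    wedge θ β A v = ∑ i : Fin (n + 1), (-1 : ℝ) ^ (i : ℕ) * (θ A (v i) * β A (i.removeNth v)) := by
  change alternatizeUncurryFin ((θ A).smulRight (β A)) v = _
  rw [alternatizeUncurryFin_apply]
  refine Finset.sum_congr rfl fun i _ => ?_
  rw [ContinuousLinearMap.smulRight_apply, zsmul_eq_mul]
  push_cast
  rfl

theorem pullback_apply {n : ℕ} (F : SL → SL) (α : Form n) (A : SL) (v : Fin n → SL) :
    pullback F α A v = α (F A) (fun i => fderiv ℝ F A (v i)) := rfl

theorem interiorProduct_apply {n : ℕ} (V : SL → SL) (α : Form (n + 1)) (A : SL) (v : Fin n → SL) :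
    interiorProduct V α A v = α A (Fin.cons (V A) v) := rfl

theorem interiorProduct_add {n : ℕ} (V : SL → SL) (α β : Form (n + 1)) :
    interiorProduct V (α + β) = interiorProduct V α + interiorProduct V β := rfl

theorem pullback_add {n : ℕ} (F : SL → SL) (α β : Form n) :
    pullback F (α + β) = pullback F α + pullback F β := rfl

theorem pullback_smul {n : ℕ} (F : SL → SL) (c : ℝ) (α : Form n) :
    pullback F (c • α) = c • pullback F α := rfl

theorem interiorProduct_smul {n : ℕ} (V : SL → SL) (c : ℝ) (α : Form (n + 1)) :
    interiorProduct V (c • α) = c • interiorProduct V α := rfl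

theorem pullback_comp {n : ℕ} {F G : SL → SL} {α : Form n} {A : SL}
    (hF : DifferentiableAt ℝ F A) (hG : DifferentiableAt ℝ G (F A)) :
    pullback F (pullback G α) A = pullback (G ∘ F) α A := by
  ext v
  simp only [pullback_apply, fderiv_comp A hG hF]
  rfl

theorem pullback_congr {n : ℕ} {F G : SL → SL} {α : Form n} {A : SL} (h : F =ᶠ[𝓝 A] G) :
    pullback F α A = pullback G α A := by
  rw [pullback, pullback, h.fderiv_eq, h.eq_of_nhds]

/-- Pullback of a wedge product with an exact covector field preserved by the map. -/
theorem pullback_wedge {n : ℕ} {F : SL → SL} {f : SL → ℝ} {β : Form n} {A : SL}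
    (hF : DifferentiableAt ℝ F A) (hf : DifferentiableAt ℝ f (F A)) (hfF : f ∘ F =ᶠ[𝓝 A] f) :
    pullback F (wedge (fderiv ℝ f) β) A = wedge (fderiv ℝ f) (pullback F β) A := by
  ext v
  rw [pullback_apply, wedge_apply, wedge_apply]
  refine Finset.sum_congr rfl fun i _ => ?_
  have h : fderiv ℝ f A (v i) = fderiv ℝ f (F A) (fderiv ℝ F A (v i)) := by
    rw [← hfF.fderiv_eq, fderiv_comp A hf hF]; rfl
  rw [h]
  rfl

/-- Contraction is an antiderivation, and the term containing `θ(V)` drops out. -/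
theorem interiorProduct_wedge {n : ℕ} {V : SL → SL} {θ : SL → SL →L[ℝ] ℝ} {β : Form (n + 1)}
    {A : SL} (h : θ A (V A) = 0) :
    interiorProduct V (wedge θ β) A = -wedge θ (interiorProduct V β) A := by
  ext v
  rw [interiorProduct_apply, wedge_apply, Fin.sum_univ_succ]
  have h0 : (Fin.cons (V A) v : Fin (n + 2) → SL) 0 = V A := rfl
  rw [h0, h, zero_mul, mul_zero, zero_add]
  change _ = -(wedge θ (interiorProduct V β) A v)
  rw [wedge_apply, ← Finset.sum_neg_distrib]
  refine Finset.sum_congr rfl fun i _ => ?_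
  rw [Fin.cons_succ, interiorProduct_apply]
  have h1 : (i.succ.removeNth (Fin.cons (V A) v : Fin (n + 2) → SL))
      = Fin.cons (V A) (i.removeNth v) := by
    funext j
    refine Fin.cases ?_ (fun j => ?_) j
    · simp [Fin.removeNth]
    · simp [Fin.removeNth]
  rw [h1, Fin.val_succ, pow_succ]
  ring

/-- A function has no contraction, so degree zero needs its own version. -/
theorem interiorProduct_wedge_zero {V : SL → SL} {θ : SL → SL →L[ℝ] ℝ} {β : Form 0}
    {A : SL} (h : θ A (V A) = 0) :
    interiorProduct V (wedge θ β) A = 0 := by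
  ext v
  rw [interiorProduct_apply, wedge_apply]
  simp [h]

theorem wedge_congr {n : ℕ} {θ : SL → SL →L[ℝ] ℝ} {β γ : Form n} {A : SL} (h : β A = γ A) :
    wedge θ β A = wedge θ γ A := by
  ext v; rw [wedge_apply, wedge_apply, h]

theorem wedge_neg_apply {n : ℕ} {θ : SL → SL →L[ℝ] ℝ} {β γ : Form n} {A : SL} (h : β A = -γ A) :
    wedge θ β A = -wedge θ γ A := by
  rw [wedge_congr (γ := -γ) h, map_neg]; rfl

/-- The real part of the Casimir function. -/
def casimirRe (A : SL) : ℝ := (casimir A).re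
/-- The imaginary part of the Casimir function. -/
def casimirIm (A : SL) : ℝ := (casimir A).im

theorem contDiff_casimirRe : ContDiff ℝ ∞ casimirRe := Complex.reCLM.contDiff.comp contDiff_casimir
theorem contDiff_casimirIm : ContDiff ℝ ∞ casimirIm := Complex.imCLM.contDiff.comp contDiff_casimir

theorem ePhi_apply {n : ℕ} (β : Form n) :
    ePhi n β = wedge (fderiv ℝ casimirRe) (wedge (fderiv ℝ casimirIm) β) := rfl

theorem ePhi_congr {n : ℕ} {β γ : Form n} {A : SL} (h : β A = γ A) :
    ePhi n β A = ePhi n γ A := wedge_congr (wedge_congr h)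

theorem pullback_ePhi {n : ℕ} {F : SL → SL} {β : Form n} {A : SL}
    (hF : DifferentiableAt ℝ F A) (hfF : casimir ∘ F =ᶠ[𝓝 A] casimir) :
    pullback F (ePhi n β) A = ePhi n (pullback F β) A := by
  rw [ePhi_apply, ePhi_apply, pullback_wedge hF
    (contDiff_casimirRe.differentiable (by simp) _) (hfF.mono fun B hB => congrArg Complex.re hB)]
  exact wedge_congr (pullback_wedge hF (contDiff_casimirIm.differentiable (by simp) _)
    (hfF.mono fun B hB => congrArg Complex.im hB))

/-- The signs from passing `df₁` and `df₂` cancel. -/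
theorem interiorProduct_ePhi {n : ℕ} {V : SL → SL} {β : Form (n + 1)} {A : SL}
    (h1 : fderiv ℝ casimirRe A (V A) = 0) (h2 : fderiv ℝ casimirIm A (V A) = 0) :
    interiorProduct V (ePhi (n + 1) β) A = ePhi n (interiorProduct V β) A := by
  rw [ePhi_apply, ePhi_apply, interiorProduct_wedge h1]
  rw [wedge_neg_apply (interiorProduct_wedge h2), neg_neg]

theorem interiorProduct_ePhi_zero {V : SL → SL} {β : Form 0} {A : SL}
    (h1 : fderiv ℝ casimirRe A (V A) = 0) (h2 : fderiv ℝ casimirIm A (V A) = 0) :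
    interiorProduct V (ePhi 0 β) A = 0 := by
  rw [ePhi_apply, interiorProduct_wedge h1]
  rw [wedge_congr (γ := 0) (interiorProduct_wedge_zero h2), map_zero]
  exact neg_zero

/-- The pointwise wedge product with a covector, as a continuous linear map. -/
def wedgeL (n : ℕ) (θ : SL →L[ℝ] ℝ) : SL [⋀^Fin n]→L[ℝ] ℝ →L[ℝ] SL [⋀^Fin (n + 1)]→L[ℝ] ℝ :=
  ContinuousAlternatingMap.alternatizeUncurryFinCLM ℝ SL ℝ ∘L
    ContinuousLinearMap.smulRightL ℝ SL (SL [⋀^Fin n]→L[ℝ] ℝ) θ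

theorem contDiff_wedge {n : ℕ} {θ : SL → SL →L[ℝ] ℝ} {β : Form n} (hθ : ContDiff ℝ ∞ θ)
    (hβ : ContDiff ℝ ∞ β) : ContDiff ℝ ∞ (wedge θ β) := by
  have : wedge θ β = fun A => ContinuousAlternatingMap.alternatizeUncurryFinCLM ℝ SL ℝ
    (ContinuousLinearMap.smulRightL ℝ SL (SL [⋀^Fin n]→L[ℝ] ℝ) (θ A) (β A)) := rfl
  rw [this]
  exact (ContinuousLinearMap.contDiff _).comp
    (((ContinuousLinearMap.smulRightL ℝ SL (SL [⋀^Fin n]→L[ℝ] ℝ)).contDiff.comp hθ).clm_apply hβ)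

open ContinuousAlternatingMap in
/-- `d (df ∧ β) = -df ∧ dβ`. -/
theorem extDeriv_wedge {n : ℕ} {f : SL → ℝ} {β : Form n} (hf : ContDiff ℝ ∞ f)
    (hβ : ContDiff ℝ ∞ β) (A : SL) :
    extDeriv (wedge (fderiv ℝ f) β) A = -wedge (fderiv ℝ f) (extDeriv β) A := by
  have hdf : ContDiff ℝ ∞ (fderiv ℝ f) := hf.fderiv_right (mod_cast le_rfl)
  let B : (SL →L[ℝ] ℝ) →L[ℝ] (SL [⋀^Fin n]→L[ℝ] ℝ) →L[ℝ] (SL →L[ℝ] SL [⋀^Fin n]→L[ℝ] ℝ) :=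
    ContinuousLinearMap.smulRightL ℝ SL (SL [⋀^Fin n]→L[ℝ] ℝ)
  have h1 := B.hasFDerivAt_of_bilinear (hdf.differentiable (by simp) A).hasFDerivAt
      (hβ.differentiable (by simp) A).hasFDerivAt
  have h2 : HasFDerivAt (wedge (fderiv ℝ f) β) (alternatizeUncurryFinCLM ℝ SL ℝ ∘L
      (B.precompR SL (fderiv ℝ f A) (fderiv ℝ β A)
        + B.precompL SL (fderiv ℝ (fderiv ℝ f) A) (β A))) A :=
    (alternatizeUncurryFinCLM ℝ SL ℝ).hasFDerivAt.comp A h1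
  have hsymm : ∀ x y, fderiv ℝ (fderiv ℝ f) A x y = fderiv ℝ (fderiv ℝ f) A y x :=
    fun x y => hf.contDiffAt.isSymmSndFDerivAt minSmoothness_two_le x y
  set θ := fderiv ℝ f A
  set b := fderiv ℝ β A with hb
  let S : SL →L[ℝ] SL →L[ℝ] SL [⋀^Fin n]→L[ℝ] ℝ := B.precompR SL θ b
  let S' : SL →L[ℝ] SL →L[ℝ] SL [⋀^Fin n]→L[ℝ] ℝ :=
    ContinuousLinearMap.smulRightL ℝ SL (SL →L[ℝ] SL [⋀^Fin n]→L[ℝ] ℝ) θ b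
  -- The Hessian of `f` is symmetric, so antisymmetrization kills its contribution.
  have e0 : alternatizeUncurryFin (alternatizeUncurryFinCLM ℝ SL ℝ ∘L
      B.precompL SL (fderiv ℝ (fderiv ℝ f) A) (β A)) = 0 :=
    alternatizeUncurryFin_alternatizeUncurryFinCLM_comp_of_symmetric fun x y => by
      change (fderiv ℝ (fderiv ℝ f) A x y) • β A = (fderiv ℝ (fderiv ℝ f) A y x) • β A
      rw [hsymm]
  -- `S x y = θ(y) b(x)` and `S' x y = θ(x) b(y)` are transposes of each other, so their sum is
  -- killed as well. As `S'` alternates to `df ∧ dβ`, this is where the minus sign comes from.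
  have e1 : alternatizeUncurryFin (alternatizeUncurryFinCLM ℝ SL ℝ ∘L (S + S')) = 0 :=
    alternatizeUncurryFin_alternatizeUncurryFinCLM_comp_of_symmetric fun x y => by
      change θ y • b x + θ x • b y = θ x • b y + θ y • b x
      exact add_comm _ _
  have e2 : alternatizeUncurryFin (alternatizeUncurryFinCLM ℝ SL ℝ ∘L S')
      = wedge (fderiv ℝ f) (extDeriv β) A := by
    change alternatizeUncurryFin _ = alternatizeUncurryFin _
    congr 1
    ext1 x
    change alternatizeUncurryFinCLM ℝ SL ℝ (θ x • b) = θ x • alternatizeUncurryFinCLM ℝ SL ℝ b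
    rw [map_smul]
  rw [ContinuousLinearMap.comp_add, alternatizeUncurryFin_add, e2] at e1
  rw [extDeriv, h2.fderiv, ContinuousLinearMap.comp_add, alternatizeUncurryFin_add, e0, add_zero]
  exact eq_neg_of_add_eq_zero_left e1

theorem extDeriv_ePhi {n : ℕ} {β : Form n} (hβ : ContDiff ℝ ∞ β) :
    extDeriv (ePhi n β) = ePhi (n + 1) (extDeriv β) := by
  funext A
  rw [ePhi_apply, ePhi_apply, extDeriv_wedge contDiff_casimirRe
    (contDiff_wedge (contDiff_casimirIm.fderiv_right (mod_cast le_rfl)) hβ),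
    wedge_neg_apply (extDeriv_wedge contDiff_casimirIm hβ A), neg_neg]

/-! ### Smoothness of families of pullbacks -/

instance instFiniteDimensionalMultilinear (n : ℕ) :
    FiniteDimensional ℝ (ContinuousMultilinearMap ℝ (fun _ : Fin n => SL) ℝ) :=
  FiniteDimensional.of_injective
    (ContinuousMultilinearMap.toMultilinearMapLinear (R' := ℝ) (A := ℝ) (M₁ := fun _ : Fin n => SL)
      (M₂ := ℝ))
    ContinuousMultilinearMap.toMultilinearMap_injective

/-- In finite dimension the inclusion of alternating into multilinear maps has a continuous linear
left inverse, so smoothness can be tested after the inclusion. -/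
theorem contDiff_toMultilinear_iff {X : Type*} [NormedAddCommGroup X] [NormedSpace ℝ X] {n : ℕ}
    {a : X → SL [⋀^Fin n]→L[ℝ] ℝ} {N : ℕ∞ω}
    (h : ContDiff ℝ N fun x => (a x).toContinuousMultilinearMap) : ContDiff ℝ N a := by
  obtain ⟨g, hg⟩ := (ContinuousAlternatingMap.toContinuousMultilinearMapLI (𝕜 := ℝ) (E := SL)
    (F := ℝ) (ι := Fin n)).toLinearMap.exists_leftInverse_of_injective
    (LinearMap.ker_eq_bot.2 ContinuousAlternatingMap.toContinuousMultilinearMap_injective)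
  have h1 : a = (LinearMap.toContinuousLinearMap g) ∘ fun x => (a x).toContinuousMultilinearMap := by
    funext x
    exact (LinearMap.congr_fun hg (a x)).symm
  rw [h1]
  exact (LinearMap.toContinuousLinearMap g).contDiff.comp h

/-- Smoothness of pullbacks along smooth families. -/
theorem ContDiff.compCLM {X : Type*} [NormedAddCommGroup X] [NormedSpace ℝ X] {n : ℕ}
    {a : X → SL [⋀^Fin n]→L[ℝ] ℝ} {L : X → SL →L[ℝ] SL} (ha : ContDiff ℝ ∞ a)
    (hL : ContDiff ℝ ∞ L) : ContDiff ℝ ∞ fun x => (a x).compContinuousLinearMap (L x) := by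
  have h1 : ContDiff ℝ ∞ fun x => (a x).toContinuousMultilinearMap.compContinuousLinearMap
      (fun _ => L x) := by
    have h2 : ContDiff ℝ ∞ fun x => ((fun _ : Fin n => L x), (a x).toContinuousMultilinearMap) :=
      (contDiff_pi.2 fun _ => hL).prodMk
        ((ContinuousAlternatingMap.toContinuousMultilinearMapLI (𝕜 := ℝ) (E := SL) (F := ℝ)
          (ι := Fin n)).contDiff.comp ha)
    rw [contDiff_iff_contDiffAt]
    intro x
    exact (ContinuousMultilinearMap.analyticAt_uncurry_compContinuousLinearMap
      (𝕜 := ℝ)).contDiffAt.comp x h2.contDiffAt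
  exact contDiff_toMultilinear_iff h1

/-! ### Weighted bounds for the jets of families of functions -/

section Jets

variable {ι E F G H : Type*} [NormedAddCommGroup E] [NormedSpace ℝ E]
  [NormedAddCommGroup F] [NormedSpace ℝ F] [NormedAddCommGroup G] [NormedSpace ℝ G]
  [NormedAddCommGroup H] [NormedSpace ℝ H]

theorem natCast_le_infty (n : ℕ) : (n : ℕ∞ω) ≤ (∞ : ℕ∞ω) := mod_cast le_top

/-- A family of smooth functions `u i` whose `j`-th derivatives at the points `a i`, `j ≤ n`, are
bounded by `C w(i) b(i)ʲ`. -/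
structure JetBound (n : ℕ) (u : ι → E → F) (a : ι → E) (w b : ι → ℝ) : Prop where
  smooth : ∀ i, ContDiff ℝ ∞ (u i)
  weight_nonneg : ∀ i, 0 ≤ w i
  one_le : ∀ i, 1 ≤ b i
  bound : ∃ C, 0 ≤ C ∧ ∀ i, ∀ j ≤ n, ‖iteratedFDeriv ℝ j (u i) (a i)‖ ≤ C * w i * b i ^ j

variable {n : ℕ} {a : ι → E} {w w' b : ι → ℝ}

theorem JetBound.mono {u : ι → E → F} (h : JetBound n u a w b) (hw' : ∀ i, 0 ≤ w' i) (K : ℝ)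
    (hw : ∀ i, w i ≤ K * w' i) : JetBound n u a w' b := by
  obtain ⟨hs, h0, hb, C, hC, h⟩ := h
  refine ⟨hs, hw', hb, C * |K|, by positivity, fun i j hj => (h i j hj).trans ?_⟩
  have h1 : 0 ≤ b i ^ j := pow_nonneg (zero_le_one.trans (hb i)) j
  calc C * w i * b i ^ j ≤ C * (|K| * w' i) * b i ^ j := by
          gcongr
          exact (hw i).trans (mul_le_mul_of_nonneg_right (le_abs_self K) (hw' i))
      _ = _ := by ring

theorem JetBound.reindex {κ : Type*} {u : ι → E → F} (h : JetBound n u a w b) (f : κ → ι) :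
    JetBound n (fun k => u (f k)) (fun k => a (f k)) (fun k => w (f k)) (fun k => b (f k)) := by
  obtain ⟨hs, h0, hb, C, hC, h⟩ := h
  exact ⟨fun k => hs _, fun k => h0 _, fun k => hb _, C, hC, fun k => h _⟩

theorem JetBound.add {u v : ι → E → F} (hu : JetBound n u a w b) (hv : JetBound n v a w b) :
    JetBound n (fun i x => u i x + v i x) a w b := by
  obtain ⟨hs, h0, hb, C, hC, h⟩ := hu
  obtain ⟨hs', h0', hb', C', hC', h'⟩ := hv
  refine ⟨fun i => (hs i).add (hs' i), h0, hb, C + C', add_nonneg hC hC', fun i j hj => ?_⟩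
  have e : (fun x => u i x + v i x) = u i + v i := rfl
  rw [e, iteratedFDeriv_add ((hs i).of_le (natCast_le_infty j)) ((hs' i).of_le (natCast_le_infty j))]
  calc _ ≤ C * w i * b i ^ j + C' * w i * b i ^ j :=
        (norm_add_le _ _).trans (add_le_add (h i j hj) (h' i j hj))
    _ = _ := by ring

/-- Leibniz rule. -/
theorem JetBound.bilinear {u : ι → E → F} {v : ι → E → G} (B : F →L[ℝ] G →L[ℝ] H)
    (hu : JetBound n u a w b) (hv : JetBound n v a w' b) :
    JetBound n (fun i x => B (u i x) (v i x)) a (fun i => w i * w' i) b := by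
  obtain ⟨hs, h0, hb, C, hC, h⟩ := hu
  obtain ⟨hs', h0', hb', C', hC', h'⟩ := hv
  refine ⟨fun i => (B.contDiff.comp (hs i)).clm_apply (hs' i), fun i => mul_nonneg (h0 i) (h0' i),
    hb, ‖B‖ * (2 ^ n * (C * C')), by positivity, fun i j hj => ?_⟩
  refine (B.norm_iteratedFDeriv_le_of_bilinear (hs i) (hs' i) (a i) (natCast_le_infty j)).trans ?_
  have hb0 : 0 ≤ b i := zero_le_one.trans (hb i)
  have := h0 i
  have := h0' i
  calc ‖B‖ * ∑ k ∈ Finset.range (j + 1), (j.choose k : ℝ) * ‖iteratedFDeriv ℝ k (u i) (a i)‖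
          * ‖iteratedFDeriv ℝ (j - k) (v i) (a i)‖
      ≤ ‖B‖ * ∑ k ∈ Finset.range (j + 1), (j.choose k : ℝ) * (C * C' * (w i * w' i) * b i ^ j) := by
        refine mul_le_mul_of_nonneg_left (Finset.sum_le_sum fun k hk => ?_) (norm_nonneg B)
        have hk : k ≤ j := Nat.lt_succ_iff.1 (Finset.mem_range.1 hk)
        rw [mul_assoc]
        refine mul_le_mul_of_nonneg_left ?_ (Nat.cast_nonneg _)
        calc _ ≤ (C * w i * b i ^ k) * (C' * w' i * b i ^ (j - k)) := by
              refine mul_le_mul (h i k (hk.trans hj)) (h' i _ ((Nat.sub_le _ _).trans hj))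
                (norm_nonneg _) (by positivity)
          _ = C * C' * (w i * w' i) * (b i ^ k * b i ^ (j - k)) := by ring
          _ = _ := by rw [← pow_add, Nat.add_sub_cancel' hk]
    _ = ‖B‖ * (2 ^ j * (C * C')) * (w i * w' i) * b i ^ j := by
        rw [← Finset.sum_mul, ← Nat.cast_sum, Nat.sum_range_choose]
        push_cast
        ring
    _ ≤ _ := by
        gcongr
        norm_num

theorem JetBound.smul {u : ι → E → ℝ} {v : ι → E → F} (hu : JetBound n u a w b)
    (hv : JetBound n v a w' b) :
    JetBound n (fun i x => u i x • v i x) a (fun i => w i * w' i) b :=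
  hu.bilinear (ContinuousLinearMap.lsmul ℝ ℝ) hv

theorem JetBound.mul {u v : ι → E → ℝ} (hu : JetBound n u a w b) (hv : JetBound n v a w' b) :
    JetBound n (fun i x => u i x * v i x) a (fun i => w i * w' i) b :=
  hu.bilinear (ContinuousLinearMap.mul ℝ ℝ) hv

theorem JetBound.clm_comp {u : ι → E → F} (L : F →L[ℝ] G) (hu : JetBound n u a w b) :
    JetBound n (fun i x => L (u i x)) a w b := by
  obtain ⟨hs, h0, hb, C, hC, h⟩ := hu
  refine ⟨fun i => L.contDiff.comp (hs i), h0, hb, ‖L‖ * C, by positivity, fun i j hj => ?_⟩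
  refine (L.norm_iteratedFDeriv_comp_left (hs i).contDiffAt (natCast_le_infty j)).trans ?_
  calc _ ≤ ‖L‖ * (C * w i * b i ^ j) := by gcongr; exact h i j hj
    _ = _ := by ring

/-- A family of constants. -/
theorem JetBound.const {c : ι → F} (hb : ∀ i, 1 ≤ b i) :
    JetBound n (fun i (_ : E) => c i) a (fun i => ‖c i‖) b := by
  refine ⟨fun i => contDiff_const, fun i => norm_nonneg _, hb, 1, zero_le_one, fun i j hj => ?_⟩
  have hb0 : 0 ≤ b i := zero_le_one.trans (hb i)
  rcases Nat.eq_zero_or_pos j with rfl | hj0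
  · simp
  · rw [iteratedFDeriv_const_of_ne hj0.ne']
    simp only [Pi.zero_apply, norm_zero]
    positivity

/-- Differentiation uses up one order and costs one factor `b` in the weight. -/
theorem JetBound.jet_fderiv {u : ι → E → F} (hu : JetBound (n + 1) u a w b) :
    JetBound n (fun i => fderiv ℝ (u i)) a (fun i => w i * b i) b := by
  obtain ⟨hs, h0, hb, C, hC, h⟩ := hu
  have hb0 : ∀ i, 0 ≤ b i := fun i => zero_le_one.trans (hb i)
  refine ⟨fun i => (hs i).fderiv_right (mod_cast le_rfl), fun i => mul_nonneg (h0 i) (hb0 i), hb,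
    C, hC, fun i j hj => ?_⟩
  rw [norm_iteratedFDeriv_fderiv]
  refine (h i (j + 1) (by omega)).trans_eq ?_
  ring

/-- A fixed smooth function, near a bounded set of points. -/
theorem JetBound.of_contDiff [FiniteDimensional ℝ E] {P : E → F} (hP : ContDiff ℝ ∞ P) {R : ℝ}
    (ha : ∀ i, ‖a i‖ ≤ R) (hb : ∀ i, 1 ≤ b i) :
    JetBound n (fun _ => P) a (fun i => ‖P (a i)‖ + (b i)⁻¹) b := by
  have hb0 : ∀ i, 0 < b i := fun i => zero_lt_one.trans_le (hb i)
  have : ProperSpace E := FiniteDimensional.proper ℝ E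
  have h1 : ∀ j : ℕ, ∃ C, ∀ x ∈ Metric.closedBall (0 : E) R, ‖iteratedFDeriv ℝ j P x‖ ≤ C :=
    fun j => (isCompact_closedBall _ _).exists_bound_of_continuousOn
      (hP.continuous_iteratedFDeriv (natCast_le_infty j)).continuousOn
  choose C hC using h1
  refine ⟨fun _ => hP, fun i => by have := hb0 i; positivity, hb,
    1 + ∑ j ∈ Finset.range (n + 1), |C j|, by positivity, fun i j hj => ?_⟩
  have hCj : |C j| ≤ ∑ j ∈ Finset.range (n + 1), |C j| :=
    Finset.single_le_sum (f := fun j => |C j|) (fun _ _ => abs_nonneg _)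
      (Finset.mem_range.2 (by omega))
  have hbi := hb0 i
  rcases Nat.eq_zero_or_pos j with rfl | hj0
  · rw [norm_iteratedFDeriv_zero, pow_zero, mul_one]
    have : 0 ≤ ∑ j ∈ Finset.range (n + 1), |C j| := by positivity
    have h2 : 0 ≤ (b i)⁻¹ := by positivity
    nlinarith [norm_nonneg (P (a i))]
  · have h3 : ‖iteratedFDeriv ℝ j P (a i)‖ ≤ C j := hC j _ (by simpa using ha i)
    -- Only the value of `P` needs the weight `‖P‖`: a derivative of order `j ≥ 1` is paid for by
    -- `b⁻¹`, because `b⁻¹ bʲ ≥ 1`.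
    have h4 : 1 ≤ (b i)⁻¹ * b i ^ j := by
      obtain ⟨k, rfl⟩ := Nat.exists_eq_succ_of_ne_zero hj0.ne'
      rw [Nat.succ_eq_add_one, pow_succ', ← mul_assoc, inv_mul_cancel₀ hbi.ne', one_mul]
      exact one_le_pow₀ (hb i)
    calc ‖iteratedFDeriv ℝ j P (a i)‖ ≤ 1 + ∑ j ∈ Finset.range (n + 1), |C j| := by
          linarith [le_abs_self (C j)]
      _ ≤ (1 + ∑ j ∈ Finset.range (n + 1), |C j|) * ((b i)⁻¹ * b i ^ j) :=
          le_mul_of_one_le_right (by positivity) h4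
      _ ≤ (1 + ∑ j ∈ Finset.range (n + 1), |C j|) * ((‖P (a i)‖ + (b i)⁻¹) * b i ^ j) := by
          gcongr
          linarith [norm_nonneg (P (a i))]
      _ = _ := by ring

theorem JetBound.of_contDiff_one [FiniteDimensional ℝ E] {P : E → F} (hP : ContDiff ℝ ∞ P) {R : ℝ}
    (ha : ∀ i, ‖a i‖ ≤ R) (hb : ∀ i, 1 ≤ b i) :
    JetBound n (fun _ => P) a (fun _ => 1) b := by
  have : ProperSpace E := FiniteDimensional.proper ℝ E
  obtain ⟨C, hC⟩ := (isCompact_closedBall (0 : E) R).exists_bound_of_continuousOn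
    hP.continuous.continuousOn
  refine (JetBound.of_contDiff hP ha hb).mono (fun _ => zero_le_one) (C + 1) fun i => ?_
  have h1 := hC (a i) (by simpa using ha i)
  have h2 := inv_le_one_of_one_le₀ (hb i)
  linarith

/-- Composition, the derivatives of order at least one of the inner family being controlled by
powers of `b`. -/
theorem JetBound.comp {u : ι → E → G} {g : ι → G → F} {t : Set G} (ht : UniqueDiffOn ℝ t)
    (hb : ∀ i, 1 ≤ b i) (hw : ∀ i, 0 ≤ w i)
    (hu : ∀ i, ContDiff ℝ ∞ (u i)) (hut : ∀ i x, u i x ∈ t)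
    (hub : ∃ C, ∀ i, ∀ j, 1 ≤ j → j ≤ n → ‖iteratedFDeriv ℝ j (u i) (a i)‖ ≤ C * b i ^ j)
    (hg : ∀ i, ContDiffOn ℝ ∞ (g i) t)
    (hgb : ∃ C, 0 ≤ C ∧ ∀ i, ∀ j ≤ n, ‖iteratedFDerivWithin ℝ j (g i) t (u i (a i))‖ ≤ C * w i) :
    JetBound n (fun i x => g i (u i x)) a w b := by
  obtain ⟨C, hC⟩ := hub
  obtain ⟨K, hK0, hK⟩ := hgb
  have hsm : ∀ i, ContDiff ℝ ∞ (fun x => g i (u i x)) := fun i => by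
    rw [← contDiffOn_univ]
    exact (hg i).comp (hu i).contDiffOn fun x _ => hut i x
  refine ⟨hsm, hw, hb, (n.factorial : ℝ) * K * (max C 1) ^ n, by positivity, fun i j hj => ?_⟩
  have hb0 : 0 ≤ b i := zero_le_one.trans (hb i)
  -- The composition estimate requires the `k`-th inner derivative to be bounded by a `k`-th power,
  -- hence the base `max C 1 * b`.
  have h1 : ‖iteratedFDeriv ℝ j (g i ∘ u i) (a i)‖
      ≤ (j.factorial : ℝ) * (K * w i) * (max C 1 * b i) ^ j := by
    refine norm_iteratedFDeriv_comp_le' (t := t) (N := ∞) (by rintro _ ⟨x, rfl⟩; exact hut i x) ht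
      (hg i) (hu i) (natCast_le_infty j) (a i) (fun k hk => hK i k (hk.trans hj)) fun k hk hkj => ?_
    refine (hC i k hk (hkj.trans hj)).trans ?_
    rw [mul_pow]
    gcongr
    calc C ≤ max C 1 := le_max_left _ _
      _ ≤ max C 1 ^ k := le_self_pow₀ (le_max_right _ _) (by omega)
  refine h1.trans ?_
  rw [mul_pow]
  have := hw i
  have h2 : (j.factorial : ℝ) ≤ n.factorial := mod_cast Nat.factorial_le hj
  have h3 : max C 1 ^ j ≤ max C 1 ^ n := pow_le_pow_right₀ (le_max_right _ _) hj
  calc (j.factorial : ℝ) * (K * w i) * (max C 1 ^ j * b i ^ j)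
      ≤ (n.factorial : ℝ) * (K * w i) * (max C 1 ^ n * b i ^ j) := by gcongr
    _ = _ := by ring

/-- Evaluation of a family of multilinear maps on families of vectors. -/
theorem JetBound.multilinear_apply {m : ℕ} {α : ι → E → ContinuousMultilinearMap ℝ
    (fun _ : Fin m => F) ℝ} {V : Fin m → ι → E → F} {wV : Fin m → ι → ℝ}
    (hα : JetBound n α a w b) (hV : ∀ k, JetBound n (V k) a (wV k) b) :
    JetBound n (fun i x => α i x fun k => V k i x) a (fun i => w i * ∏ k, wV k i) b := by
  induction m generalizing w with
  | zero =>
    have h := hα.clm_comp (ContinuousMultilinearMap.apply ℝ (fun _ : Fin 0 => F) ℝ Fin.elim0)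
    simp only [Finset.univ_eq_empty, Finset.prod_empty, mul_one]
    convert h using 3 with i x
    simp only [ContinuousMultilinearMap.apply_apply]
    congr 1
    funext k
    exact k.elim0
  | succ m ih =>
    let B := (continuousMultilinearCurryLeftEquiv ℝ (fun _ : Fin (m + 1) => F)
      ℝ).toContinuousLinearEquiv.toContinuousLinearMap
    have h1 := hα.bilinear B (hV 0)
    have h2 := ih (α := fun i x => B (α i x) (V 0 i x)) (V := fun k => V k.succ) h1
      fun k => hV k.succ
    have e : ∀ i, w i * ∏ k, wV k i = w i * wV 0 i * ∏ k : Fin m, wV k.succ i := fun i => by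
      rw [Fin.prod_univ_succ, mul_assoc]
    simp only [e]
    convert h2 using 3 with i x
    change _ = (α i x) (Fin.cons (V 0 i x) fun k => V k.succ i x)
    congr 1
    funext k
    refine Fin.cases rfl (fun k => rfl) k

/-- Bounds for a family of alternating maps follow from bounds for its evaluations. -/
theorem JetBound.of_eval {m : ℕ} {u : ι → E → F [⋀^Fin m]→L[ℝ] ℝ} (hs : ∀ i, ContDiff ℝ ∞ (u i))
    (hw : ∀ i, 0 ≤ w i) (hb : ∀ i, 1 ≤ b i)
    (h : JetBound n (fun (p : ι × (Fin m → F)) x => u p.1 x p.2) (fun p => a p.1)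
      (fun p => w p.1 * ∏ k, ‖p.2 k‖) (fun p => b p.1)) : JetBound n u a w b := by
  obtain ⟨-, -, -, C, hC, h⟩ := h
  refine ⟨hs, hw, hb, C, hC, fun i j hj => ?_⟩
  have hwi := hw i
  have hbi : 0 ≤ b i := zero_le_one.trans (hb i)
  refine ContinuousMultilinearMap.opNorm_le_bound (by positivity) fun y => ?_
  refine ContinuousAlternatingMap.opNorm_le_bound _ (by positivity) fun v => ?_
  have h1 := h (i, v) j hj
  let L : (F [⋀^Fin m]→L[ℝ] ℝ) →L[ℝ] ℝ := ContinuousAlternatingMap.apply ℝ F ℝ v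
  have h2 : iteratedFDeriv ℝ j (fun x => u i x v) (a i)
      = L.compContinuousMultilinearMap (iteratedFDeriv ℝ j (u i) (a i)) :=
    L.iteratedFDeriv_comp_left (hs i).contDiffAt (natCast_le_infty j)
  have h3 : iteratedFDeriv ℝ j (u i) (a i) y v = iteratedFDeriv ℝ j (fun x => u i x v) (a i) y := by
    rw [h2]; rfl
  rw [h3]
  refine (ContinuousMultilinearMap.le_opNorm _ _).trans ?_
  calc _ ≤ (C * (w i * ∏ k, ‖v k‖) * b i ^ j) * ∏ k, ‖y k‖ := by gcongr
    _ = _ := by ring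

theorem JetBound.clm_apply_const {m : ℕ} {L : ι → E → F →L[ℝ] G} (hL : JetBound n L a w b)
    (k : Fin m) : JetBound n (fun (p : ι × (Fin m → F)) x => L p.1 x (p.2 k)) (fun p => a p.1)
      (fun p => w p.1 * ‖p.2 k‖) (fun p => b p.1) :=
  (hL.reindex (Prod.fst : ι × (Fin m → F) → ι)).bilinear (ContinuousLinearMap.id ℝ (F →L[ℝ] G))
    (JetBound.const (c := fun p : ι × (Fin m → F) => p.2 k) fun p => hL.one_le p.1)

end Jets

/-! ### Jet bounds for pullbacks and contractions of forms -/

section FormJets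

variable {ι : Type*} {n m : ℕ} {a : ι → SL} {w b : ι → ℝ}

theorem JetBound.toMultilinear {u : ι → SL → SL [⋀^Fin m]→L[ℝ] ℝ} (h : JetBound n u a w b) :
    JetBound n (fun i x => (u i x).toContinuousMultilinearMap) a w b :=
  h.clm_comp (ContinuousAlternatingMap.toContinuousMultilinearMapLI (𝕜 := ℝ) (E := SL) (F := ℝ)
    (ι := Fin m)).toContinuousLinearMap

/-- Pullbacks of forms. -/
theorem JetBound.jet_pullback {Φ : ι → SL → SL} {α : ι → Form m} {wα wD : ι → ℝ}
    (hα : JetBound n (fun i x => α i (Φ i x)) a wα b)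
    (hD : JetBound n (fun i => fderiv ℝ (Φ i)) a wD b) :
    JetBound n (fun i => pullback (Φ i) (α i)) a (fun i => wα i * wD i ^ m) b := by
  refine JetBound.of_eval (fun i => ContDiff.compCLM (hα.smooth i) (hD.smooth i))
    (fun i => mul_nonneg (hα.weight_nonneg i) (pow_nonneg (hD.weight_nonneg i) m)) hα.one_le ?_
  have h := (hα.reindex (Prod.fst : ι × (Fin m → SL) → ι)).toMultilinear.multilinear_apply
    (V := fun k p x => fderiv ℝ (Φ p.1) x (p.2 k)) (fun k => hD.clm_apply_const k)
  have e : ∀ p : ι × (Fin m → SL), wα p.1 * ∏ k, wD p.1 * ‖p.2 k‖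
      = wα p.1 * wD p.1 ^ m * ∏ k, ‖p.2 k‖ := fun p => by
    rw [Finset.prod_mul_distrib, Finset.prod_const, Finset.card_univ, Fintype.card_fin, mul_assoc]
  simp only [e] at h
  exact h

/-- Contractions of pullbacks of forms. -/
theorem JetBound.jet_interiorProduct {Φ : ι → SL → SL} {V V' : ι → SL → SL}
    {α : ι → Form (m + 1)} {wα wV wD : ι → ℝ}
    (hα : JetBound n (fun i x => α i (Φ i x)) a wα b)
    (hV : JetBound n V' a wV b) (hVs : ∀ i, ContDiff ℝ ∞ (V i))
    (hVV : ∀ i x, fderiv ℝ (Φ i) x (V i x) = V' i x)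
    (hD : JetBound n (fun i => fderiv ℝ (Φ i)) a wD b) :
    JetBound n (fun i => interiorProduct (V i) (pullback (Φ i) (α i))) a
      (fun i => wα i * (wV i * wD i ^ m)) b := by
  refine JetBound.of_eval (fun i => ?_)
    (fun i => mul_nonneg (hα.weight_nonneg i) (mul_nonneg (hV.weight_nonneg i)
      (pow_nonneg (hD.weight_nonneg i) m))) hα.one_le ?_
  · have h1 : ContDiff ℝ ∞ (pullback (Φ i) (α i)) :=
      ContDiff.compCLM (hα.smooth i) (hD.smooth i)
    exact ((ContinuousAlternatingMap.curryLeftLI (𝕜 := ℝ) (E := SL) (F := ℝ)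
      (n := m)).contDiff.comp h1).clm_apply (hVs i)
  -- The contracted slot is fed with `V' = DΦ(V)` and keeps its own weight `wV`, possibly far
  -- smaller than separate bounds on `DΦ` and `V` would give. The other `m` slots contribute `wD`
  -- each.
  · have h := (hα.reindex (Prod.fst : ι × (Fin m → SL) → ι)).toMultilinear.multilinear_apply
      (V := Fin.cons (fun p x => V' p.1 x) fun k p x => fderiv ℝ (Φ p.1) x (p.2 k))
      (wV := Fin.cons (fun p => wV p.1) fun k p => wD p.1 * ‖p.2 k‖) (fun k => by
        refine Fin.cases ?_ (fun k => ?_) k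
        · exact hV.reindex (Prod.fst : ι × (Fin m → SL) → ι)
        · exact hD.clm_apply_const k)
    have e : ∀ p : ι × (Fin m → SL), wα p.1 * ∏ k, (Fin.cons (fun p => wV p.1)
        (fun k p => wD p.1 * ‖p.2 k‖) : Fin (m + 1) → (ι × (Fin m → SL)) → ℝ) k p
        = wα p.1 * (wV p.1 * wD p.1 ^ m) * ∏ k, ‖p.2 k‖ := fun p => by
      rw [Fin.prod_univ_succ]
      simp only [Fin.cons_zero, Fin.cons_succ]
      rw [Finset.prod_mul_distrib, Finset.prod_const, Finset.card_univ, Fintype.card_fin]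
      ring
    simp only [e] at h
    convert h using 3 with p x
    change α p.1 (Φ p.1 x) _ = α p.1 (Φ p.1 x) _
    congr 1
    funext k
    refine Fin.cases ?_ (fun k => rfl) k
    exact hVV p.1 x

end FormJets

/-! ### Entire functions with rapidly decreasing nonnegative coefficients -/

/-- The sum of the power series with coefficients `a`. -/
def ser (a : ℕ → ℝ) (z : ℝ) : ℝ := ∑' k, a k * z ^ k

/-- The coefficients of the derived power series. -/
def shiftCoeff (a : ℕ → ℝ) (k : ℕ) : ℝ := (k + 1) * a (k + 1)

/-- Nonnegative coefficients dominating those of the derived series. -/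
structure Dominating (a : ℕ → ℝ) : Prop where
  nonneg : ∀ k, 0 ≤ a k
  step : ∀ k : ℕ, (k + 1) * a (k + 1) ≤ a k

theorem Dominating.shift {a : ℕ → ℝ} (h : Dominating a) : Dominating (shiftCoeff a) := by
  refine ⟨fun k => mul_nonneg (by positivity) (h.nonneg _), fun k => ?_⟩
  have := h.step (k + 1)
  simp only [shiftCoeff]
  push_cast at this ⊢
  exact mul_le_mul_of_nonneg_left this (by positivity)

theorem Dominating.le_div_factorial {a : ℕ → ℝ} (h : Dominating a) (k : ℕ) :
    a k ≤ a 0 / k.factorial := by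
  induction k with
  | zero => simp
  | succ k ih =>
    have h1 := h.step k
    have hk : (0 : ℝ) < k + 1 := by positivity
    rw [Nat.factorial_succ]
    push_cast
    calc a (k + 1) ≤ a k / (k + 1) := by rw [le_div_iff₀ hk]; linarith
      _ ≤ a 0 / k.factorial / (k + 1) := by gcongr
      _ = _ := by rw [div_div, mul_comm]

theorem Dominating.summable_abs {a : ℕ → ℝ} (h : Dominating a) (R : ℝ) :
    Summable fun k => a k * |R| ^ k := by
  refine Summable.of_nonneg_of_le (fun k => mul_nonneg (h.nonneg k) (by positivity)) (fun k => ?_)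
    ((Real.summable_pow_div_factorial |R|).mul_left (a 0))
  calc a k * |R| ^ k ≤ a 0 / k.factorial * |R| ^ k := by gcongr; exact h.le_div_factorial k
    _ = _ := by ring

theorem Dominating.summable {a : ℕ → ℝ} (h : Dominating a) (z : ℝ) :
    Summable fun k => a k * z ^ k := by
  refine Summable.of_norm ?_
  refine (h.summable_abs z).congr fun k => ?_
  rw [norm_mul, norm_pow, Real.norm_eq_abs, Real.norm_eq_abs, abs_of_nonneg (h.nonneg k)]

theorem Dominating.hasDerivAt {a : ℕ → ℝ} (h : Dominating a) (z : ℝ) :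
    HasDerivAt (ser a) (ser (shiftCoeff a) z) z := by
  set R := |z| + 1
  have hR : 0 ≤ R := by positivity
  let u : ℕ → ℝ := fun k => k * a k * R ^ (k - 1)
  have hu : Summable u := by
    rw [← summable_nat_add_iff 1]
    have := h.shift.summable_abs R
    rw [abs_of_nonneg hR] at this
    refine this.congr fun k => ?_
    simp [u, shiftCoeff]
  have h1 := hasDerivAt_tsum_of_isPreconnected (𝕜 := ℝ) (u := u) hu (t := Metric.ball 0 R)
    (g := fun k y => a k * y ^ k) (g' := fun k y => a k * (k * y ^ (k - 1)))
    Metric.isOpen_ball (convex_ball _ _).isPreconnected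
    (fun k y _ => (hasDerivAt_pow k y).const_mul (a k))
    (fun k y hy => by
      have hy : |y| ≤ R := by simpa using (Metric.mem_ball.1 hy).le
      rw [norm_mul, norm_mul, norm_pow, Real.norm_eq_abs, Real.norm_eq_abs, Real.norm_eq_abs,
        abs_of_nonneg (h.nonneg k), Nat.abs_cast]
      have := h.nonneg k
      calc a k * (k * |y| ^ (k - 1)) ≤ a k * (k * R ^ (k - 1)) := by gcongr
        _ = _ := by simp only [u]; ring)
    (y₀ := 0) (y := z) (Metric.mem_ball_self (by positivity)) (h.summable 0)
    (by simp [R])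
  have e : ser (shiftCoeff a) z = ∑' k, a k * (k * z ^ (k - 1)) := by
    rw [Summable.tsum_eq_zero_add]
    · simp only [CharP.cast_eq_zero, zero_mul, mul_zero, zero_add, ser, shiftCoeff]
      refine tsum_congr fun k => ?_
      push_cast
      ring
    · rw [← summable_nat_add_iff 1]
      refine (h.shift.summable z).congr fun k => ?_
      simp only [shiftCoeff, Nat.add_sub_cancel]
      push_cast
      ring
  rw [e]
  exact h1

theorem Dominating.deriv_ser {a : ℕ → ℝ} (h : Dominating a) :
    deriv (ser a) = ser (shiftCoeff a) := funext fun z => (h.hasDerivAt z).deriv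

theorem Dominating.contDiff {a : ℕ → ℝ} (h : Dominating a) : ContDiff ℝ ∞ (ser a) := by
  rw [contDiff_infty]
  intro n
  induction n generalizing a with
  | zero => exact contDiff_zero.2 (continuous_iff_continuousAt.2 fun z => (h.hasDerivAt z).continuousAt)
  | succ n ih =>
    push_cast
    rw [contDiff_succ_iff_deriv]
    refine ⟨fun z => (h.hasDerivAt z).differentiableAt, by simp, ?_⟩
    rw [h.deriv_ser]
    exact ih h.shift

theorem Dominating.ser_nonneg {a : ℕ → ℝ} (h : Dominating a) {z : ℝ} (hz : 0 ≤ z) :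
    0 ≤ ser a z := tsum_nonneg fun k => mul_nonneg (h.nonneg k) (by positivity)

/-- The condition on the coefficients says that on `z ≥ 0` the derived series is at most the series
itself. Hence `cosh` and `sinh` terms are their own weights in the jet bounds. -/
theorem Dominating.iteratedDeriv_le {a : ℕ → ℝ} (h : Dominating a) {z : ℝ} (hz : 0 ≤ z) (n : ℕ) :
    ‖iteratedFDeriv ℝ n (ser a) z‖ ≤ ser a z := by
  rw [norm_iteratedFDeriv_eq_norm_iteratedDeriv]
  induction n generalizing a with
  | zero => rw [iteratedDeriv_zero, Real.norm_of_nonneg (h.ser_nonneg hz)]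
  | succ n ih =>
    rw [iteratedDeriv_succ', h.deriv_ser]
    refine (ih h.shift).trans ?_
    exact (h.shift.summable z).tsum_le_tsum
      (fun k => mul_le_mul_of_nonneg_right (h.step k) (by positivity)) (h.summable z)

/-- The coefficients of `cosh √z`. -/
def coshCoeff (k : ℕ) : ℝ := 1 / (2 * k).factorial

/-- The coefficients of `sinh √z / √z`. -/
def sinhCoeff (k : ℕ) : ℝ := 1 / (2 * k + 1).factorial

theorem dominating_coshCoeff : Dominating coshCoeff := by
  refine ⟨fun k => by unfold coshCoeff; positivity, fun k => ?_⟩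
  simp only [coshCoeff]
  have e : 2 * (k + 1) = 2 * k + 1 + 1 := by ring
  rw [e, Nat.factorial_succ, Nat.factorial_succ]
  push_cast
  rw [mul_one_div, div_le_div_iff₀ (by positivity) (by positivity)]
  have h1 : (0 : ℝ) ≤ (2 * k).factorial := by positivity
  have hk : (0 : ℝ) ≤ k := by positivity
  have h2 : ((k : ℝ) + 1) ≤ (2 * k + 1 + 1) * (2 * k + 1) := by nlinarith
  nlinarith [mul_le_mul_of_nonneg_right h2 h1]

theorem dominating_sinhCoeff : Dominating sinhCoeff := by
  refine ⟨fun k => by unfold sinhCoeff; positivity, fun k => ?_⟩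
  simp only [sinhCoeff]
  have e : 2 * (k + 1) + 1 = 2 * k + 1 + 1 + 1 := by ring
  rw [e, Nat.factorial_succ (2 * k + 1 + 1), Nat.factorial_succ (2 * k + 1)]
  push_cast
  rw [mul_one_div, div_le_div_iff₀ (by positivity) (by positivity)]
  have h1 : (0 : ℝ) ≤ (2 * k + 1).factorial := by positivity
  have hk : (0 : ℝ) ≤ k := by positivity
  have h2 : ((k : ℝ) + 1) ≤ (2 * k + 1 + 1 + 1) * (2 * k + 1 + 1) := by nlinarith
  nlinarith [mul_le_mul_of_nonneg_right h2 h1]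

theorem ser_coshCoeff (x : ℝ) : ser coshCoeff (x ^ 2) = Real.cosh x := by
  rw [Real.cosh_eq_tsum]
  refine tsum_congr fun k => ?_
  rw [coshCoeff, ← pow_mul]
  ring

theorem mul_ser_sinhCoeff (x : ℝ) : x * ser sinhCoeff (x ^ 2) = Real.sinh x := by
  rw [Real.sinh_eq_tsum, ser, ← tsum_mul_left]
  refine tsum_congr fun k => ?_
  rw [sinhCoeff, ← pow_mul, pow_succ]
  ring

/-! ### The flow of `W` -/

/-- `cosh (t |f|)`, as a smooth function. -/
def cF (t : ℝ) (A : SL) : ℝ := ser coshCoeff (t ^ 2 * esq A)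

/-- `sinh (t |f|) / |f|`, as a smooth function. -/
def sF (t : ℝ) (A : SL) : ℝ := t * ser sinhCoeff (t ^ 2 * esq A)

/-- The square of the normalizing factor of the flow. -/
def yF (t : ℝ) (A : SL) : ℝ := cF t A * cF t A + esq A * (sF t A * sF t A)
  + rho A * (cF t A * sF t A)

/-- The flow of `W`. -/
def flow (t : ℝ) (A : SL) : SL :=
  (√(yF t A))⁻¹ • (cF t A • A - sF t A • casimirStar A)

theorem esq_nonneg (A : SL) : 0 ≤ esq A := Complex.normSq_nonneg _

theorem cF_eq (t : ℝ) (A : SL) : cF t A = Real.cosh (t * ‖casimir A‖) := by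
  rw [cF, esq_eq, ← mul_pow, ser_coshCoeff]

theorem sF_eq (t : ℝ) (A : SL) : ‖casimir A‖ * sF t A = Real.sinh (t * ‖casimir A‖) := by
  rw [sF, esq_eq, ← mul_pow, ← mul_ser_sinhCoeff]; ring

theorem cF_sq (t : ℝ) (A : SL) : cF t A ^ 2 - esq A * sF t A ^ 2 = 1 := by
  rw [esq_eq, ← mul_pow, sF_eq, cF_eq, Real.cosh_sq]; ring

theorem one_le_cF (t : ℝ) (A : SL) : 1 ≤ cF t A := by rw [cF_eq]; exact Real.one_le_cosh _

theorem sF_nonneg {t : ℝ} (ht : 0 ≤ t) (A : SL) : 0 ≤ sF t A :=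
  mul_nonneg ht (dominating_sinhCoeff.ser_nonneg (mul_nonneg (sq_nonneg t) (esq_nonneg A)))

theorem sF_le {t : ℝ} (ht : 0 ≤ t) (A : SL) : sF t A ≤ t * cF t A := by
  refine mul_le_mul_of_nonneg_left ?_ ht
  refine (dominating_sinhCoeff.summable _).tsum_le_tsum (fun k => ?_)
    (dominating_coshCoeff.summable _)
  have hz : 0 ≤ t ^ 2 * esq A := mul_nonneg (sq_nonneg t) (esq_nonneg A)
  refine mul_le_mul_of_nonneg_right ?_ (by positivity)
  unfold sinhCoeff coshCoeff
  gcongr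
  omega

theorem norm_casimir_mul_sF_le {t : ℝ} (A : SL) : ‖casimir A‖ * sF t A ≤ cF t A := by
  rw [sF_eq, cF_eq]
  exact (Real.sinh_lt_cosh _).le

theorem sq_cF_le_yF {t : ℝ} (ht : 0 ≤ t) (A : SL) : cF t A ^ 2 ≤ yF t A := by
  have h1 := sF_nonneg ht A
  have h2 := one_le_cF t A
  have h3 := esq_nonneg A
  have h4 := rho_nonneg A
  have h5 : 0 ≤ esq A * (sF t A * sF t A) := by positivity
  have h6 : 0 ≤ rho A * (cF t A * sF t A) := by positivity
  rw [yF]; nlinarith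

theorem one_le_yF {t : ℝ} (ht : 0 ≤ t) (A : SL) : 1 ≤ yF t A := by
  have h2 := one_le_cF t A
  nlinarith [sq_cF_le_yF ht A]

theorem yF_pos {t : ℝ} (ht : 0 ≤ t) (A : SL) : 0 < yF t A := zero_lt_one.trans_le (one_le_yF ht A)

theorem hasDerivAt_cF (t : ℝ) (A : SL) :
    HasDerivAt (fun s => cF s A) (esq A * sF t A) t := by
  have h1 : (fun s => cF s A) = fun s => Real.cosh (s * ‖casimir A‖) := funext fun s => cF_eq s A
  rw [h1]
  have h2 := (((hasDerivAt_id t).mul_const ‖casimir A‖)).cosh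
  refine h2.congr_deriv ?_
  simp only [id, one_mul]
  rw [esq_eq, sq, mul_assoc, sF_eq]; ring

theorem hasDerivAt_sF (t : ℝ) (A : SL) : HasDerivAt (fun s => sF s A) (cF t A) t := by
  rcases eq_or_ne ‖casimir A‖ 0 with h0 | h0
  · have he : esq A = 0 := by rw [esq_eq, h0]; norm_num
    have h1 : (fun s => sF s A) = fun s => s := funext fun s => by
      have : sinhCoeff 0 = 1 := by simp [sinhCoeff]
      rw [sF, he, mul_zero, ser, tsum_eq_single 0 (fun k hk => by simp [hk])]
      simp [this]
    rw [h1, cF_eq, h0, mul_zero, Real.cosh_zero]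
    exact hasDerivAt_id t
  · have h1 : (fun s => sF s A) = fun s => Real.sinh (s * ‖casimir A‖) / ‖casimir A‖ :=
      funext fun s => by rw [← sF_eq]; field_simp
    rw [h1]
    have h2 := (((hasDerivAt_id t).mul_const ‖casimir A‖)).sinh.div_const ‖casimir A‖
    refine h2.congr_deriv ?_
    simp only [id, one_mul]
    rw [cF_eq]
    field_simp

theorem flow_eq_comb (t : ℝ) (A : SL) : flow t A =
    ((√(yF t A))⁻¹ * cF t A) • A - ((√(yF t A))⁻¹ * sF t A) • casimirStar A := by
  rw [flow, smul_sub, smul_smul, smul_smul]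

theorem inv_sqrt_sq {y : ℝ} (hy : 0 < y) : (√y)⁻¹ ^ 2 * y = 1 := by
  rw [inv_pow, Real.sq_sqrt hy.le, inv_mul_cancel₀ hy.ne']

/-- `yF` is exactly the factor by which `casimir_comb` multiplies `f`. -/
theorem casimir_flow {t : ℝ} (ht : 0 ≤ t) (A : SL) : casimir (flow t A) = casimir A := by
  have h := inv_sqrt_sq (yF_pos ht A)
  rw [flow_eq_comb, casimir_comb]
  have e : ((√(yF t A))⁻¹ * cF t A) ^ 2 + ((√(yF t A))⁻¹ * sF t A) ^ 2 * esq A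
      + (√(yF t A))⁻¹ * cF t A * ((√(yF t A))⁻¹ * sF t A) * rho A = 1 := by
    rw [← h, yF]; ring
  rw [e]; simp

theorem rho_flow {t : ℝ} (ht : 0 ≤ t) (A : SL) : rho (flow t A) * yF t A =
    (cF t A ^ 2 + esq A * sF t A ^ 2) * rho A + 4 * (cF t A * sF t A) * esq A := by
  have h := inv_sqrt_sq (yF_pos ht A)
  rw [flow_eq_comb, rho_comb]
  linear_combination ((cF t A ^ 2 + esq A * sF t A ^ 2) * rho A
    + 4 * (cF t A * sF t A) * esq A) * h

/-- Since `f · conj f · A = |f|² A`, the span of `A` and `f A*` is stable under `casimirStar`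
wherever `f` is unchanged. -/
theorem casimirStar_comb {p q : ℝ} {A : SL}
    (h : casimir (p • A - q • casimirStar A) = casimir A) :
    casimirStar (p • A - q • casimirStar A) = p • casimirStar A - (q * esq A) • A := by
  have e : cmul (casimir A) (cmul (starRingEnd ℂ (casimir A)) A) = esq A • A := by
    rw [cmul_cmul, Complex.mul_conj, cmul_ofReal]; rfl
  rw [casimirStar, h, conjTr_sub, conjTr_smul, conjTr_smul, conjTr_casimirStar, map_sub, map_smul,
    map_smul, e, smul_smul]
  rfl

/-- A manifestly decaying formula for `W` along the flow. -/
def flowW (t : ℝ) (A : SL) : SL :=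
  -(((√(yF t A))⁻¹ * ((√(yF t A))⁻¹ * (√(yF t A))⁻¹)) •
    ((esq A * sF t A) • A + (rho A * cF t A) • ((1 / 2 : ℝ) • A)
      + (cF t A • casimirStar A + rho A • (sF t A • ((1 / 2 : ℝ) • casimirStar A)))))

theorem W_flow_eq {t : ℝ} (ht : 0 ≤ t) (A : SL) : W (flow t A) =
    ((√(yF t A))⁻¹ * sF t A * esq A - rho (flow t A) / 2 * ((√(yF t A))⁻¹ * cF t A)) • A
     - ((√(yF t A))⁻¹ * cF t A - rho (flow t A) / 2 * ((√(yF t A))⁻¹ * sF t A))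
      • casimirStar A := by
  have h := casimir_flow ht A
  rw [W_eq]
  generalize hr : rho (flow t A) = r
  rw [flow_eq_comb] at h ⊢
  rw [casimirStar_comb h]
  module

/-- The coefficients in `W_flow_eq` are differences of large terms. The relations `c² - |f|² s² = 1`
and `y⁻¹ y = 1` cancel the leading parts and leave the factor `y^(-3/2)`. -/
theorem W_flow {t : ℝ} (ht : 0 ≤ t) (A : SL) : W (flow t A) = flowW t A := by
  have h := inv_sqrt_sq (yF_pos ht A)
  have hr := rho_flow ht A
  have hc := cF_sq t A
  rw [W_flow_eq ht, flowW]
  set s := (√(yF t A))⁻¹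
  have hr' : rho (flow t A) = s ^ 2 * ((cF t A ^ 2 + esq A * sF t A ^ 2) * rho A
      + 4 * (cF t A * sF t A) * esq A) := by
    rw [← hr]; linear_combination (-rho (flow t A)) * h
  have h' : s ^ 2 * (cF t A * cF t A + esq A * (sF t A * sF t A)
    + rho A * (cF t A * sF t A)) = 1 := h
  generalize cF t A = c at *
  generalize sF t A = S at *
  have e1 : s * S * esq A - rho (flow t A) / 2 * (s * c)
      = -(s * (s * s) * (esq A * S + rho A * c / 2)) := by
    rw [hr']
    linear_combination (-s * S * esq A) * h' - (s ^ 3 * esq A * S + s ^ 3 * rho A * c / 2) * hc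
  have e2 : s * c - rho (flow t A) / 2 * (s * S)
      = s * (s * s) * (c + rho A * S / 2) := by
    rw [hr']
    linear_combination (-s * c) * h' + (s ^ 3 * c + s ^ 3 * rho A * S / 2) * hc
  rw [e1, e2]
  module

theorem hasDerivAt_flow {t : ℝ} (ht : 0 ≤ t) (A : SL) :
    HasDerivAt (fun s => flow s A) (W (flow t A)) t := by
  have hy0 := yF_pos ht A
  have hc := hasDerivAt_cF t A
  have hs := hasDerivAt_sF t A
  have hy : HasDerivAt (fun s => yF s A) (4 * (cF t A * sF t A) * esq A
      + (cF t A ^ 2 + esq A * sF t A ^ 2) * rho A) t := by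
    refine (((hc.mul hc).add ((hs.mul hs).const_mul (esq A))).add
      ((hc.mul hs).const_mul (rho A))).congr_deriv ?_
    ring
  have hi := (hy.sqrt hy0.ne').inv (Real.sqrt_pos.2 hy0).ne'
  have hN := (hc.smul_const A).sub (hs.smul_const (casimirStar A))
  refine (hi.smul hN).congr_deriv ?_
  have hr := rho_flow ht A
  have h := inv_sqrt_sq hy0
  rw [W_flow_eq ht]
  simp only [Pi.inv_apply, Pi.sub_apply]
  -- The logarithmic derivative of `y` in time is `ρ(φ_t A)`; differentiating `y^(-1/2)` thus
  -- produces the term `-(ρ/2) φ_t(A)` of `W`.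
  have e : 4 * (cF t A * sF t A) * esq A + (cF t A ^ 2 + esq A * sF t A ^ 2) * rho A
      = rho (flow t A) * yF t A := by rw [hr]; ring
  rw [e]
  have hsq : √(yF t A) ^ 2 = yF t A := Real.sq_sqrt hy0.le
  have hp : 0 < √(yF t A) := Real.sqrt_pos.2 hy0
  rw [← hsq]
  simp only [Real.sqrt_sq hp.le]
  generalize √(yF t A) = q at *
  generalize rho (flow t A) = r at *
  match_scalars <;> field_simp <;> ring

theorem flow_zero (A : SL) : flow 0 A = A := by
  have hc : cF 0 A = 1 := by rw [cF_eq]; simp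
  have hs : sF 0 A = 0 := by simp [sF]
  rw [flow, yF, hc, hs]; simp

theorem contDiff_cF : ContDiff ℝ ∞ fun q : ℝ × SL => cF q.1 q.2 :=
  dominating_coshCoeff.contDiff.comp ((contDiff_fst.pow 2).mul (contDiff_esq.comp contDiff_snd))

theorem contDiff_sF : ContDiff ℝ ∞ fun q : ℝ × SL => sF q.1 q.2 :=
  contDiff_fst.mul (dominating_sinhCoeff.contDiff.comp
    ((contDiff_fst.pow 2).mul (contDiff_esq.comp contDiff_snd)))

theorem contDiff_yF : ContDiff ℝ ∞ fun q : ℝ × SL => yF q.1 q.2 :=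
  ((contDiff_cF.mul contDiff_cF).add ((contDiff_esq.comp contDiff_snd).mul
    (contDiff_sF.mul contDiff_sF))).add
    ((contDiff_rho.comp contDiff_snd).mul (contDiff_cF.mul contDiff_sF))

theorem contDiffAt_flow {q : ℝ × SL} (hq : 0 ≤ q.1) :
    ContDiffAt ℝ ∞ (fun q : ℝ × SL => flow q.1 q.2) q := by
  have hy := yF_pos hq q.2
  exact ((contDiff_yF.contDiffAt.sqrt hy.ne').inv (Real.sqrt_pos.2 hy).ne').smul
    ((contDiff_cF.smul contDiff_snd).sub (contDiff_sF.smul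
      (contDiff_casimirStar.comp contDiff_snd))).contDiffAt

theorem contDiff_flow {t : ℝ} (ht : 0 ≤ t) : ContDiff ℝ ∞ (flow t) := by
  rw [contDiff_iff_contDiffAt]
  intro A
  exact ContDiffAt.comp (f := fun A => (t, A)) A (contDiffAt_flow (q := (t, A)) ht)
    (contDiffAt_const.prodMk contDiffAt_id)

theorem isForwardFlow_flow : IsForwardFlow W flow where
  zero := flow_zero
  deriv A _ ht := (hasDerivAt_flow ht A).hasDerivWithinAt
  smooth _ hq := (contDiffAt_flow hq.1).contDiffWithinAt

theorem contDiff_W : ContDiff ℝ ∞ W := by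
  have h : W = fun A => -((rho A / 2) • A) - casimirStar A := funext W_eq
  rw [h]
  exact ((contDiff_rho.div_const 2).smul contDiff_id).neg.sub contDiff_casimirStar

/-- The flow of `W` preserves `W`. -/
theorem fderiv_flow_W {t : ℝ} (ht : 0 ≤ t) (A : SL) : fderiv ℝ (flow t) A (W A) = flowW t A := by
  -- The derivative is computed along the line `A + u W`, where `m u` is the factor acquired by `f`.
  -- As `m'(0) = 0`, the quantities `|f|²`, `c` and `s` are stationary at `u = 0`; only `ρ` and the
  -- two vectors vary to first order.
  let m : ℝ → ℝ := fun u => (1 - u * (rho A / 2)) ^ 2 + u ^ 2 * esq A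
    + (1 - u * (rho A / 2)) * u * rho A
  have hp : HasDerivAt (fun u : ℝ => 1 - u * (rho A / 2)) (-(rho A / 2)) 0 :=
    (((hasDerivAt_id (0 : ℝ)).mul_const (rho A / 2)).const_sub 1).congr_deriv (by ring)
  have hid := hasDerivAt_id (0 : ℝ)
  have hm0 : m 0 = 1 := by simp [m]
  have hm : HasDerivAt m 0 0 := by
    refine (((hp.pow 2).add ((hid.pow 2).mul_const (esq A))).add
      ((hp.mul hid).mul_const (rho A))).congr_deriv ?_
    simp
    ring
  have hγ : ∀ u : ℝ, A + u • W A = (1 - u * (rho A / 2)) • A - u • casimirStar A := fun u => by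
    rw [W_eq]; module
  have hcas : ∀ u : ℝ, casimir (A + u • W A) = (m u : ℝ) * casimir A := fun u => by
    rw [hγ, casimir_comb]
  have he : ∀ u : ℝ, esq (A + u • W A) = m u ^ 2 * esq A := fun u => by
    rw [esq, hcas, Complex.normSq_mul, Complex.normSq_ofReal, sq]; rfl
  have hrho : ∀ u : ℝ, rho (A + u • W A) = ((1 - u * (rho A / 2)) ^ 2 + u ^ 2 * esq A) * rho A
      + 4 * (1 - u * (rho A / 2)) * u * esq A := fun u => by rw [hγ, rho_comb]
  have hCs : ∀ u : ℝ, casimirStar (A + u • W A)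
      = m u • ((1 - u * (rho A / 2)) • casimirStar A - (u * esq A) • A) := fun u => by
    have e : cmul (casimir A) (cmul (starRingEnd ℂ (casimir A)) A) = esq A • A := by
      rw [cmul_cmul, Complex.mul_conj, cmul_ofReal]; rfl
    rw [casimirStar, hcas, hγ, conjTr_sub, conjTr_smul, conjTr_smul, conjTr_casimirStar,
      ← cmul_cmul, cmul_ofReal, map_sub, map_smul, map_smul, e, smul_smul]
    rfl
  have hz : HasDerivAt (fun u : ℝ => t ^ 2 * esq (A + u • W A)) 0 0 := by
    simp only [he]
    refine (((hm.pow 2).mul_const (esq A)).const_mul (t ^ 2)).congr_deriv ?_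
    simp
  have hW0 : A + (0 : ℝ) • W A = A := by simp
  have hc : HasDerivAt (fun u : ℝ => cF t (A + u • W A)) 0 0 := by
    refine ((dominating_coshCoeff.hasDerivAt _).comp (0 : ℝ) hz).congr_deriv ?_
    simp
  have hs : HasDerivAt (fun u : ℝ => sF t (A + u • W A)) 0 0 := by
    refine (((dominating_sinhCoeff.hasDerivAt _).comp (0 : ℝ) hz).const_mul t).congr_deriv ?_
    simp
  have hr : HasDerivAt (fun u : ℝ => rho (A + u • W A)) (4 * esq A - rho A ^ 2) 0 := by
    simp only [hrho]
    refine ((((hp.pow 2).add ((hid.pow 2).mul_const (esq A))).mul_const (rho A)).add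
      (((hp.const_mul 4).mul hid).mul_const (esq A))).congr_deriv ?_
    simp
    ring
  have hesq : HasDerivAt (fun u : ℝ => esq (A + u • W A)) 0 0 := by
    simp only [he]
    refine ((hm.pow 2).mul_const (esq A)).congr_deriv ?_
    simp
  have hy : HasDerivAt (fun u : ℝ => yF t (A + u • W A))
      ((4 * esq A - rho A ^ 2) * (cF t A * sF t A)) 0 := by
    refine (((hc.mul hc).add (hesq.mul (hs.mul hs))).add (hr.mul (hc.mul hs))).congr_deriv ?_
    simp
  have hy0 := yF_pos ht A
  have hi := (hy.sqrt (by rw [hW0]; exact hy0.ne')).inv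
    (by rw [hW0]; exact (Real.sqrt_pos.2 hy0).ne')
  have hline : HasDerivAt (fun u : ℝ => A + u • W A) (W A) 0 := by
    refine ((hid.smul_const (W A)).const_add A).congr_deriv ?_
    simp
  have hStar : HasDerivAt (fun u : ℝ => casimirStar (A + u • W A))
      (-(rho A / 2) • casimirStar A - esq A • A) 0 := by
    simp only [hCs]
    refine (hm.smul ((hp.smul_const (casimirStar A)).sub
      ((hid.mul_const (esq A)).smul_const A))).congr_deriv ?_
    simp [hm0]
  have hflow := hi.smul ((hc.smul hline).sub (hs.smul hStar))
  have hd : HasFDerivAt (flow t) (fderiv ℝ (flow t) A) (A + (0 : ℝ) • W A) := by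
    rw [hW0]
    exact ((contDiff_flow ht).differentiable (by simp) A).hasFDerivAt
  have h1 := hd.comp_hasDerivAt (0 : ℝ) hline
  have h2 := h1.unique hflow
  rw [h2]
  simp only [Pi.inv_apply, Pi.sub_apply, Pi.smul_apply', zero_smul, add_zero]
  have hcs := cF_sq t A
  have h := inv_sqrt_sq hy0
  have hp0 : 0 < √(yF t A) := Real.sqrt_pos.2 hy0
  have hsq : √(yF t A) ^ 2
      = cF t A * cF t A + esq A * (sF t A * sF t A) + rho A * (cF t A * sF t A) :=
    Real.sq_sqrt hy0.le
  rw [flowW, W_eq]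
  generalize √(yF t A) = q at *
  generalize cF t A = c at *
  generalize sF t A = S at *
  have e1 : -((4 * esq A - rho A ^ 2) * (c * S) / (2 * q)) / q ^ 2 * c
      + q⁻¹ * (c * (-(rho A / 2)) + S * esq A) = -(q⁻¹ * (q⁻¹ * q⁻¹) * (esq A * S + rho A * c / 2)) := by
    field_simp
    linear_combination (-c * rho A + 2 * S * esq A) * hsq - (2 * S * esq A + c * rho A) * hcs
  have e2 : -((4 * esq A - rho A ^ 2) * (c * S) / (2 * q)) / q ^ 2 * S
      + q⁻¹ * (c + S * (-(rho A / 2))) = q⁻¹ * (q⁻¹ * q⁻¹) * (c + rho A * S / 2) := by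
    field_simp
    linear_combination (2 * c - rho A * S) * hsq + (2 * c + rho A * S) * hcs
  have e3 : -((q⁻¹ * (q⁻¹ * q⁻¹)) • ((esq A * S) • A + (rho A * c) • ((1 / 2 : ℝ) • A)
      + (c • casimirStar A + rho A • (S • ((1 / 2 : ℝ) • casimirStar A)))))
      = (-(q⁻¹ * (q⁻¹ * q⁻¹) * (esq A * S + rho A * c / 2))) • A
        - (q⁻¹ * (q⁻¹ * q⁻¹) * (c + rho A * S / 2)) • casimirStar A := by module
  rw [e3, ← e1, ← e2]
  module

theorem norm_conjTr (A : SL) : ‖conjTr A‖ = ‖A‖ := by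
  have h : ‖conjTr A‖ ^ 2 = ‖A‖ ^ 2 := by
    rw [norm_sq_eq_rho, norm_sq_eq_rho, rho, rho]
    simp [mat_conjTr, Complex.normSq_conj]
    ring
  exact (pow_left_inj₀ (norm_nonneg _) (norm_nonneg _) two_ne_zero).1 h

theorem norm_cmul (z : ℂ) (A : SL) : ‖cmul z A‖ = ‖z‖ * ‖A‖ := by
  have h : ‖cmul z A‖ ^ 2 = (‖z‖ * ‖A‖) ^ 2 := by
    rw [mul_pow, norm_sq_eq_rho, norm_sq_eq_rho, rho, rho]
    simp only [mat_cmul, Matrix.smul_apply, smul_eq_mul, Complex.normSq_mul]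
    simp only [Complex.normSq_eq_norm_sq]
    ring
  exact (pow_left_inj₀ (norm_nonneg _) (by positivity) two_ne_zero).1 h

theorem norm_casimirStar (A : SL) : ‖casimirStar A‖ = ‖casimir A‖ * ‖A‖ := by
  rw [casimirStar, norm_cmul, norm_conjTr]

/-! ### Jets of the flow -/

section FlowJets

variable {ι : Type*} {n : ℕ} {R : ℝ} {t : ι → ℝ} {a : ι → SL}

/-- The cost of a derivative along the flow. -/
def timeWeight (t : ℝ) : ℝ := (1 + t) ^ 2

theorem one_le_timeWeight {t : ℝ} (ht : 0 ≤ t) : 1 ≤ timeWeight t := by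
  unfold timeWeight; nlinarith

theorem inv_timeWeight_mul_le {t : ℝ} (ht : 0 ≤ t) : (timeWeight t)⁻¹ * t ≤ 1 := by
  rw [inv_mul_le_iff₀ (by unfold timeWeight; positivity), timeWeight]; nlinarith

theorem inv_timeWeight_mul_sq_le {t : ℝ} (ht : 0 ≤ t) : (timeWeight t)⁻¹ * t ^ 2 ≤ 1 := by
  rw [inv_mul_le_iff₀ (by unfold timeWeight; positivity), timeWeight]; nlinarith

/-- A derivative of `t²|f|²` costs at most a constant times `t² ≤ (1 + t)²`, and the series bounds
its own derivatives. -/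
theorem jet_ser_esq (ht : ∀ i, 0 ≤ t i) (ha : ∀ i, ‖a i‖ ≤ R) {c : ℕ → ℝ} (hc : Dominating c) :
    JetBound n (fun i A => ser c (t i ^ 2 * esq A)) a
      (fun i => ser c (t i ^ 2 * esq (a i))) (fun i => timeWeight (t i)) := by
  obtain ⟨-, -, -, C, hC0, hC⟩ := JetBound.of_contDiff_one (ι := ι) (n := n) (b := fun _ => 1)
    contDiff_esq ha (fun _ => le_rfl)
  have hz : ∀ i, 0 ≤ t i ^ 2 * esq (a i) := fun i => mul_nonneg (sq_nonneg _) (esq_nonneg _)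
  refine JetBound.comp (u := fun i A => t i ^ 2 * esq A) (g := fun _ => ser c) (t := univ)
    uniqueDiffOn_univ (fun i => one_le_timeWeight (ht i)) (fun i => hc.ser_nonneg (hz i))
    (fun i => contDiff_const.mul contDiff_esq) (fun _ _ => mem_univ _) ⟨C, fun i j hj hjn => ?_⟩
    (fun _ => hc.contDiff.contDiffOn) ⟨1, zero_le_one, fun i j hj => ?_⟩
  · have e : (fun A => t i ^ 2 * esq A) = (t i ^ 2) • esq := rfl
    rw [e, iteratedFDeriv_const_smul_apply (contDiff_esq.of_le (natCast_le_infty j)).contDiffAt,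
      norm_smul, Real.norm_of_nonneg (sq_nonneg _)]
    have h1 := hC i j hjn
    simp only [one_pow, mul_one] at h1
    have h2 : t i ^ 2 ≤ timeWeight (t i) := by unfold timeWeight; nlinarith [ht i]
    have h3 : timeWeight (t i) ≤ timeWeight (t i) ^ j :=
      le_self_pow₀ (one_le_timeWeight (ht i)) (by omega)
    calc _ ≤ timeWeight (t i) ^ j * C :=
          mul_le_mul (h2.trans h3) h1 (norm_nonneg _) ((sq_nonneg _).trans (h2.trans h3))
      _ = _ := mul_comm _ _
  · rw [iteratedFDerivWithin_univ, one_mul]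
    exact hc.iteratedDeriv_le (hz i) j

variable (n) in
theorem jet_cF (ht : ∀ i, 0 ≤ t i) (ha : ∀ i, ‖a i‖ ≤ R) :
    JetBound n (fun i => cF (t i)) a (fun i => cF (t i) (a i)) (fun i => timeWeight (t i)) :=
  jet_ser_esq ht ha dominating_coshCoeff

variable (n) in
theorem jet_sF (ht : ∀ i, 0 ≤ t i) (ha : ∀ i, ‖a i‖ ≤ R) :
    JetBound n (fun i => sF (t i)) a (fun i => sF (t i) (a i)) (fun i => timeWeight (t i)) := by
  have h := (JetBound.const (E := SL) (n := n) (a := a) (c := t)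
    fun i => one_le_timeWeight (ht i)).mul (jet_ser_esq ht ha dominating_sinhCoeff)
  refine h.mono (fun i => sF_nonneg (ht i) _) 1 fun i => ?_
  rw [Real.norm_of_nonneg (ht i), one_mul]
  rfl

variable (n) in
-- The factors `|f|²` and `ρ` bring additional terms `b⁻¹ s²` and `b⁻¹ c s`. By `s ≤ t c` these are
-- at most `b⁻¹ t² c²` and `b⁻¹ t c²`, which the choice `b = (1 + t)²` absorbs into `c² ≤ y`.
theorem jet_yF (ht : ∀ i, 0 ≤ t i) (ha : ∀ i, ‖a i‖ ≤ R) :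
    JetBound n (fun i => yF (t i)) a (fun i => yF (t i) (a i)) (fun i => timeWeight (t i)) := by
  have hb : ∀ i, 1 ≤ timeWeight (t i) := fun i => one_le_timeWeight (ht i)
  have hc := jet_cF n ht ha
  have hs := jet_sF n ht ha
  have he := JetBound.of_contDiff (n := n) contDiff_esq ha hb
  have hr := JetBound.of_contDiff (n := n) contDiff_rho ha hb
  have hy0 : ∀ i, 0 ≤ yF (t i) (a i) := fun i => (yF_pos (ht i) _).le
  have h0 : ∀ i, 0 ≤ (timeWeight (t i))⁻¹ := fun i => by have := hb i; positivity
  have hy : ∀ i, yF (t i) (a i) = cF (t i) (a i) * cF (t i) (a i)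
    + esq (a i) * (sF (t i) (a i) * sF (t i) (a i))
    + rho (a i) * (cF (t i) (a i) * sF (t i) (a i)) := fun i => rfl
  have k1 : ∀ i, 0 ≤ esq (a i) * (sF (t i) (a i) * sF (t i) (a i)) := fun i =>
    mul_nonneg (esq_nonneg _) (mul_self_nonneg _)
  have k2 : ∀ i, 0 ≤ rho (a i) * (cF (t i) (a i) * sF (t i) (a i)) := fun i =>
    mul_nonneg (rho_nonneg _) (mul_nonneg (zero_le_one.trans (one_le_cF _ _)) (sF_nonneg (ht i) _))
  refine JetBound.add (JetBound.add ((hc.mul hc).mono hy0 1 fun i => ?_)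
    ((he.mul (hs.mul hs)).mono hy0 2 fun i => ?_)) ((hr.mul (hc.mul hs)).mono hy0 2 fun i => ?_)
  · have := k1 i
    have := k2 i
    rw [hy i]; linarith
  · rw [Real.norm_of_nonneg (esq_nonneg _), add_mul]
    have h1 : (timeWeight (t i))⁻¹ * (sF (t i) (a i) * sF (t i) (a i))
        ≤ cF (t i) (a i) * cF (t i) (a i) := by
      have h2 := sF_le (ht i) (a i)
      have h3 := sF_nonneg (ht i) (a i)
      have h4 := inv_timeWeight_mul_sq_le (ht i)
      have h5 := h3.trans h2
      calc _ ≤ (timeWeight (t i))⁻¹ * ((t i * cF (t i) (a i)) * (t i * cF (t i) (a i))) := by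
            have := h0 i
            gcongr
        _ = ((timeWeight (t i))⁻¹ * t i ^ 2) * (cF (t i) (a i) * cF (t i) (a i)) := by ring
        _ ≤ 1 * (cF (t i) (a i) * cF (t i) (a i)) :=
            mul_le_mul_of_nonneg_right h4 (mul_self_nonneg _)
        _ = _ := one_mul _
    have := k1 i
    have := k2 i
    have := mul_self_nonneg (cF (t i) (a i))
    rw [hy i]; linarith
  · rw [Real.norm_of_nonneg (rho_nonneg _), add_mul]
    have h1 : (timeWeight (t i))⁻¹ * (cF (t i) (a i) * sF (t i) (a i))
        ≤ cF (t i) (a i) * cF (t i) (a i) := by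
      have h2 := sF_le (ht i) (a i)
      have h3 := zero_le_one.trans (one_le_cF (t i) (a i))
      have h4 := inv_timeWeight_mul_le (ht i)
      calc _ ≤ (timeWeight (t i))⁻¹ * (cF (t i) (a i) * (t i * cF (t i) (a i))) := by
            have := h0 i
            gcongr
        _ = ((timeWeight (t i))⁻¹ * t i) * (cF (t i) (a i) * cF (t i) (a i)) := by ring
        _ ≤ 1 * (cF (t i) (a i) * cF (t i) (a i)) :=
            mul_le_mul_of_nonneg_right h4 (mul_self_nonneg _)
        _ = _ := one_mul _
    have := k1 i
    have := k2 i
    have := mul_self_nonneg (cF (t i) (a i))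
    rw [hy i]; linarith

theorem contDiffOn_inv_sqrt : ContDiffOn ℝ ∞ (fun z : ℝ => (√z)⁻¹) (Ioi 0) := fun _ hz =>
  ((contDiffAt_id.sqrt (ne_of_gt hz)).inv (Real.sqrt_pos.2 hz).ne').contDiffWithinAt

variable (n) in
-- Homogeneity: `y^(-1/2) = y(a)^(-1/2) h(y/y(a))` with `h(z) = z^(-1/2)`. The inner function equals
-- `1` at the base point, so only the derivatives of `h` at `1` enter and the constants are uniform.
theorem jet_inv_sqrt_yF (ht : ∀ i, 0 ≤ t i) (ha : ∀ i, ‖a i‖ ≤ R) :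
    JetBound n (fun i A => (√(yF (t i) A))⁻¹) a (fun i => (√(yF (t i) (a i)))⁻¹)
      (fun i => timeWeight (t i)) := by
  have hb : ∀ i, 1 ≤ timeWeight (t i) := fun i => one_le_timeWeight (ht i)
  have hy0 : ∀ i A, 0 < yF (t i) A := fun i A => yF_pos (ht i) _
  obtain ⟨hys, -, -, C, hC0, hC⟩ := jet_yF n ht ha
  set h : ℝ → ℝ := fun z => (√z)⁻¹ with hh
  have key : JetBound n (fun i A => (√(yF (t i) (a i)))⁻¹ • h ((yF (t i) (a i))⁻¹ • yF (t i) A)) a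
      (fun i => (√(yF (t i) (a i)))⁻¹) (fun i => timeWeight (t i)) := by
    refine JetBound.comp (u := fun i A => (yF (t i) (a i))⁻¹ • yF (t i) A)
      (g := fun i z => (√(yF (t i) (a i)))⁻¹ • h z) (t := Ioi 0) (uniqueDiffOn_Ioi 0) hb
      (fun i => by positivity) (fun i => (hys i).const_smul _)
      (fun i A => mul_pos (inv_pos.2 (hy0 i _)) (hy0 i A)) ⟨C, fun i j hj hjn => ?_⟩
      (fun i => contDiffOn_inv_sqrt.const_smul _)
      ⟨∑ j ∈ Finset.range (n + 1), ‖iteratedFDerivWithin ℝ j h (Ioi 0) 1‖, by positivity,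
        fun i j hj => ?_⟩
    · have e : (fun A => (yF (t i) (a i))⁻¹ • yF (t i) A) = (yF (t i) (a i))⁻¹ • yF (t i) := rfl
      rw [e, iteratedFDeriv_const_smul_apply ((hys i).of_le (natCast_le_infty j)).contDiffAt,
        norm_smul, Real.norm_of_nonneg (inv_nonneg.2 (hy0 i _).le), inv_mul_le_iff₀ (hy0 i _)]
      refine (hC i j hjn).trans_eq ?_
      ring
    · have e : (yF (t i) (a i))⁻¹ • yF (t i) (a i) = 1 := inv_mul_cancel₀ (hy0 i _).ne'
      have e2 : (fun z => (√(yF (t i) (a i)))⁻¹ • h z) = (√(yF (t i) (a i)))⁻¹ • h := rfl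
      rw [e, e2, iteratedFDerivWithin_const_smul_apply
        ((contDiffOn_inv_sqrt.of_le (natCast_le_infty j)) 1 (mem_Ioi.2 one_pos)) (uniqueDiffOn_Ioi 0) (mem_Ioi.2 one_pos),
        norm_smul, Real.norm_of_nonneg (by positivity), mul_comm]
      gcongr
      exact Finset.single_le_sum (f := fun j => ‖iteratedFDerivWithin ℝ j h (Ioi 0) 1‖)
        (fun _ _ => norm_nonneg _) (Finset.mem_range.2 (by omega))
  convert key using 3 with i A
  simp only [hh, smul_eq_mul]
  rw [Real.sqrt_mul (inv_nonneg.2 (hy0 i _).le), Real.sqrt_inv, mul_inv, inv_inv, ← mul_assoc,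
    inv_mul_cancel₀ (Real.sqrt_pos.2 (hy0 i _)).ne', one_mul]

theorem inv_sqrt_yF_mul_cF_le {t : ℝ} (ht : 0 ≤ t) (A : SL) : (√(yF t A))⁻¹ * cF t A ≤ 1 := by
  rw [inv_mul_le_iff₀ (Real.sqrt_pos.2 (yF_pos ht A)), mul_one]
  exact Real.le_sqrt_of_sq_le (sq_cF_le_yF ht A)

variable (n) in
theorem jet_sF_casimirStar (ht : ∀ i, 0 ≤ t i) (ha : ∀ i, ‖a i‖ ≤ R) :
    JetBound n (fun i A => sF (t i) A • casimirStar A) a (fun i => cF (t i) (a i))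
      (fun i => timeWeight (t i)) := by
  have hb : ∀ i, 1 ≤ timeWeight (t i) := fun i => one_le_timeWeight (ht i)
  refine ((jet_sF n ht ha).smul (JetBound.of_contDiff contDiff_casimirStar ha hb)).mono
    (fun i => zero_le_one.trans (one_le_cF _ _)) (R + 1) fun i => ?_
  rw [norm_casimirStar, mul_add]
  have h1 := sF_le (ht i) (a i)
  have h2 := inv_timeWeight_mul_le (ht i)
  have h3 := norm_casimir_mul_sF_le (t := t i) (a i)
  have h4 := one_le_cF (t i) (a i)
  have h0 : 0 ≤ (timeWeight (t i))⁻¹ := by have := hb i; positivity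
  have h5 : sF (t i) (a i) * (timeWeight (t i))⁻¹ ≤ cF (t i) (a i) := by
    calc _ ≤ t i * cF (t i) (a i) * (timeWeight (t i))⁻¹ := by gcongr
      _ = ((timeWeight (t i))⁻¹ * t i) * cF (t i) (a i) := by ring
      _ ≤ 1 * cF (t i) (a i) := by gcongr
      _ = _ := one_mul _
  have h6 : sF (t i) (a i) * (‖casimir (a i)‖ * ‖a i‖) ≤ cF (t i) (a i) * R := by
    calc _ = (‖casimir (a i)‖ * sF (t i) (a i)) * ‖a i‖ := by ring
      _ ≤ cF (t i) (a i) * R := mul_le_mul h3 (ha i) (norm_nonneg _) (by linarith)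
  linarith

variable (n) in
-- The vector `c A - s f A*` has weight `c`, which `y^(-1/2) ≤ 1/c` compensates.
theorem jet_flow (ht : ∀ i, 0 ≤ t i) (ha : ∀ i, ‖a i‖ ≤ R) :
    JetBound n (fun i => flow (t i)) a (fun _ => 1) (fun i => timeWeight (t i)) := by
  have hb : ∀ i, 1 ≤ timeWeight (t i) := fun i => one_le_timeWeight (ht i)
  have hc0 : ∀ i, 0 ≤ cF (t i) (a i) := fun i => zero_le_one.trans (one_le_cF _ _)
  have h1 := (jet_cF n ht ha).smul (JetBound.of_contDiff_one (n := n) contDiff_id ha hb)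
  have h2 := (jet_sF_casimirStar n ht ha).clm_comp (-ContinuousLinearMap.id ℝ SL)
  have h3 := (h1.mono hc0 1 fun i => by simp).add h2
  have h := ((jet_inv_sqrt_yF n ht ha).smul h3).mono (w' := fun _ => 1) (fun _ => zero_le_one) 1
    fun i => by rw [one_mul]; exact inv_sqrt_yF_mul_cF_le (ht i) _
  convert h using 3 with i A
  rw [flow, sub_eq_add_neg]; rfl

variable (n) in
-- Every term in the bracket of `flowW` has weight `c`, and the three factors `y^(-1/2) ≤ 1/c` leave
-- `c⁻²`. This is the exponential decay off the cone.
theorem jet_flowW (ht : ∀ i, 0 ≤ t i) (ha : ∀ i, ‖a i‖ ≤ R) :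
    JetBound n (fun i => flowW (t i)) a (fun i => (cF (t i) (a i) ^ 2)⁻¹)
      (fun i => timeWeight (t i)) := by
  have hb : ∀ i, 1 ≤ timeWeight (t i) := fun i => one_le_timeWeight (ht i)
  have hc0 : ∀ i, 0 < cF (t i) (a i) := fun i => zero_lt_one.trans_le (one_le_cF _ _)
  have hi := jet_inv_sqrt_yF n ht ha
  have hc := jet_cF n ht ha
  have hs := jet_sF n ht ha
  have he := JetBound.of_contDiff (n := n) contDiff_esq ha hb
  have hr := JetBound.of_contDiff_one (n := n) contDiff_rho ha hb
  have hA := JetBound.of_contDiff_one (n := n) contDiff_id ha hb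
  have hCs := JetBound.of_contDiff_one (n := n) contDiff_casimirStar ha hb
  have h1 : JetBound n (fun i A => (esq A * sF (t i) A) • id A) a (fun i => cF (t i) (a i))
      (fun i => timeWeight (t i)) := by
    refine ((he.mul hs).smul hA).mono (fun i => (hc0 i).le) (R ^ 2 + 1) fun i => ?_
    rw [Real.norm_of_nonneg (esq_nonneg _), mul_one, add_mul]
    have k1 := sF_le (ht i) (a i)
    have k2 := inv_timeWeight_mul_le (ht i)
    have k3 := norm_casimir_mul_sF_le (t := t i) (a i)
    have k4 := one_le_cF (t i) (a i)
    have h0 : 0 ≤ (timeWeight (t i))⁻¹ := by have := hb i; positivity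
    have h5 : (timeWeight (t i))⁻¹ * sF (t i) (a i) ≤ cF (t i) (a i) := by
      calc _ ≤ (timeWeight (t i))⁻¹ * (t i * cF (t i) (a i)) := by gcongr
        _ = ((timeWeight (t i))⁻¹ * t i) * cF (t i) (a i) := by ring
        _ ≤ 1 * cF (t i) (a i) := by gcongr
        _ = _ := one_mul _
    have h7 : ‖casimir (a i)‖ ≤ R ^ 2 := by
      have := norm_casimir_le (a i)
      rw [← norm_sq_eq_rho] at this
      have h8 : ‖a i‖ ^ 2 ≤ R ^ 2 := pow_le_pow_left₀ (norm_nonneg _) (ha i) 2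
      nlinarith [norm_nonneg (casimir (a i))]
    have h6 : esq (a i) * sF (t i) (a i) ≤ R ^ 2 * cF (t i) (a i) := by
      calc _ = ‖casimir (a i)‖ * (‖casimir (a i)‖ * sF (t i) (a i)) := by rw [esq_eq]; ring
        _ ≤ R ^ 2 * cF (t i) (a i) := mul_le_mul h7 k3
            (mul_nonneg (norm_nonneg _) (sF_nonneg (ht i) _)) (sq_nonneg R)
    linarith
  have h2 := (hr.mul hc).smul (hA.clm_comp ((1 / 2 : ℝ) • ContinuousLinearMap.id ℝ SL))
  have h3 := hc.smul hCs
  have h4 := hr.smul ((jet_sF_casimirStar n ht ha).clm_comp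
    ((1 / 2 : ℝ) • ContinuousLinearMap.id ℝ SL))
  have h5 := (h1.add (h2.mono (fun i => (hc0 i).le) 1 fun i => by simp)).add
    ((h3.mono (fun i => (hc0 i).le) 1 fun i => by simp).add
      (h4.mono (fun i => (hc0 i).le) 1 fun i => by simp))
  have h6 := ((hi.mul (hi.mul hi)).smul h5).clm_comp (-ContinuousLinearMap.id ℝ SL)
  have h7 := h6.mono (w' := fun i => (cF (t i) (a i) ^ 2)⁻¹)
    (fun i => by have := hc0 i; positivity) 1 fun i => by
      rw [one_mul]
      have k1 := inv_sqrt_yF_mul_cF_le (ht i) (a i)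
      have k2 : (√(yF (t i) (a i)))⁻¹ ≤ (cF (t i) (a i))⁻¹ :=
        inv_anti₀ (hc0 i) (Real.le_sqrt_of_sq_le (sq_cF_le_yF (ht i) _))
      have k3 : 0 ≤ (√(yF (t i) (a i)))⁻¹ := by positivity
      have k4 := (hc0 i).le
      calc _ = ((√(yF (t i) (a i)))⁻¹ * (√(yF (t i) (a i)))⁻¹)
            * ((√(yF (t i) (a i)))⁻¹ * cF (t i) (a i)) := by ring
        _ ≤ ((cF (t i) (a i))⁻¹ * (cF (t i) (a i))⁻¹) * 1 := by gcongr
        _ = _ := by rw [mul_one, ← mul_inv, sq]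
  convert h7 using 3 with i A
  rw [flowW]
  change _ = -(_ : SL)
  congr 2
  simp only [_root_.smul_apply, ContinuousLinearMap.id_apply, id,
    smul_comm (sF (t i) A) (1 / 2 : ℝ) (casimirStar A)]

end FlowJets

/-! ### Smooth dependence of integrals on parameters -/

section ParametricIntegral

variable {Ω E F : Type*} [MeasurableSpace Ω] [NormedAddCommGroup E] [NormedSpace ℝ E]
  [NormedAddCommGroup F] [NormedSpace ℝ F]

/-- Differentiation under the integral sign at every order: domination of each derivative on balls
makes the integral of the Taylor series the Taylor series of the integral. -/
theorem hasFTaylorSeriesUpTo_integral {ν : Measure Ω} [CompleteSpace F] {G : Ω → E → F}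
    (hs : ∀ᵐ z ∂ν, ContDiff ℝ ∞ (G z))
    (hm : ∀ (j : ℕ) (x : E), AEStronglyMeasurable (fun z => iteratedFDeriv ℝ j (G z) x) ν)
    (hb : ∀ (j : ℕ) (R : ℝ), ∃ g : Ω → ℝ, Integrable g ν ∧
      ∀ᵐ z ∂ν, ∀ x, ‖x‖ ≤ R → ‖iteratedFDeriv ℝ j (G z) x‖ ≤ g z) :
    HasFTaylorSeriesUpTo ((⊤ : ℕ∞) : ℕ∞ω) (fun x => ∫ z, G z x ∂ν)
      fun x j => ∫ z, iteratedFDeriv ℝ j (G z) x ∂ν := by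
  have hi : ∀ (j : ℕ) (x : E), Integrable (fun z => iteratedFDeriv ℝ j (G z) x) ν := fun j x => by
    obtain ⟨g, hg, h⟩ := hb j ‖x‖
    exact hg.mono' (hm j x) (h.mono fun z h => h x le_rfl)
  have hd : ∀ (j : ℕ) (x : E), HasFDerivAt (fun x => ∫ z, iteratedFDeriv ℝ j (G z) x ∂ν)
      (∫ z, iteratedFDeriv ℝ (j + 1) (G z) x ∂ν).curryLeft x := fun j x => by
    let c := (continuousMultilinearCurryLeftEquiv ℝ (fun _ : Fin (j + 1) => E)
      F).toContinuousLinearEquiv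
    have hc : ∀ z y, fderiv ℝ (iteratedFDeriv ℝ j (G z)) y
        = c (iteratedFDeriv ℝ (j + 1) (G z) y) := fun z y => by
      rw [iteratedFDeriv_succ_eq_comp_left]
      exact (LinearIsometryEquiv.apply_symm_apply _ _).symm
    have e : (∫ z, iteratedFDeriv ℝ (j + 1) (G z) x ∂ν).curryLeft
        = ∫ z, fderiv ℝ (iteratedFDeriv ℝ j (G z)) x ∂ν := by
      simp only [hc]
      exact (c.integral_comp_comm _).symm
    obtain ⟨g, hg, h⟩ := hb (j + 1) (‖x‖ + 1)
    rw [e]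
    refine hasFDerivAt_integral_of_dominated_of_fderiv_le (s := Metric.ball x 1) (bound := g)
      (F' := fun y z => fderiv ℝ (iteratedFDeriv ℝ j (G z)) y) (Metric.ball_mem_nhds x one_pos)
      (Eventually.of_forall fun y => hm j y) (hi j x) ?_ ?_ hg ?_
    · simp only [hc]
      exact c.continuous.comp_aestronglyMeasurable (hm (j + 1) x)
    · filter_upwards [h] with z h y hy
      rw [norm_fderiv_iteratedFDeriv]
      refine h y ?_
      have := norm_le_norm_add_norm_sub' y x
      rw [Metric.mem_ball, dist_eq_norm] at hy
      linarith
    · filter_upwards [hs] with z h y _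
      exact ((h.differentiable_iteratedFDeriv (m := j)
        (mod_cast ENat.natCast_lt_top j)) y).hasFDerivAt
  refine ⟨fun x => ?_, fun j _ x => hd j x, fun j _ => ?_⟩
  · have := (continuousMultilinearCurryFin0 ℝ E F).toContinuousLinearEquiv.integral_comp_comm
      (μ := ν) fun z => iteratedFDeriv ℝ 0 (G z) x
    exact this.symm.trans rfl
  · exact continuous_iff_continuousAt.2 fun x => (hd j x).continuousAt

/-- Joint smoothness of the derivatives in the second variable. -/
theorem contDiffAt_iteratedFDeriv_right {X : Type*} [NormedAddCommGroup X] [NormedSpace ℝ X]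
    {S : Set X} {u : X → E → F}
    (hu : ∀ p : X × E, p.1 ∈ S → ContDiffAt ℝ ∞ (fun p : X × E => u p.1 p.2) p) (j : ℕ) :
    ∀ p : X × E, p.1 ∈ S →
      ContDiffAt ℝ ∞ (fun p : X × E => iteratedFDeriv ℝ j (u p.1) p.2) p := by
  induction j with
  | zero =>
    intro p hp
    exact (continuousMultilinearCurryFin0 ℝ E F).symm.toContinuousLinearEquiv.contDiff.contDiffAt.comp
      p (hu p hp)
  | succ j ih =>
    intro p hp
    have h1 : ContDiffAt ℝ ∞ (fun p : X × E => fderiv ℝ (iteratedFDeriv ℝ j (u p.1)) p.2) p := by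
      refine ContDiffAt.fderiv (n := ∞) (f := fun (p : X × E) => iteratedFDeriv ℝ j (u p.1))
        (g := Prod.snd) ?_ contDiffAt_snd (mod_cast le_rfl)
      exact ContDiffAt.comp (g := fun p : X × E => iteratedFDeriv ℝ j (u p.1) p.2)
        (f := fun q : (X × E) × E => (q.1.1, q.2)) (p, p.2) (ih p hp)
        ((contDiffAt_fst.fst).prodMk contDiffAt_snd)
    exact (continuousMultilinearCurryLeftEquiv ℝ (fun _ : Fin (j + 1) => E)
      F).symm.toContinuousLinearEquiv.contDiff.contDiffAt.comp p h1

end ParametricIntegral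

/-! ### Flat bounds -/

/-- The derivatives of `α` up to order `n` are bounded by `M |A|ᴺ` on the ball of radius `r`. -/
def FlatBound {m : ℕ} (α : Form m) (n N : ℕ) (r M : ℝ) : Prop :=
  ∀ A, ‖A‖ ≤ r → ∀ j ≤ n, ‖iteratedFDeriv ℝ j α A‖ ≤ M * ‖A‖ ^ N

/-- Induction on `N`, for all orders `j` at once: as the `j`-th derivative vanishes at the origin,
the mean value inequality on the ball of radius `|A|` trades one derivative for one power of `|A|`.
-/
theorem exists_iteratedFDeriv_le {m : ℕ} (α : flatForms m) (N : ℕ) (r : ℝ) :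
    ∀ j : ℕ, ∃ M, 0 ≤ M ∧ ∀ A, ‖A‖ ≤ r → ‖iteratedFDeriv ℝ j α.1 A‖ ≤ M * ‖A‖ ^ N := by
  have : ProperSpace SL := FiniteDimensional.proper ℝ SL
  induction N with
  | zero =>
    intro j
    obtain ⟨C, hC⟩ := (isCompact_closedBall (0 : SL) r).exists_bound_of_continuousOn
      (α.2.1.continuous_iteratedFDeriv (natCast_le_infty j)).continuousOn
    refine ⟨max C 0, le_max_right _ _, fun A hA => ?_⟩
    rw [pow_zero, mul_one]
    exact (hC A (by simpa using hA)).trans (le_max_left _ _)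
  | succ N ih =>
    intro j
    obtain ⟨M, hM0, hM⟩ := ih (j + 1)
    refine ⟨M, hM0, fun A hA => ?_⟩
    have h1 := (convex_closedBall (0 : SL) ‖A‖).norm_image_sub_le_of_norm_fderiv_le
      (𝕜 := ℝ) (f := iteratedFDeriv ℝ j α.1) (C := M * ‖A‖ ^ N) (x := 0) (y := A)
      (fun B _ => α.2.1.differentiable_iteratedFDeriv (m := j)
        (mod_cast ENat.natCast_lt_top j) B)
      (fun B hB => by
        have hB : ‖B‖ ≤ ‖A‖ := by simpa using hB
        rw [norm_fderiv_iteratedFDeriv]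
        refine (hM B (hB.trans hA)).trans ?_
        gcongr) (by simp) (by simp)
    rw [α.2.2 j, sub_zero, sub_zero] at h1
    rw [pow_succ, ← mul_assoc]
    exact h1

theorem exists_flatBound {m : ℕ} (α : flatForms m) (n N : ℕ) (r : ℝ) :
    ∃ M, 0 ≤ M ∧ FlatBound α.1 n N r M := by
  choose M hM0 hM using exists_iteratedFDeriv_le α N r
  refine ⟨∑ j ∈ Finset.range (n + 1), M j, Finset.sum_nonneg fun j _ => hM0 j,
    fun A hA j hj => (hM j A hA).trans ?_⟩
  gcongr
  exact Finset.single_le_sum (f := M) (fun j _ => hM0 j) (Finset.mem_range.2 (by omega))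

theorem FlatBound.mono_exponent {m : ℕ} {α : Form m} {n N k : ℕ} {r M : ℝ}
    (h : FlatBound α n (N + k) r M) (hM : 0 ≤ M) : FlatBound α n N r (r ^ k * M) := fun A hA j hj => by
  refine (h A hA j hj).trans ?_
  rw [pow_add]
  have : ‖A‖ ^ k ≤ r ^ k := pow_le_pow_left₀ (norm_nonneg A) hA k
  calc M * (‖A‖ ^ N * ‖A‖ ^ k) ≤ M * (‖A‖ ^ N * r ^ k) := by gcongr
    _ = _ := by ring

/-- A smooth form with flat bounds is flat. -/
theorem mem_flatForms_of_flatBound {m : ℕ} {α : Form m} (hα : ContDiff ℝ ∞ α)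
    (h : ∀ n, ∃ M, FlatBound α n 1 1 M) : α ∈ flatForms m := by
  refine ⟨hα, fun n => ?_⟩
  obtain ⟨M, hM⟩ := h n
  have := hM 0 (by simp) n le_rfl
  rw [norm_zero, pow_one, mul_zero] at this
  exact norm_le_zero_iff.1 this

/-- A pointwise form of property SLB for `(0, b, c)`. -/
def PointwiseSLB {m m' : ℕ} (ℓ : flatForms m →ₗ[ℝ] flatForms m') (b c : ℕ) : Prop :=
  ∀ (R : ℝ) (n k : ℕ), ∃ C, 0 ≤ C ∧ ∀ r ≤ R, ∀ (α : flatForms m) (M : ℝ), 0 ≤ M →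
    FlatBound α.1 n (k + b * n + c) r M → FlatBound (ℓ α).1 n k r (C * M)

/-! ### From pointwise weighted estimates to property SLB -/

section SLB

variable {m m' m'' : ℕ}

theorem PointwiseSLB.comp {ℓ' : flatForms m' →ₗ[ℝ] flatForms m''}
    {ℓ : flatForms m →ₗ[ℝ] flatForms m'} {b c : ℕ} (h' : PointwiseSLB ℓ' 0 0)
    (h : PointwiseSLB ℓ b c) : PointwiseSLB (ℓ' ∘ₗ ℓ) b c := fun R n k => by
  obtain ⟨C, hC0, hC⟩ := h R n k
  obtain ⟨C', hC0', hC'⟩ := h' R n k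
  refine ⟨C' * C, by positivity, fun r hr α M hM hα => ?_⟩
  rw [mul_assoc]
  refine hC' r hr (ℓ α) (C * M) (by positivity) ?_
  simpa using hC r hr α M hM hα

theorem PointwiseSLB.add {ℓ ℓ' : flatForms m →ₗ[ℝ] flatForms m'} {b c : ℕ}
    (h : PointwiseSLB ℓ b c) (h' : PointwiseSLB ℓ' b c) : PointwiseSLB (ℓ + ℓ') b c :=
  fun R n k => by
  obtain ⟨C, hC0, hC⟩ := h R n k
  obtain ⟨C', hC0', hC'⟩ := h' R n k
  refine ⟨C + C', by positivity, fun r hr α M hM hα A hA j hj => ?_⟩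
  have h1 := hC r hr α M hM hα A hA j hj
  have h2 := hC' r hr α M hM hα A hA j hj
  have e : ((ℓ + ℓ') α).1 = (ℓ α).1 + (ℓ' α).1 := rfl
  rw [e, iteratedFDeriv_add ((ℓ α).2.1.of_le (natCast_le_infty j))
    ((ℓ' α).2.1.of_le (natCast_le_infty j))]
  calc _ ≤ C * M * ‖A‖ ^ k + C' * M * ‖A‖ ^ k := (norm_add_le _ _).trans (add_le_add h1 h2)
    _ = _ := by ring

theorem PointwiseSLB.mono {ℓ : flatForms m →ₗ[ℝ] flatForms m'} (h : PointwiseSLB ℓ 0 0)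
    (b c : ℕ) : PointwiseSLB ℓ b c := fun R n k => by
  obtain ⟨C, hC0, hC⟩ := h R n k
  refine ⟨C * |R| ^ (b * n + c), by positivity, fun r hr α M hM hα => ?_⟩
  rw [add_assoc] at hα
  rcases le_or_gt 0 r with h0 | h0
  · have h1 := hC r hr α (r ^ (b * n + c) * M) (by positivity) (by simpa using hα.mono_exponent hM)
    refine fun A hA j hj => (h1 A hA j hj).trans ?_
    have : r ^ (b * n + c) ≤ |R| ^ (b * n + c) := pow_le_pow_left₀ h0 (hr.trans (le_abs_self R)) _
    rw [← mul_assoc]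
    gcongr
  · intro A hA
    exact absurd ((norm_nonneg A).trans hA) (not_le.2 h0)

/-- The bound with `M = 0` expresses vanishing on the ball, so semilocality is a special case of the
estimate. -/
theorem flatBound_zero_iff {α : Form m} {N : ℕ} {r : ℝ} :
    FlatBound α 0 N r 0 ↔ ∀ A, ‖A‖ ≤ r → α A = 0 := by
  refine forall₂_congr fun A _ => ⟨fun h => ?_, fun h j hj => ?_⟩
  · simpa using h 0 le_rfl
  · obtain rfl : j = 0 := by omega
    simp [h]

theorem flatNorm_le_of_flatBound {α : flatForms m} {n k : ℕ} {r M : ℝ}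
    (h : FlatBound α.1 n k r M) : flatNorm n k r α ≤ ENNReal.ofReal M := by
  refine iSup₂_le fun A hA => iSup₂_le fun j hj => ENNReal.div_le_of_le_mul ?_
  have h1 := h A (by simpa using hA) j hj
  rw [← ofReal_norm, ← ofReal_norm, ← ENNReal.ofReal_pow (norm_nonneg _)]
  refine (ENNReal.ofReal_le_ofReal h1).trans ?_
  rw [ENNReal.ofReal_mul' (by positivity)]

theorem flatBound_of_flatNorm {α : flatForms m} {n k : ℕ} {r : ℝ} (h : flatNorm n k r α ≠ ⊤) :
    FlatBound α.1 n k r (flatNorm n k r α).toReal := fun A hA j hj => by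
  have h1 : ‖iteratedFDeriv ℝ j α.1 A‖ₑ / ‖A‖ₑ ^ k ≤ flatNorm n k r α :=
    (le_iSup₂ (f := fun j (_ : j ≤ n) => ‖iteratedFDeriv ℝ j α.1 A‖ₑ / ‖A‖ₑ ^ k) j hj).trans
      (le_iSup₂ (f := fun A (_ : A ∈ Metric.closedBall (0 : SL) r) =>
        ⨆ j ≤ n, ‖iteratedFDeriv ℝ j α.1 A‖ₑ / ‖A‖ₑ ^ k) A (by simpa using hA))
  rw [ENNReal.div_le_iff_le_mul (Or.inr h) (Or.inl (ENNReal.pow_ne_top enorm_ne_top))] at h1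
  have h2 := ENNReal.toReal_mono (ENNReal.mul_ne_top h (ENNReal.pow_ne_top enorm_ne_top)) h1
  rwa [ENNReal.toReal_mul, ENNReal.toReal_pow, toReal_enorm, toReal_enorm] at h2

/-- The induced operator is defined on chosen preimages; the kernel condition makes the choice
immaterial and the result linear. -/
theorem exists_linearMap_of_ker_le {U V X Y : Type*} [AddCommGroup U] [Module ℝ U]
    [AddCommGroup V] [Module ℝ V] [AddCommGroup X] [Module ℝ X] [AddCommGroup Y] [Module ℝ Y]
    (𝒱 : Submodule ℝ U) (𝒲 : Submodule ℝ V) (ρ : U →ₗ[ℝ] X) (σ : V →ₗ[ℝ] Y) (ℓ : U →ₗ[ℝ] V)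
    (hm : ∀ α ∈ 𝒱, ℓ α ∈ 𝒲) (h : ∀ α ∈ 𝒱, ρ α = 0 → σ (ℓ α) = 0) :
    ∃ L : 𝒱.map ρ →ₗ[ℝ] 𝒲.map σ, ∀ (α : U) (hα : α ∈ 𝒱),
      (L ⟨ρ α, Submodule.mem_map_of_mem hα⟩).1 = σ (ℓ α) := by
  have hch : ∀ x : 𝒱.map ρ, ∃ α ∈ 𝒱, ρ α = x.1 := fun x => x.2
  choose s hs hsx using hch
  have key : ∀ (x : 𝒱.map ρ) α, α ∈ 𝒱 → ρ α = x.1 → σ (ℓ (s x)) = σ (ℓ α) := fun x α hα hx => by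
    rw [← sub_eq_zero, ← map_sub, ← map_sub]
    exact h _ (𝒱.sub_mem (hs x) hα) (by rw [map_sub, hsx, hx, sub_self])
  refine ⟨{ toFun := fun x => ⟨σ (ℓ (s x)), Submodule.mem_map_of_mem (hm _ (hs x))⟩
            map_add' := fun x y => Subtype.ext ?_
            map_smul' := fun c x => Subtype.ext ?_ }, fun α hα => key _ α hα rfl⟩
  · change σ (ℓ (s (x + y))) = σ (ℓ (s x)) + σ (ℓ (s y))
    rw [key _ (s x + s y) (𝒱.add_mem (hs x) (hs y)) (by rw [map_add, hsx, hsx]; rfl), map_add,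
      map_add]
  · change σ (ℓ (s (c • x))) = c • σ (ℓ (s x))
    rw [key _ (c • s x) (𝒱.smul_mem c (hs x)) (by rw [map_smul, hsx]; rfl), map_smul, map_smul]

theorem PointwiseSLB.propertySLB {ℓ : flatForms m →ₗ[ℝ] flatForms m'} {b c : ℕ}
    (h : PointwiseSLB ℓ b c) {𝒱 : Submodule ℝ (flatForms m)} {𝒲 : Submodule ℝ (flatForms m')}
    (hm : ∀ α ∈ 𝒱, ℓ α ∈ 𝒲) : PropertySLB 𝒱 𝒲 ℓ 0 b c where
  maps := hm
  semilocal r hr := by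
    refine exists_linearMap_of_ker_le 𝒱 𝒲 _ _ ℓ hm fun α hα h0 => ?_
    obtain ⟨C, -, hC⟩ := h r 0 0
    have h1 : FlatBound α.1 0 (0 + b * 0 + c) r 0 := flatBound_zero_iff.2 fun A hA =>
      congrFun h0 ⟨A, by simpa using hA⟩
    have h2 := hC r le_rfl α 0 le_rfl h1
    rw [mul_zero, flatBound_zero_iff] at h2
    exact funext fun A => h2 A (mem_closedBall_zero_iff.1 A.2)
  bounded := by
    -- The admissible constants for one `r` form a convex set, and a single constant serves all
    -- radii near a given one, so a partition of unity gives a choice continuous in `r`. Requiring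
    -- `1 ≤ C` keeps the right side infinite when the norm there is infinite.
    have key : ∀ n k : ℕ, ∃ C : C(ℝ, ℝ), ∀ r : ℝ, C r ∈ {C : ℝ | 1 ≤ C ∧ ∀ (α : flatForms m) (M : ℝ),
        0 ≤ M → FlatBound α.1 n (k + b * n + c) r M → FlatBound (ℓ α).1 n k r (C * M)} := by
      intro n k
      refine exists_continuous_forall_mem_convex_of_local_const (fun r => ?_) fun r => ?_
      · refine OrdConnected.convex ⟨fun x hx y hy z hz => ⟨hx.1.trans hz.1, fun α M hM hα => ?_⟩⟩
        refine fun A hA j hj => (hx.2 α M hM hα A hA j hj).trans ?_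
        gcongr
        exact hz.1
      · obtain ⟨C, hC0, hC⟩ := h (r + 1) n k
        refine ⟨C + 1, ?_⟩
        filter_upwards [Iio_mem_nhds (lt_add_one r)] with s hs
        refine ⟨by linarith, fun α M hM hα A hA j hj => (hC s hs.le α M hM hα A hA j hj).trans ?_⟩
        gcongr
        linarith
    choose C hC using key
    refine ⟨fun r n k => C n k r, fun n k => (C n k).continuous.continuousOn,
      fun r n k hr α hα => ?_⟩
    obtain ⟨h1, h2⟩ := hC n k r
    by_cases htop : flatNorm (n + 0) (k + b * n + c) r α = ⊤
    · rw [htop, ENNReal.mul_top (ENNReal.ofReal_pos.2 (zero_lt_one.trans_le h1)).ne']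
      exact le_top
    · have h3 := h2 α _ ENNReal.toReal_nonneg (flatBound_of_flatNorm htop)
      refine (flatNorm_le_of_flatBound h3).trans_eq ?_
      rw [ENNReal.ofReal_mul (zero_le_one.trans h1)]
      exact congrArg _ (ENNReal.ofReal_toReal htop)

end SLB

/-! ### Operators on flat forms given by integrals of kernels -/

section Kernel

variable {Ω : Type*} [MeasurableSpace Ω] {m m' : ℕ}

/-- A family of linear operators `G z` from flat forms to smooth forms, depending on a parameter `z`,
bounded so that its integral satisfies property SLB for `(0, b, c)`. -/
structure IsFlatKernel (ν : Measure Ω) (T : Set Ω) (G : Form m → Ω → Form m') (b c : ℕ) : Prop where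
  ae_mem : ∀ᵐ z ∂ν, z ∈ T
  smooth : ∀ α ∈ flatForms m, ∀ z ∈ T, ContDiff ℝ ∞ (G α z)
  meas : ∀ α ∈ flatForms m, ∀ (j : ℕ) (A : SL),
    AEStronglyMeasurable (fun z => iteratedFDeriv ℝ j (G α z) A) ν
  bound : ∀ (R : ℝ) (n k : ℕ), ∃ g : Ω → ℝ, Integrable g ν ∧ (∀ z, 0 ≤ g z) ∧
    ∀ r ≤ R, ∀ α ∈ flatForms m, ∀ M : ℝ, 0 ≤ M → FlatBound α n (k + b * n + c) r M →
      ∀ z ∈ T, FlatBound (G α z) n k r (g z * M)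
  map_add : ∀ α β z, G (α + β) z = G α z + G β z
  map_smul : ∀ (s : ℝ) α z, G (s • α) z = s • G α z

variable {ν : Measure Ω} {T : Set Ω} {G : Form m → Ω → Form m'} {b c : ℕ}

theorem IsFlatKernel.dominated (h : IsFlatKernel ν T G b c) (α : flatForms m) (j k : ℕ) (R : ℝ) :
    ∃ g : Ω → ℝ, Integrable g ν ∧
      ∀ z ∈ T, ∀ A, ‖A‖ ≤ R → ‖iteratedFDeriv ℝ j (G α.1 z) A‖ ≤ g z * ‖A‖ ^ k := by
  obtain ⟨g, hg, -, hb⟩ := h.bound R j k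
  obtain ⟨M, hM0, hM⟩ := exists_flatBound α j (k + b * j + c) R
  exact ⟨fun z => g z * M, hg.mul_const M,
    fun z hz A hA => hb R le_rfl α.1 α.2 M hM0 hM z hz A hA j le_rfl⟩

theorem IsFlatKernel.integrable (h : IsFlatKernel ν T G b c) (α : flatForms m) (j : ℕ) (A : SL) :
    Integrable (fun z => iteratedFDeriv ℝ j (G α.1 z) A) ν := by
  obtain ⟨g, hg, hb⟩ := h.dominated α j 0 ‖A‖
  refine hg.mono' (h.meas α.1 α.2 j A) ?_
  filter_upwards [h.ae_mem] with z hz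
  simpa using hb z hz A le_rfl

theorem IsFlatKernel.integrable_apply (h : IsFlatKernel ν T G b c) (α : flatForms m) (A : SL) :
    Integrable (fun z => G α.1 z A) ν :=
  (continuousMultilinearCurryFin0 ℝ SL (SL [⋀^Fin m']→L[ℝ]
    ℝ)).toContinuousLinearEquiv.toContinuousLinearMap.integrable_comp (h.integrable α 0 A)

theorem IsFlatKernel.hasFTaylorSeries (h : IsFlatKernel ν T G b c) (α : flatForms m) :
    HasFTaylorSeriesUpTo ((⊤ : ℕ∞) : ℕ∞ω) (fun A => ∫ z, G α.1 z A ∂ν)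
      fun A j => ∫ z, iteratedFDeriv ℝ j (G α.1 z) A ∂ν := by
  refine hasFTaylorSeriesUpTo_integral (h.ae_mem.mono fun z hz => h.smooth α.1 α.2 z hz)
    (h.meas α.1 α.2) fun j R => ?_
  obtain ⟨g, hg, hb⟩ := h.dominated α j 0 R
  refine ⟨g, hg, h.ae_mem.mono fun z hz A hA => ?_⟩
  simpa using hb z hz A hA

theorem IsFlatKernel.iteratedFDeriv_eq (h : IsFlatKernel ν T G b c) (α : flatForms m) (j : ℕ)
    (A : SL) : iteratedFDeriv ℝ j (fun A => ∫ z, G α.1 z A ∂ν) A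
      = ∫ z, iteratedFDeriv ℝ j (G α.1 z) A ∂ν :=
  ((h.hasFTaylorSeries α).eq_iteratedFDeriv (natCast_le_infty j) A).symm

theorem IsFlatKernel.flatBound_integral (h : IsFlatKernel ν T G b c) (R : ℝ) (n k : ℕ) :
    ∃ C, 0 ≤ C ∧ ∀ r ≤ R, ∀ (α : flatForms m) (M : ℝ), 0 ≤ M →
      FlatBound α.1 n (k + b * n + c) r M →
      FlatBound (fun A => ∫ z, G α.1 z A ∂ν) n k r (C * M) := by
  obtain ⟨g, hg, hg0, hb⟩ := h.bound R n k
  refine ⟨∫ z, g z ∂ν, integral_nonneg hg0, fun r hr α M hM hα A hA j hj => ?_⟩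
  rw [h.iteratedFDeriv_eq, mul_assoc, ← integral_mul_const]
  refine norm_integral_le_of_norm_le (hg.mul_const _) ?_
  filter_upwards [h.ae_mem] with z hz
  rw [← mul_assoc]
  exact hb r hr α.1 α.2 M hM hα z hz A hA j hj

theorem IsFlatKernel.integral_mem (h : IsFlatKernel ν T G b c) (α : flatForms m) :
    (fun A => ∫ z, G α.1 z A ∂ν) ∈ flatForms m' := by
  refine mem_flatForms_of_flatBound (h.hasFTaylorSeries α).contDiff fun n => ?_
  obtain ⟨C, -, hC⟩ := h.flatBound_integral 1 n 1
  obtain ⟨M, hM0, hM⟩ := exists_flatBound α n (1 + b * n + c) 1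
  exact ⟨_, hC 1 le_rfl α M hM0 hM⟩

/-- The operator `α ↦ ∫ G(α, z) dν(z)`. -/
def IsFlatKernel.op (h : IsFlatKernel ν T G b c) : flatForms m →ₗ[ℝ] flatForms m' where
  toFun α := ⟨fun A => ∫ z, G α.1 z A ∂ν, h.integral_mem α⟩
  map_add' α β := Subtype.ext <| funext fun A => by
    change ∫ z, G (α.1 + β.1) z A ∂ν = (∫ z, G α.1 z A ∂ν) + ∫ z, G β.1 z A ∂ν
    rw [← integral_add (h.integrable_apply α A) (h.integrable_apply β A)]
    simp only [h.map_add, Pi.add_apply]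
  map_smul' s α := Subtype.ext <| funext fun A => by
    change ∫ z, G (s • α.1) z A ∂ν = s • ∫ z, G α.1 z A ∂ν
    rw [← integral_smul]
    simp only [h.map_smul, Pi.smul_apply]

theorem IsFlatKernel.pointwiseSLB_op (h : IsFlatKernel ν T G b c) : PointwiseSLB h.op b c :=
  fun R n k => h.flatBound_integral R n k

end Kernel

/-! ### Decay along the flow -/

/-- The difference is `c s (ρ² - 4|f|²)/y`, which is nonnegative. Since the flow does not increase
the norm, its pullbacks on a ball involve the form on that ball only. -/
theorem rho_flow_le {t : ℝ} (ht : 0 ≤ t) (A : SL) : rho (flow t A) ≤ rho A := by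
  have hy := yF_pos ht A
  have h1 := rho_flow ht A
  have h2 : 0 ≤ cF t A * sF t A :=
    mul_nonneg (zero_le_one.trans (one_le_cF t A)) (sF_nonneg ht A)
  have h3 := esq_le A
  have h4 : yF t A = cF t A * cF t A + esq A * (sF t A * sF t A) + rho A * (cF t A * sF t A) := rfl
  refine le_of_mul_le_mul_right ?_ hy
  rw [h1, h4]
  nlinarith [mul_le_mul_of_nonneg_right h3 h2]

theorem norm_flow_le {t : ℝ} (ht : 0 ≤ t) (A : SL) : ‖flow t A‖ ≤ ‖A‖ := by
  refine (pow_le_pow_iff_left₀ (norm_nonneg _) (norm_nonneg _) two_ne_zero).1 ?_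
  rw [norm_sq_eq_rho, norm_sq_eq_rho]
  exact rho_flow_le ht A

/-- The inequality `y coth y ≤ 1 + y` without the division; the difference `cosh y - sinh y` is `exp
(-y) ≤ 1`, and `y ≤ sinh y`. -/
theorem mul_cosh_le {y : ℝ} (hy : 0 ≤ y) : y * Real.cosh y ≤ (1 + y) * Real.sinh y := by
  have h1 : Real.cosh y - Real.sinh y = Real.exp (-y) := Real.cosh_sub_sinh y
  have h2 : y ≤ Real.sinh y := Real.self_le_sinh_iff.2 hy
  have h3 : Real.exp (-y) ≤ 1 := Real.exp_le_one_iff.2 (by linarith)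
  nlinarith

theorem mul_cF_le {t : ℝ} (ht : 0 ≤ t) (A : SL) :
    t * cF t A ≤ (1 + t * ‖casimir A‖) * sF t A := by
  rcases (norm_nonneg (casimir A)).eq_or_lt with h | h
  · have e : esq A = 0 := by rw [esq_eq, ← h]; ring
    have e1 : cF t A = 1 := by rw [cF_eq, ← h]; simp
    have e2 : sF t A = t := by
      rw [sF, e, mul_zero, ser, tsum_eq_single 0 fun k hk => by simp [hk]]
      simp [sinhCoeff]
    rw [e1, e2, ← h]; simp
  · refine le_of_mul_le_mul_left ?_ h
    have h1 := mul_cosh_le (mul_nonneg ht h.le)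
    rw [← cF_eq, ← sF_eq] at h1
    linarith

/-- On the cone `ρ(φ_t A) = ρ/(1 + tρ)`, which decays like `1/t`. Off the cone `ρ` tends to `2|f|`
instead, and the factor `1 + t|f|` accounts for this. -/
theorem one_add_mul_rho_flow_le {t : ℝ} (ht : 0 ≤ t) (A : SL) :
    (1 + t) * rho (flow t A) ≤ 4 * (1 + rho A) * (1 + t * ‖casimir A‖) := by
  have hy := yF_pos ht A
  have h1 := rho_flow ht A
  have hc := one_le_cF t A
  have hs := sF_nonneg ht A
  have hcs := cF_sq t A
  have hT := mul_cF_le ht A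
  have hρ := rho_nonneg A
  have he := esq_le A
  have hx := norm_nonneg (casimir A)
  have hex := esq_eq A
  have hxS : ‖casimir A‖ * sF t A ≤ cF t A := norm_casimir_mul_sF_le A
  have hxρ := norm_casimir_le A
  have h4 : yF t A = cF t A * cF t A + esq A * (sF t A * sF t A) + rho A * (cF t A * sF t A) := rfl
  generalize cF t A = c at *
  generalize sF t A = S at *
  generalize ‖casimir A‖ = x at *
  generalize rho A = ρ at *
  generalize rho (flow t A) = q at *
  rw [hex] at h1 h4 hcs
  have hc0 : 0 < c := by linarith
  -- The numerator in `rho_flow` is at most `4ρc²`, while `y ≥ c (c + ρS)`; one factor `c` cancels.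
  have hq : q * (c + ρ * S) ≤ 4 * ρ * c := by
    have h5 : q * yF t A ≤ 4 * ρ * c * c := by
      rw [h1]
      have k1 : x ^ 2 * S ^ 2 ≤ c ^ 2 := by rw [← mul_pow]; exact pow_le_pow_left₀ (by positivity) hxS 2
      have k2 : c * S * x ^ 2 ≤ c * c * x := by nlinarith [mul_le_mul_of_nonneg_left hxS (mul_nonneg hc0.le hx)]
      nlinarith [mul_le_mul_of_nonneg_right hxρ (mul_nonneg hc0.le hc0.le), mul_le_mul_of_nonneg_right k1 hρ]
    have hq0 : 0 ≤ q := by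
      by_contra hneg
      push Not at hneg
      have : 0 ≤ q * yF t A := by rw [h1]; positivity
      nlinarith
    have h6 : q * (c * (c + ρ * S)) ≤ q * yF t A := by
      refine mul_le_mul_of_nonneg_left ?_ hq0
      rw [h4]; nlinarith [sq_nonneg (x * S)]
    refine le_of_mul_le_mul_left ?_ hc0
    nlinarith
  have hD : 0 < c + ρ * S := by positivity
  refine le_of_mul_le_mul_right ?_ hD
  have h7 : (1 + t) * q * (c + ρ * S) ≤ (1 + t) * (4 * ρ * c) := by
    rw [mul_assoc]; exact mul_le_mul_of_nonneg_left hq (by linarith)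
  refine h7.trans ?_
  have k3 : 0 ≤ t * x := mul_nonneg ht hx
  have k4 := mul_le_mul_of_nonneg_left hT hρ
  have k5 := mul_le_mul_of_nonneg_left hT (mul_nonneg hρ hρ)
  have k6 : 0 ≤ ρ * S * (t * x) := by positivity
  have k7 : 0 ≤ ρ * (c * (t * x)) := by positivity
  have k8 : 0 ≤ c * (t * x) := by positivity
  nlinarith [mul_nonneg hρ hs]

theorem exists_one_add_pow_le_cosh_sq (p : ℕ) :
    ∃ K : ℝ, 0 ≤ K ∧ ∀ y : ℝ, 0 ≤ y → (1 + y) ^ p ≤ K * Real.cosh y ^ 2 := by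
  refine ⟨p.factorial * (4 * Real.exp 1), by positivity, fun y hy => ?_⟩
  have h1 : (1 + y) ^ p ≤ p.factorial * Real.exp (1 + y) := by
    have := Real.pow_div_factorial_le_exp (1 + y) (by linarith) p
    rwa [div_le_iff₀ (by positivity), mul_comm] at this
  have h2 : Real.exp y / 2 ≤ Real.cosh y := by
    rw [Real.cosh_eq]
    have := Real.exp_pos (-y)
    linarith
  have h3 : Real.exp y ≤ 4 * Real.cosh y ^ 2 := by
    have h4 : 1 ≤ Real.exp y := Real.one_le_exp hy
    nlinarith [pow_le_pow_left₀ (by positivity) h2 2]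
  rw [Real.exp_add] at h1
  calc _ ≤ (p.factorial : ℝ) * (Real.exp 1 * (4 * Real.cosh y ^ 2)) := by
        refine h1.trans ?_
        gcongr
    _ = _ := by ring

/-- The powers of `(1 + t)²` to be beaten are `m` from the factors `Dφ_t`, `j` from derivatives and
one more for integrability, at most `n + 6` in all. So `(1 + t)^(2n+12)` is paired with
`|φ_t|^(2(2n+12))`, leaving `(1 + t|f|)^(2n+12)`, which `cosh²` dominates. Of the `5n + 35` powers
of `|φ_t|`, the remaining `n + 11` are merely bounded. -/
theorem exists_flow_decay (R : ℝ) (m n : ℕ) (hm : m ≤ 5) : ∃ K : ℝ, 0 ≤ K ∧ ∀ t : ℝ, 0 ≤ t →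
    ∀ A : SL, ‖A‖ ≤ R → ∀ j ≤ n, ‖flow t A‖ ^ (5 * n + 35) * ((cF t A ^ 2)⁻¹ *
      timeWeight t ^ m) * timeWeight t ^ j ≤ K * (1 + t ^ 2)⁻¹ := by
  obtain ⟨K, hK0, hK⟩ := exists_one_add_pow_le_cosh_sq (2 * n + 12)
  refine ⟨|R| ^ (n + 11) * (4 * (1 + R ^ 2)) ^ (2 * n + 12) * K, by positivity,
    fun t ht A hA j hj => ?_⟩
  have hc := one_le_cF t A
  have hc2 : 0 < cF t A ^ 2 := by positivity
  have h1 := one_add_mul_rho_flow_le ht A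
  have h2 := norm_flow_le ht A
  have hφ := norm_nonneg (flow t A)
  have hρ : rho A ≤ R ^ 2 := by
    rw [← norm_sq_eq_rho]; exact pow_le_pow_left₀ (norm_nonneg A) hA 2
  have hx : 0 ≤ t * ‖casimir A‖ := mul_nonneg ht (norm_nonneg _)
  rw [← norm_sq_eq_rho] at h1
  have hR : ‖flow t A‖ ≤ |R| := h2.trans (hA.trans (le_abs_self R))
  have h3 : ((1 + t) * ‖flow t A‖ ^ 2) ^ (2 * n + 12)
      ≤ (4 * (1 + R ^ 2)) ^ (2 * n + 12) * (K * cF t A ^ 2) := by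
    rw [cF_eq]
    calc _ ≤ (4 * (1 + R ^ 2) * (1 + t * ‖casimir A‖)) ^ (2 * n + 12) := by
          refine pow_le_pow_left₀ (by positivity) (h1.trans ?_) _
          gcongr
      _ = (4 * (1 + R ^ 2)) ^ (2 * n + 12) * (1 + t * ‖casimir A‖) ^ (2 * n + 12) := mul_pow _ _ _
      _ ≤ _ := by gcongr; exact hK _ hx
  have h4 : timeWeight t ^ m * timeWeight t ^ j * (1 + t ^ 2) ≤ (1 + t) ^ (2 * n + 12) := by
    have k1 : (1 : ℝ) + t ^ 2 ≤ timeWeight t := by unfold timeWeight; nlinarith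
    have k2 := one_le_timeWeight ht
    calc _ ≤ timeWeight t ^ m * timeWeight t ^ j * timeWeight t := by gcongr
      _ = timeWeight t ^ (m + j + 1) := by ring
      _ ≤ timeWeight t ^ (n + 6) := pow_le_pow_right₀ k2 (by omega)
      _ = _ := by rw [timeWeight, ← pow_mul]; congr 1
  rw [le_mul_inv_iff₀ (by positivity)]
  calc _ = (cF t A ^ 2)⁻¹ * (‖flow t A‖ ^ (5 * n + 35)
        * (timeWeight t ^ m * timeWeight t ^ j * (1 + t ^ 2))) := by ring
    _ ≤ (cF t A ^ 2)⁻¹ * (‖flow t A‖ ^ (5 * n + 35) * (1 + t) ^ (2 * n + 12)) := by gcongr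
    _ = (cF t A ^ 2)⁻¹ * (‖flow t A‖ ^ (n + 11)
        * ((1 + t) * ‖flow t A‖ ^ 2) ^ (2 * n + 12)) := by
      rw [mul_pow, ← pow_mul, show 5 * n + 35 = (n + 11) + 2 * (2 * n + 12) by ring, pow_add]
      ring
    _ ≤ (cF t A ^ 2)⁻¹ * (|R| ^ (n + 11)
        * ((4 * (1 + R ^ 2)) ^ (2 * n + 12) * (K * cF t A ^ 2))) := by gcongr
    _ = _ := by field_simp

/-! ### The kernel `i_W φ_s^*` -/

/-- The hypothesis `‖Φ(a)‖ ≤ ‖a‖` keeps the evaluation inside the ball where the form is controlled;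
the power of `‖Φ(a)‖`, not of `‖a‖`, is retained because it decays in time. -/
theorem JetBound.flat_comp {ι : Type*} {n N m : ℕ} {Φ : ι → SL → SL} {a : ι → SL} {b M : ι → ℝ}
    {α : ι → Form m} (hΦ : JetBound n Φ a (fun _ => 1) b) (hα : ∀ i, ContDiff ℝ ∞ (α i))
    (hM : ∀ i, 0 ≤ M i) (hle : ∀ i, ‖Φ i (a i)‖ ≤ ‖a i‖)
    (hb : ∀ i, FlatBound (α i) n N ‖a i‖ (M i)) :
    JetBound n (fun i x => α i (Φ i x)) a (fun i => M i * ‖Φ i (a i)‖ ^ N) b := by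
  obtain ⟨hs, -, hb1, C, hC0, hC⟩ := hΦ
  refine JetBound.comp (u := Φ) (g := α) (t := univ) uniqueDiffOn_univ hb1
    (fun i => mul_nonneg (hM i) (by positivity)) hs (fun _ _ => mem_univ _)
    ⟨C, fun i j _ hjn => by simpa using hC i j hjn⟩ (fun i => (hα i).contDiffOn)
    ⟨1, zero_le_one, fun i j hj => ?_⟩
  rw [iteratedFDerivWithin_univ, one_mul]
  exact hb i _ (hle i) j hj

theorem form_eq_zero {m : ℕ} (hm : 6 < m) (α : Form m) : α = 0 := by
  funext A
  ext v
  refine (α A).toAlternatingMap.map_linearDependent v fun h => ?_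
  have := h.fintype_card_le_finrank
  rw [Fintype.card_fin] at this
  have := finrank_SL_le
  omega

theorem pullback_zero {m : ℕ} (F : SL → SL) : pullback F (0 : Form m) = 0 := by
  have := pullback_smul F 0 (0 : Form m)
  simpa using this

theorem interiorProduct_zero {m : ℕ} (V : SL → SL) : interiorProduct V (0 : Form (m + 1)) = 0 := by
  have := interiorProduct_smul V 0 (0 : Form (m + 1))
  simpa using this

theorem contDiff_fderiv_flow_uncurry {q : ℝ × SL} (hq : 0 < q.1) :
    ContDiffAt ℝ ∞ (fun q : ℝ × SL => fderiv ℝ (flow q.1) q.2) q := by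
  refine ContDiffAt.fderiv (n := ∞) (f := fun q : ℝ × SL => flow q.1) (g := Prod.snd) ?_
    contDiffAt_snd (mod_cast le_rfl)
  exact ContDiffAt.comp (g := fun q : ℝ × SL => flow q.1 q.2)
    (f := fun p : (ℝ × SL) × SL => (p.1.1, p.2)) (q, q.2) (contDiffAt_flow hq.le)
    ((contDiffAt_fst.fst).prodMk contDiffAt_snd)

theorem contDiff_compCLM_uncurry (n : ℕ) : ContDiff ℝ ∞
    fun p : (SL [⋀^Fin n]→L[ℝ] ℝ) × (SL →L[ℝ] SL) => p.1.compContinuousLinearMap p.2 :=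
  ContDiff.compCLM contDiff_fst contDiff_snd

theorem contDiff_curryLeft_uncurry (n : ℕ) : ContDiff ℝ ∞
    fun p : (SL [⋀^Fin (n + 1)]→L[ℝ] ℝ) × SL => p.1.curryLeft p.2 :=
  ((ContinuousAlternatingMap.curryLeftLI (𝕜 := ℝ) (E := SL) (F := ℝ)
      (n := n)).contDiff.comp contDiff_fst).clm_apply contDiff_snd

theorem contDiffAt_pullback_flow {n : ℕ} {α : Form n} (hα : ContDiff ℝ ∞ α) {q : ℝ × SL}
    (hq : 0 < q.1) : ContDiffAt ℝ ∞ (fun q : ℝ × SL => pullback (flow q.1) α q.2) q :=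
  (contDiff_compCLM_uncurry n).contDiffAt.comp q
    ((hα.contDiffAt.comp q (contDiffAt_flow hq.le)).prodMk (contDiff_fderiv_flow_uncurry hq))

theorem contDiff_pullback {n : ℕ} {α : Form n} {F : SL → SL} (hα : ContDiff ℝ ∞ α)
    (hF : ContDiff ℝ ∞ F) : ContDiff ℝ ∞ (pullback F α) :=
  ContDiff.compCLM (hα.comp hF) (hF.fderiv_right (mod_cast le_rfl))

theorem contDiff_interiorProduct {n : ℕ} {α : Form (n + 1)} {V : SL → SL} (hα : ContDiff ℝ ∞ α)
    (hV : ContDiff ℝ ∞ V) : ContDiff ℝ ∞ (interiorProduct V α) :=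
  (contDiff_curryLeft_uncurry n).comp (hα.prodMk hV)

/-- The integrand `i_W φ_s^* α` of the homotopy operator. -/
def flowKernel {n : ℕ} (α : Form (n + 1)) (s : ℝ) : Form n := interiorProduct W (pullback (flow s) α)

theorem contDiffAt_flowKernel {n : ℕ} {α : Form (n + 1)} (hα : ContDiff ℝ ∞ α) {q : ℝ × SL}
    (hq : 0 < q.1) : ContDiffAt ℝ ∞ (fun q : ℝ × SL => flowKernel α q.1 q.2) q :=
  ContDiffAt.comp (g := fun p : (SL [⋀^Fin (n + 1)]→L[ℝ] ℝ) × SL => p.1.curryLeft p.2)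
    (f := fun q : ℝ × SL => (pullback (flow q.1) α q.2, W q.2)) q
    (contDiff_curryLeft_uncurry n).contDiffAt
    ((contDiffAt_pullback_flow hα hq).prodMk (contDiff_W.contDiffAt.comp q contDiffAt_snd))

theorem contDiff_flowKernel {n : ℕ} {α : Form (n + 1)} (hα : ContDiff ℝ ∞ α) {s : ℝ} (hs : 0 ≤ s) :
    ContDiff ℝ ∞ (flowKernel α s) :=
  contDiff_interiorProduct (contDiff_pullback hα (contDiff_flow hs)) contDiff_W

theorem continuousOn_iteratedFDeriv_flowKernel {n : ℕ} {α : Form (n + 1)} (hα : ContDiff ℝ ∞ α)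
    (j : ℕ) (A : SL) : ContinuousOn (fun s => iteratedFDeriv ℝ j (flowKernel α s) A) (Ioi 0) := by
  intro s hs
  have h := contDiffAt_iteratedFDeriv_right (S := Ioi (0 : ℝ)) (u := flowKernel α)
    (fun p hp => contDiffAt_flowKernel hα hp) j (s, A) hs
  exact (ContinuousAt.comp (g := fun p : ℝ × SL => iteratedFDeriv ℝ j (flowKernel α p.1) p.2)
    (f := fun s => (s, A)) h.continuousAt
    (continuousAt_id.prodMk continuousAt_const)).continuousWithinAt

theorem exists_flowKernel_bound (m : ℕ) (R : ℝ) (n k : ℕ) : ∃ K : ℝ, 0 ≤ K ∧ ∀ r ≤ R,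
    ∀ α : Form (m + 1), ContDiff ℝ ∞ α → ∀ M : ℝ, 0 ≤ M → FlatBound α n (k + 5 * n + 35) r M →
      ∀ s, 0 ≤ s → FlatBound (flowKernel α s) n k r (K * (1 + s ^ 2)⁻¹ * M) := by
  -- Forms of degree `m + 1 > 6` vanish, so only `m ≤ 5` is left.
  rcases lt_or_ge 5 m with hm | hm
  · refine ⟨0, le_rfl, fun r _ α _ M _ _ s _ A _ j _ => ?_⟩
    have e : flowKernel α s = 0 := by
      rw [flowKernel, form_eq_zero (by omega) α, pullback_zero, interiorProduct_zero]
    have e0 : iteratedFDeriv ℝ j (0 : Form m) = 0 := iteratedFDeriv_fun_zero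
    rw [e, e0]
    simp
  -- All times, points, forms and bounds form one index set, so that a single `JetBound` constant is
  -- uniform over them.
  let ι := {p : (ℝ × SL) × (Form (m + 1) × ℝ) // 0 ≤ p.1.1 ∧ ‖p.1.2‖ ≤ R ∧ ContDiff ℝ ∞ p.2.1 ∧
    0 ≤ p.2.2 ∧ FlatBound p.2.1 n (k + 5 * n + 35) ‖p.1.2‖ p.2.2}
  let t : ι → ℝ := fun i => i.1.1.1
  let a : ι → SL := fun i => i.1.1.2
  let al : ι → Form (m + 1) := fun i => i.1.2.1
  let M : ι → ℝ := fun i => i.1.2.2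
  have ht : ∀ i, 0 ≤ t i := fun i => i.2.1
  have ha : ∀ i, ‖a i‖ ≤ R := fun i => i.2.2.1
  have h1 := JetBound.flat_comp (jet_flow n ht ha) (α := al) (M := M) (fun i => i.2.2.2.1)
    (fun i => i.2.2.2.2.1) (fun i => norm_flow_le (ht i) _) fun i => i.2.2.2.2.2
  -- The contracted slot is `Dφ_s(W) = W ∘ φ_s` with weight `c⁻²`; each of the other `m` slots costs
  -- one `timeWeight`.
  have h2 := JetBound.jet_interiorProduct (V := fun _ => W) h1 (jet_flowW n ht ha)
    (fun _ => contDiff_W) (fun i A => fderiv_flow_W (ht i) A) (jet_flow (n + 1) ht ha).jet_fderiv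
  obtain ⟨-, -, -, C, hC0, hC⟩ := h2
  obtain ⟨K, hK0, hK⟩ := exists_flow_decay R m n hm
  refine ⟨C * K, by positivity, fun r hr α hα M' hM' hb s hs A hA j hj => ?_⟩
  have h3 := hC ⟨((s, A), (α, M')), hs, hA.trans hr, hα, hM', fun B hB => hb B (hB.trans hA)⟩ j hj
  have h4 := hK s hs A (hA.trans hr) j hj
  have h5 := norm_flow_le hs A
  refine h3.trans ?_
  simp only [t, a, M, one_mul]
  have hw : 0 ≤ ‖flow s A‖ ^ (5 * n + 35) * ((cF s A ^ 2)⁻¹ * timeWeight s ^ m)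
      * timeWeight s ^ j := by
    have := one_le_timeWeight hs
    positivity
  calc _ = C * M' * ‖flow s A‖ ^ k * (‖flow s A‖ ^ (5 * n + 35)
        * ((cF s A ^ 2)⁻¹ * timeWeight s ^ m) * timeWeight s ^ j) := by ring
    _ ≤ C * M' * ‖A‖ ^ k * (K * (1 + s ^ 2)⁻¹) := by gcongr
    _ = _ := by ring

/-- The kernel of the homotopy operator, on an interval of positive times. -/
theorem isFlatKernel_flowKernel (m : ℕ) {S : Set ℝ} (hS : MeasurableSet S) (hS0 : S ⊆ Ioi 0) :
    IsFlatKernel (volume.restrict S) (Ioi 0) (flowKernel (n := m)) 5 35 where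
  ae_mem := (ae_restrict_mem hS).mono fun _ h => hS0 h
  smooth α hα _ hs := contDiff_flowKernel hα.1 (le_of_lt hs)
  meas α hα j A := ((continuousOn_iteratedFDeriv_flowKernel hα.1 j A).mono
    hS0).aestronglyMeasurable hS
  bound R n k := by
    obtain ⟨K, hK0, hK⟩ := exists_flowKernel_bound m R n k
    exact ⟨fun s => K * (1 + s ^ 2)⁻¹, (integrable_inv_one_add_sq.const_mul K).restrict,
      fun s => by positivity, fun r hr α hα M hM hb s hs => hK r hr α hα.1 M hM hb s (le_of_lt hs)⟩
  map_add α β s := by rw [flowKernel, pullback_add, interiorProduct_add]; rfl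
  map_smul c α s := by rw [flowKernel, pullback_smul, interiorProduct_smul]; rfl

/-! ### The derivative of a family of pullbacks -/

section Cartan

variable {E : Type*} [NormedAddCommGroup E] [NormedSpace ℝ E]

theorem removeNth_succ_cons {X : Type*} {n : ℕ} (i : Fin (n + 1)) (x : X) (v : Fin (n + 1) → X) :
    i.succ.removeNth (Fin.cons x v : Fin (n + 2) → X)
      = (Fin.cons x (i.removeNth v) : Fin (n + 1) → X) := by
  funext k
  refine Fin.cases ?_ (fun k => ?_) k
  · simp [Fin.removeNth]
  · simp [Fin.removeNth, Fin.succ_succAbove_succ]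

/-- Cartan's formula for a constant vector field. -/
theorem fderiv_apply_eq_extDeriv_add {n : ℕ} {β : E → E [⋀^Fin (n + 1)]→L[ℝ] ℝ} {x : E}
    (hβ : DifferentiableAt ℝ β x) (T : E) :
    fderiv ℝ β x T = extDeriv (fun y => (β y).curryLeft T) x + (extDeriv β x).curryLeft T := by
  have hγ : DifferentiableAt ℝ (fun y => (β y).curryLeft T) x := by
    let L := (ContinuousLinearMap.apply ℝ (E [⋀^Fin n]→L[ℝ] ℝ) T).comp
      (ContinuousAlternatingMap.curryLeftLI (𝕜 := ℝ) (E := E) (F := ℝ) (n := n)).toContinuousLinearMap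
    exact L.differentiableAt.comp x hβ
  ext v
  change _ = extDeriv (fun y => (β y).curryLeft T) x v + extDeriv β x (Fin.cons T v)
  -- In `dβ(T, v)` the term of index zero is the derivative along `T`; the others are the negatives
  -- of those in `d(i_T β)(v)`.
  rw [extDeriv_apply hβ (Fin.cons T v), extDeriv_apply hγ, Fin.sum_univ_succ (n := n + 1)]
  have e0 : fderiv ℝ (fun y => β y v) x T = fderiv ℝ β x T v := by
    have := (ContinuousAlternatingMap.apply ℝ E ℝ v).hasFDerivAt.comp x hβ.hasFDerivAt
    exact congrArg (fun L => L T) this.fderiv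
  have e1 : ∀ i : Fin (n + 1), (-1 : ℤ) ^ (i.succ : ℕ) • fderiv ℝ (fun y => β y
      (i.succ.removeNth (Fin.cons T v : Fin (n + 2) → E))) x (Fin.cons (α := fun _ => E) T v i.succ)
      = -((-1 : ℤ) ^ (i : ℕ) • fderiv ℝ (fun y => (β y).curryLeft T (i.removeNth v)) x (v i)) :=
    fun i => by
      rw [removeNth_succ_cons, Fin.cons_succ, Fin.val_succ, pow_succ, mul_neg_one, neg_smul]
      rfl
  simp only [e1, Finset.sum_neg_distrib, Fin.val_zero, pow_zero, one_smul, Fin.cons_zero,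
    Fin.removeNth_zero]
  change _ = _ + (fderiv ℝ (fun y => β y v) x T + _)
  rw [e0]
  ring

end Cartan

section Families

variable {S : Set ℝ} {Φ : ℝ → SL → SL} {V : SL → SL} {s : ℝ} {n : ℕ}

theorem fderiv_slice (hΦ : ∀ q : ℝ × SL, q.1 ∈ S → ContDiffAt ℝ ∞ (fun q : ℝ × SL => Φ q.1 q.2) q)
    (hs : s ∈ S) (B : SL) : fderiv ℝ (Φ s) B =
      (fderiv ℝ (fun q : ℝ × SL => Φ q.1 q.2) (s, B)).comp (ContinuousLinearMap.inr ℝ ℝ SL) := by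
  have h1 := ((hΦ (s, B) hs).differentiableAt (by simp)).hasFDerivAt
  exact (HasFDerivAt.comp (f := fun B => (s, B)) B h1 (hasFDerivAt_prodMk_right s B)).fderiv

/-- The derivative of a family of pullbacks of a form of positive degree. -/
theorem hasDerivAt_pullback_succ (hS : IsOpen S)
    (hΦ : ∀ q : ℝ × SL, q.1 ∈ S → ContDiffAt ℝ ∞ (fun q : ℝ × SL => Φ q.1 q.2) q) (hs : s ∈ S)
    (hV : ∀ B, HasDerivAt (fun t => Φ t B) (fderiv ℝ (Φ s) B (V B)) s) {α : Form (n + 1)}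
    (hα : ContDiff ℝ ∞ α) (A : SL) :
    HasDerivAt (fun t => pullback (Φ t) α A)
      (extDeriv (interiorProduct V (pullback (Φ s) α)) A
        + interiorProduct V (pullback (Φ s) (extDeriv α)) A) s := by
  -- The family is one map `Ψ` on `ℝ × SL`. The time derivative of its slices is the derivative of
  -- `β = Ψ^* α` along the constant field `T = ∂_t`, to which Cartan's formula for constant fields
  -- applies; the result is then restricted to the slice by `J`.
  set Ψ : ℝ × SL → SL := fun q => Φ q.1 q.2 with hΨ
  set J := ContinuousLinearMap.inr ℝ ℝ SL with hJ
  set T : ℝ × SL := (1, 0) with hT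
  have hslice : ∀ t ∈ S, ∀ B, fderiv ℝ (Φ t) B = (fderiv ℝ Ψ (t, B)).comp J :=
    fun t ht B => fderiv_slice hΦ ht B
  -- `DΨ(T) = DΦ_s(V)`, so contracting `Ψ^* α` with `T` restricts on the slice to contracting `Φ_s^*
  -- α` with `V`.
  have hVT : ∀ B, fderiv ℝ (Φ s) B (V B) = fderiv ℝ Ψ (s, B) T := fun B => by
    have h1 := ((hΦ (s, B) hs).differentiableAt (by simp)).hasFDerivAt
    have h2 : HasDerivAt (fun t : ℝ => (t, B)) T s := (hasDerivAt_id s).prodMk (hasDerivAt_const s B)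
    exact (hV B).unique (HasFDerivAt.comp_hasDerivAt (f := fun t : ℝ => (t, B)) s h1 h2)
  set β : ℝ × SL → (ℝ × SL) [⋀^Fin (n + 1)]→L[ℝ] ℝ := fun q =>
    (α (Ψ q)).compContinuousLinearMap (fderiv ℝ Ψ q) with hβdef
  have hβ : ∀ q : ℝ × SL, q.1 ∈ S → DifferentiableAt ℝ β q := fun q hq => by
    have h1 : DifferentiableAt ℝ (fun q => α (Ψ q)) q :=
      (hα.differentiable (by simp) _).comp q ((hΦ q hq).differentiableAt (by simp))
    have h2 : DifferentiableAt ℝ (fderiv ℝ Ψ) q :=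
      ((hΦ q hq).fderiv_right (m := 1) (natCast_le_infty 2)).differentiableAt one_ne_zero
    exact (h1.hasFDerivAt.continuousAlternatingMapCompContinuousLinearMap
      h2.hasFDerivAt).differentiableAt
  have hmin := minSmoothness_two_le
  have e1 : ∀ t ∈ S, pullback (Φ t) α A = (β (t, A)).compContinuousLinearMap J := fun t ht => by
    rw [pullback, hslice t ht]; rfl
  have h3 : HasDerivAt (fun t => β (t, A)) (fderiv ℝ β (s, A) T) s := by
    have h2 : HasDerivAt (fun t : ℝ => (t, A)) T s := (hasDerivAt_id s).prodMk (hasDerivAt_const s A)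
    exact HasFDerivAt.comp_hasDerivAt (f := fun t : ℝ => (t, A)) s (hβ (s, A) hs).hasFDerivAt h2
  let CJ : ((ℝ × SL) [⋀^Fin (n + 1)]→L[ℝ] ℝ) →L[ℝ] (SL [⋀^Fin (n + 1)]→L[ℝ] ℝ) :=
    ContinuousAlternatingMap.compContinuousLinearMapCLM J
  have h4 : HasDerivAt (fun t => CJ (β (t, A))) (CJ (fderiv ℝ β (s, A) T)) s :=
    HasFDerivAt.comp_hasDerivAt (l := CJ) s CJ.hasFDerivAt h3
  have h5 : HasDerivAt (fun t => pullback (Φ t) α A)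
      ((fderiv ℝ β (s, A) T).compContinuousLinearMap J) s := by
    refine h4.congr_of_eventuallyEq ?_
    filter_upwards [hS.mem_nhds hs] with t ht using e1 t ht
  refine h5.congr_deriv ?_
  rw [fderiv_apply_eq_extDeriv_add (hβ (s, A) hs) T]
  have e2 : ((extDeriv β (s, A)).curryLeft T).compContinuousLinearMap J
      = interiorProduct V (pullback (Φ s) (extDeriv α)) A := by
    have e3 : extDeriv β (s, A)
        = (extDeriv α (Ψ (s, A))).compContinuousLinearMap (fderiv ℝ Ψ (s, A)) :=
      extDeriv_pullback (hα.differentiable (by simp) _) (hΦ (s, A) hs) hmin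
    rw [e3]
    ext v
    rw [interiorProduct_apply, pullback_apply]
    change extDeriv α (Φ s A) _ = _
    congr 1
    funext i
    refine Fin.cases ?_ (fun i => ?_) i
    · exact (hVT A).symm
    · simp only [Fin.cons_succ, hslice s hs]
      rfl
  have e4 : (extDeriv (fun y => (β y).curryLeft T) (s, A)).compContinuousLinearMap J
      = extDeriv (interiorProduct V (pullback (Φ s) α)) A := by
    have hf : ∀ B, HasFDerivAt (fun B : SL => (s, B)) J B := fun B => hasFDerivAt_prodMk_right s B
    have hγ : DifferentiableAt ℝ (fun y => (β y).curryLeft T) (s, A) := by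
      let L := (ContinuousLinearMap.apply ℝ ((ℝ × SL) [⋀^Fin n]→L[ℝ] ℝ) T).comp
        (ContinuousAlternatingMap.curryLeftLI (𝕜 := ℝ) (E := ℝ × SL) (F := ℝ)
          (n := n)).toContinuousLinearMap
      exact L.differentiableAt.comp _ (hβ (s, A) hs)
    have h6 := extDeriv_pullback (f := fun B : SL => (s, B)) (x := A) hγ
      (contDiffAt_const.prodMk contDiffAt_id) hmin
    rw [(hf A).fderiv] at h6
    rw [← h6]
    congr 1
    funext B
    rw [(hf B).fderiv]
    ext v
    rw [interiorProduct_apply, pullback_apply]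
    change α (Φ s B) _ = _
    congr 1
    funext i
    refine Fin.cases ?_ (fun i => ?_) i
    · exact (hVT B).symm
    · simp only [Fin.cons_succ, hslice s hs]
      rfl
  rw [← e2, ← e4]
  rfl

theorem pullback_zero_form (F : SL → SL) (α : Form 0) (A : SL) : pullback F α A = α (F A) := by
  ext v
  rw [pullback_apply]
  congr 1
  exact Subsingleton.elim _ _

/-- The derivative of a family of pullbacks of a function. -/
theorem hasDerivAt_pullback_zero
    (hV : ∀ B, HasDerivAt (fun t => Φ t B) (fderiv ℝ (Φ s) B (V B)) s) {α : Form 0}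
    (hα : ContDiff ℝ ∞ α) (A : SL) :
    HasDerivAt (fun t => pullback (Φ t) α A)
      (interiorProduct V (pullback (Φ s) (extDeriv α)) A) s := by
  simp only [pullback_zero_form]
  have h1 := (hα.differentiable (by simp) (Φ s A))
  refine (HasFDerivAt.comp_hasDerivAt s h1.hasFDerivAt (hV A)).congr_deriv ?_
  ext v
  rw [interiorProduct_apply, pullback_apply, extDeriv, ContinuousAlternatingMap.alternatizeUncurryFin_apply,
    Fin.sum_univ_one, Fin.val_zero, pow_zero, one_smul]
  simp only [Fin.cons_zero]
  congr 1
  exact Subsingleton.elim _ _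

end Families

/-! ### Integral operators, the exterior derivative and the exterior product with `φ` -/

section KernelCalculus

variable {Ω : Type*} [MeasurableSpace Ω] {m m' : ℕ} {ν : Measure Ω} {T : Set Ω}
  {G : Form m → Ω → Form m'} {b c : ℕ}

/-- The exterior derivative as a linear function of the first derivative. -/
def extDerivL (n : ℕ) :
    ContinuousMultilinearMap ℝ (fun _ : Fin 1 => SL) (SL [⋀^Fin n]→L[ℝ] ℝ) →L[ℝ]
      SL [⋀^Fin (n + 1)]→L[ℝ] ℝ :=
  (ContinuousAlternatingMap.alternatizeUncurryFinCLM ℝ SL ℝ).comp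
    (continuousMultilinearCurryFin1 ℝ SL
      (SL [⋀^Fin n]→L[ℝ] ℝ)).toContinuousLinearEquiv.toContinuousLinearMap

theorem extDeriv_eq_extDerivL {n : ℕ} (α : Form n) (A : SL) :
    extDeriv α A = extDerivL n (iteratedFDeriv ℝ 1 α A) := by
  have h : fderiv ℝ α A = continuousMultilinearCurryFin1 ℝ SL (SL [⋀^Fin n]→L[ℝ] ℝ)
      (iteratedFDeriv ℝ 1 α A) := by
    ext1 v
    rw [continuousMultilinearCurryFin1_apply, iteratedFDeriv_one_apply]
    rfl
  rw [extDeriv, h]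
  rfl

theorem IsFlatKernel.integrable_extDeriv (h : IsFlatKernel ν T G b c) (α : flatForms m) (A : SL) :
    Integrable (fun z => extDeriv (G α.1 z) A) ν := by
  simp only [extDeriv_eq_extDerivL]
  exact (extDerivL m').integrable_comp (h.integrable α 1 A)

theorem IsFlatKernel.extDeriv_op (h : IsFlatKernel ν T G b c) (α : flatForms m) (A : SL) :
    extDeriv (h.op α).1 A = ∫ z, extDeriv (G α.1 z) A ∂ν := by
  simp only [extDeriv_eq_extDerivL]
  rw [(extDerivL m').integral_comp_comm (h.integrable α 1 A), ← h.iteratedFDeriv_eq α 1 A]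
  rfl

/-- The exterior product with `φ` at a point. -/
def ePhiL (n : ℕ) (A : SL) : SL [⋀^Fin n]→L[ℝ] ℝ →L[ℝ] SL [⋀^Fin (n + 2)]→L[ℝ] ℝ :=
  wedgeL (n + 1) (fderiv ℝ casimirRe A) ∘L wedgeL n (fderiv ℝ casimirIm A)

theorem ePhi_eq_ePhiL {n : ℕ} (β : Form n) (A : SL) : ePhi n β A = ePhiL n A (β A) := rfl

end KernelCalculus

/-! ### The foliated complex, and retractions from homotopy formulas -/

theorem ePhi_mem {n : ℕ} {β : Form n} (hβ : β ∈ flatForms n) : ePhi n β ∈ flatForms (n + 2) := by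
  have key : ∀ {n : ℕ} {β : Form n} {θ : SL → SL →L[ℝ] ℝ}, ContDiff ℝ ∞ θ → β ∈ flatForms n →
      wedge θ β ∈ flatForms (n + 1) := by
    intro n β θ hθ hβ
    refine ⟨contDiff_wedge hθ hβ.1, fun k => ?_⟩
    let B : (SL →L[ℝ] ℝ) →L[ℝ] SL [⋀^Fin n]→L[ℝ] ℝ →L[ℝ] SL [⋀^Fin (n + 1)]→L[ℝ] ℝ :=
      (ContinuousLinearMap.compL ℝ (SL [⋀^Fin n]→L[ℝ] ℝ) (SL →L[ℝ] SL [⋀^Fin n]→L[ℝ] ℝ)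
        (SL [⋀^Fin (n + 1)]→L[ℝ] ℝ) (ContinuousAlternatingMap.alternatizeUncurryFinCLM ℝ SL ℝ)).comp
        (ContinuousLinearMap.smulRightL ℝ SL (SL [⋀^Fin n]→L[ℝ] ℝ))
    have h := B.norm_iteratedFDeriv_le_of_bilinear hθ hβ.1 0 (natCast_le_infty k)
    rw [Finset.sum_eq_zero fun i _ => by rw [hβ.2, norm_zero, mul_zero], mul_zero] at h
    exact norm_le_zero_iff.1 h
  exact key (contDiff_casimirRe.fderiv_right (mod_cast le_rfl))
    (key (contDiff_casimirIm.fderiv_right (mod_cast le_rfl)) hβ)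

/-- The exterior product with `φ` on flat forms. -/
def ePhiFlat (n : ℕ) (β : flatForms n) : flatForms (n + 2) := ⟨ePhi n β.1, ePhi_mem β.2⟩

theorem mem_foliated_iff {n : ℕ} {α : flatForms (n + 2)} :
    α ∈ foliated (n + 2) ↔ ∃ β : flatForms n, ePhiFlat n β = α := by
  constructor
  · rintro ⟨β, hβ, h⟩
    exact ⟨⟨β, hβ⟩, Subtype.ext h⟩
  · rintro ⟨β, rfl⟩
    exact ⟨β.1, β.2, rfl⟩

theorem d_ePhiFlat {n : ℕ} (β : flatForms n) :
    d (n + 2) (ePhiFlat n β) = ePhiFlat (n + 1) (d n β) :=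
  Subtype.ext (extDeriv_ePhi β.2.1)

theorem d_mem_foliated (n : ℕ) (α : flatForms n) (hα : α ∈ foliated n) :
    d n α ∈ foliated (n + 1) := by
  match n with
  | 0 =>
    rw [(Submodule.mem_bot ℝ).1 hα, map_zero]; exact Submodule.zero_mem _
  | 1 =>
    rw [(Submodule.mem_bot ℝ).1 hα, map_zero]; exact Submodule.zero_mem _
  | n + 2 =>
    obtain ⟨β, rfl⟩ := mem_foliated_iff.1 hα
    rw [d_ePhiFlat]
    exact mem_foliated_iff.2 ⟨_, rfl⟩

theorem d_d (n : ℕ) (α : flatForms n) : d (n + 1) (d n α) = 0 :=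
  Subtype.ext (extDeriv_extDeriv α.2.1 minSmoothness_two_le)

/-- Operators of degree `-1` commuting with the exterior product with `φ` preserve the foliated
complex. -/
theorem mem_foliated_of_commute {h : ∀ n, flatForms (n + 1) →ₗ[ℝ] flatForms n}
    (h0 : ∀ β, h 1 (ePhiFlat 0 β) = 0)
    (hs : ∀ n β, h (n + 2) (ePhiFlat (n + 1) β) = ePhiFlat n (h n β)) (n : ℕ)
    (α : flatForms (n + 1)) (hα : α ∈ foliated (n + 1)) : h n α ∈ foliated n := by
  match n with
  | 0 =>
    rw [(Submodule.mem_bot ℝ).1 hα, map_zero]; exact Submodule.zero_mem _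
  | 1 =>
    obtain ⟨β, rfl⟩ := mem_foliated_iff.1 hα
    rw [h0]; exact Submodule.zero_mem _
  | n + 2 =>
    obtain ⟨β, rfl⟩ := mem_foliated_iff.1 hα
    rw [hs]
    exact mem_foliated_iff.2 ⟨_, rfl⟩

/-- A homotopy formula and idempotence give a deformation retraction. -/
theorem isDeformationRetraction_of_homotopy {S : ∀ n, Submodule ℝ (flatForms n)}
    {p : ∀ n, flatForms n →ₗ[ℝ] flatForms n} {h : ∀ n, flatForms (n + 1) →ₗ[ℝ] flatForms n}
    (hd : ∀ n, ∀ α ∈ S n, d n α ∈ S (n + 1)) (hh : ∀ n, ∀ α ∈ S (n + 1), h n α ∈ S n)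
    (hom0 : ∀ α ∈ S 0, p 0 α = α + h 0 (d 0 α))
    (homs : ∀ n, ∀ α ∈ S (n + 1), p (n + 1) α = α + (d n (h n α) + h (n + 1) (d (n + 1) α)))
    (idem : ∀ n, ∀ α ∈ S n, p n (p n α) = p n α) : IsDeformationRetraction S p h where
  d_mem := hd
  h_mem := hh
  p_mem n α hα := by
    match n with
    | 0 => rw [hom0 α hα]; exact Submodule.add_mem _ hα (hh _ _ (hd _ _ hα))
    | n + 1 =>
      rw [homs n α hα]
      exact Submodule.add_mem _ hα
        (Submodule.add_mem _ (hd _ _ (hh _ _ hα)) (hh _ _ (hd _ _ hα)))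
  -- Both sides equal `dα + d h dα`, because `d ∘ d = 0`.
  cochain n α hα := by
    match n with
    | 0 => rw [hom0 α hα, homs 0 _ (hd _ _ hα), d_d, map_zero, map_add, add_zero]
    | n + 1 =>
      rw [homs n α hα, homs (n + 1) _ (hd _ _ hα), d_d, map_zero, map_add, map_add, d_d, add_zero,
        zero_add]
  idem := idem
  homotopy_zero α hα := by rw [hom0 α hα, add_sub_cancel_left]
  homotopy_succ n α hα := by rw [homs n α hα, add_sub_cancel_left]

/-! ### The homotopy operator of the flow -/

/-- The limit of the homotopies `∫₀ᵗ i_W φ_s^* α ds`. -/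
def hSkeleton (n : ℕ) : flatForms (n + 1) →ₗ[ℝ] flatForms n :=
  (isFlatKernel_flowKernel n measurableSet_Ioi Subset.rfl).op

theorem hSkeleton_apply {n : ℕ} (α : flatForms (n + 1)) (A : SL) :
    (hSkeleton n α).1 A = ∫ s in Ioi (0 : ℝ), flowKernel α.1 s A := rfl

theorem homotopyAt_eq {n : ℕ} {t : ℝ} (ht : 0 ≤ t) (α : Form (n + 1)) :
    homotopyAt flow t α = fun A => ∫ s in Ioc (0 : ℝ) t, flowKernel α s A := by
  funext A
  exact intervalIntegral.integral_of_le ht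

theorem homotopyAt_mem {n : ℕ} {t : ℝ} (ht : 0 ≤ t) (α : flatForms (n + 1)) :
    homotopyAt flow t α.1 ∈ flatForms n := by
  rw [homotopyAt_eq ht]
  exact (isFlatKernel_flowKernel n measurableSet_Ioc Ioc_subset_Ioi_self).integral_mem α

/-- The `k`-th derivative of the remainder is an integral over `(t, ∞)`, bounded by the tail of one
integrable function for all points of the compact set. -/
theorem tendstoSmooth_homotopyAt {n : ℕ} (α : flatForms (n + 1)) :
    TendstoSmooth (fun t => homotopyAt flow t α.1) (hSkeleton n α).1 := by
  intro k K hK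
  obtain ⟨R, hR⟩ := hK.isBounded.exists_norm_le
  have hker := isFlatKernel_flowKernel n measurableSet_Ioi (S := Ioi (0 : ℝ)) Subset.rfl
  obtain ⟨g, hg, hb⟩ := hker.dominated α k 0 R
  have htail : Tendsto (fun t => (∫ s in Ioi (0 : ℝ), g s) - ∫ s in (0 : ℝ)..t, g s) atTop (𝓝 0) := by
    have := (intervalIntegral_tendsto_integral_Ioi (0 : ℝ) hg tendsto_id).const_sub
      (∫ s in Ioi (0 : ℝ), g s)
    rwa [sub_self] at this
  rw [Metric.tendstoUniformlyOn_iff]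
  intro ε hε
  filter_upwards [eventually_ge_atTop 0, htail.eventually_lt_const hε] with t ht hlt A hA
  refine lt_of_le_of_lt ?_ hlt
  have hker' := isFlatKernel_flowKernel n measurableSet_Ioc (S := Ioc (0 : ℝ) t) Ioc_subset_Ioi_self
  have hU : Ioi (0 : ℝ) = Ioc 0 t ∪ Ioi t := (Ioc_union_Ioi_eq_Ioi ht).symm
  have hdisj : Disjoint (Ioc (0 : ℝ) t) (Ioi t) := Ioc_disjoint_Ioi le_rfl
  have hsplit : ∀ {F : Type} [NormedAddCommGroup F] [NormedSpace ℝ F] {u : ℝ → F},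
      IntegrableOn u (Ioi 0) →
      (∫ s in Ioi (0 : ℝ), u s) - ∫ s in Ioc (0 : ℝ) t, u s = ∫ s in Ioi t, u s := by
    intro F _ _ u hu
    rw [hU] at hu
    rw [hU, setIntegral_union hdisj measurableSet_Ioi hu.left_of_union hu.right_of_union,
      add_sub_cancel_left]
  have e1 : iteratedFDeriv ℝ k (hSkeleton n α).1 A
      = ∫ s in Ioi (0 : ℝ), iteratedFDeriv ℝ k (flowKernel α.1 s) A := hker.iteratedFDeriv_eq α k A
  rw [dist_eq_norm, homotopyAt_eq ht, hker'.iteratedFDeriv_eq α k A, e1,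
    hsplit (hker.integrable α k A), intervalIntegral.integral_of_le ht, hsplit hg]
  refine norm_integral_le_of_norm_le (IntegrableOn.mono_set (f := g) hg (Ioi_subset_Ioi ht)) ?_
  filter_upwards [ae_restrict_mem measurableSet_Ioi] with s hs
  simpa using hb s (lt_of_le_of_lt ht hs) A (hR A hA)

/-! ### The homotopy formula -/

/-- The retraction of the complex of flat forms associated with the flow. -/
def pSkeleton : ∀ n, flatForms n →ₗ[ℝ] flatForms n
  | 0 => LinearMap.id + hSkeleton 0 ∘ₗ d 0
  | n + 1 => LinearMap.id + (d n ∘ₗ hSkeleton n + hSkeleton (n + 1) ∘ₗ d (n + 1))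

/-- Fundamental theorem of calculus on `(0, ∞)` for `s ↦ φ_s^* α` at `A`: by Cartan's formula the
integral of the derivative is the term that `pSkeleton` adds to `α`. -/
theorem pSkeleton_eq_of_tendsto {n : ℕ} (α : flatForms n) {A : SL} {L : SL [⋀^Fin n]→L[ℝ] ℝ}
    (hL : Tendsto (fun t => pullback (flow t) α.1 A) atTop (𝓝 L)) : (pSkeleton n α).1 A = L := by
  have h0 : pullback (flow 0) α.1 A = α.1 A := by
    have e : flow 0 = id := funext flow_zero
    rw [e, pullback, fderiv_id]
    ext v
    rfl
  have hc : ContinuousWithinAt (fun t => pullback (flow t) α.1 A) (Ici 0) 0 := by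
    have h1 : ContinuousAt (fun q : ℝ × SL => fderiv ℝ (flow q.1) q.2) (0, A) := by
      have : ContDiffAt ℝ 0 (fun q : ℝ × SL => fderiv ℝ (flow q.1) q.2) (0, A) := by
        refine ContDiffAt.fderiv (n := 1) (f := fun q : ℝ × SL => flow q.1) (g := Prod.snd) ?_
          contDiffAt_snd (by simp)
        exact ContDiffAt.comp (g := fun q : ℝ × SL => flow q.1 q.2)
          (f := fun p : (ℝ × SL) × SL => (p.1.1, p.2)) ((0, A), A)
          ((contDiffAt_flow (q := (0, A)) le_rfl).of_le (natCast_le_infty 1))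
          ((contDiffAt_fst.fst).prodMk contDiffAt_snd)
      exact this.continuousAt
    have h2 : ContinuousAt (fun t : ℝ => (t, A)) 0 := continuousAt_id.prodMk continuousAt_const
    have h3 : ContinuousAt (fun t => fderiv ℝ (flow t) A) 0 :=
      ContinuousAt.comp (g := fun q : ℝ × SL => fderiv ℝ (flow q.1) q.2)
        (f := fun t : ℝ => (t, A)) h1 h2
    have h4 : ContinuousAt (fun t => α.1 (flow t A)) 0 :=
      (α.2.1.continuous.continuousAt).comp (hasDerivAt_flow le_rfl A).continuousAt
    exact ((contDiff_compCLM_uncurry n).continuous.continuousAt.comp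
      (h4.prodMk h3)).continuousWithinAt
  have hV : ∀ s ∈ Ioi (0 : ℝ), ∀ B, HasDerivAt (fun t => flow t B) (fderiv ℝ (flow s) B (W B)) s :=
    fun s hs B => by
      rw [fderiv_flow_W (le_of_lt hs), ← W_flow (le_of_lt hs)]
      exact hasDerivAt_flow (le_of_lt hs) B
  match n with
  | 0 =>
    have hi := integral_Ioi_of_hasDerivAt_of_tendsto hc
      (fun s hs => hasDerivAt_pullback_zero (hV s hs) α.2.1 A)
      ((isFlatKernel_flowKernel 0 measurableSet_Ioi Subset.rfl).integrable_apply (d 0 α) A) hL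
    change α.1 A + (hSkeleton 0 (d 0 α)).1 A = L
    rw [hSkeleton_apply]
    change α.1 A + ∫ s in Ioi (0 : ℝ), interiorProduct W (pullback (flow s) (extDeriv α.1)) A = L
    rw [hi, h0, add_sub_cancel]
  | n + 1 =>
    have hker := isFlatKernel_flowKernel n measurableSet_Ioi (S := Ioi (0 : ℝ)) Subset.rfl
    have i1 := hker.integrable_extDeriv α A
    have i2 := (isFlatKernel_flowKernel (n + 1) measurableSet_Ioi
      (S := Ioi (0 : ℝ)) Subset.rfl).integrable_apply (d (n + 1) α) A
    have hi := integral_Ioi_of_hasDerivAt_of_tendsto hc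
      (fun s hs => hasDerivAt_pullback_succ isOpen_Ioi (fun q hq => contDiffAt_flow (le_of_lt hq)) hs
        (hV s hs) α.2.1 A) (i1.add i2) hL
    change α.1 A + (extDeriv (hSkeleton n α).1 A + (hSkeleton (n + 1) (d (n + 1) α)).1 A) = L
    have e1 : extDeriv (hSkeleton n α).1 A = ∫ s in Ioi (0 : ℝ), extDeriv (flowKernel α.1 s) A :=
      hker.extDeriv_op α A
    rw [hSkeleton_apply, e1, ← integral_add i1 i2]
    refine (congrArg (α.1 A + ·) hi).trans ?_
    simp only [h0, add_sub_cancel]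

/-! ### Commutation with the exterior product with `φ` -/

/-- Differentiate the constancy of `f` along the flow at time zero. -/
theorem fderiv_casimir_W (A : SL) :
    fderiv ℝ casimirRe A (W A) = 0 ∧ fderiv ℝ casimirIm A (W A) = 0 := by
  have h : HasDerivWithinAt (fun s => flow s A) (W A) (Ici 0) 0 := by
    have := (hasDerivAt_flow le_rfl A).hasDerivWithinAt (s := Ici (0 : ℝ))
    rwa [flow_zero] at this
  have key : ∀ {u : SL → ℝ}, ContDiff ℝ ∞ u → (∀ t, 0 ≤ t → u (flow t A) = u A) →
      fderiv ℝ u A (W A) = 0 := by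
    intro u hu hc
    have h1 : HasFDerivAt u (fderiv ℝ u A) (flow 0 A) := by
      rw [flow_zero]; exact (hu.differentiable (by simp) A).hasFDerivAt
    have h2 := h1.comp_hasDerivWithinAt (0 : ℝ) h
    have h3 : HasDerivWithinAt (u ∘ fun s => flow s A) 0 (Ici 0) 0 :=
      (hasDerivWithinAt_const (0 : ℝ) (Ici 0) (u A)).congr (fun t ht => hc t ht) (hc 0 le_rfl)
    exact (uniqueDiffWithinAt_Ici (0 : ℝ)).eq_deriv _ h2 h3
  exact ⟨key contDiff_casimirRe fun t ht => congrArg Complex.re (casimir_flow ht A),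
    key contDiff_casimirIm fun t ht => congrArg Complex.im (casimir_flow ht A)⟩

theorem pullback_flow_ePhi {n : ℕ} {t : ℝ} (ht : 0 ≤ t) (β : Form n) :
    pullback (flow t) (ePhi n β) = ePhi n (pullback (flow t) β) :=
  funext fun A => pullback_ePhi ((contDiff_flow ht).differentiable (by simp) A)
    (Eventually.of_forall fun B => casimir_flow ht B)

theorem hSkeleton_ePhiFlat_zero (β : flatForms 0) : hSkeleton 1 (ePhiFlat 0 β) = 0 := by
  refine Subtype.ext (funext fun A => ?_)
  rw [hSkeleton_apply]
  refine (setIntegral_congr_fun (g := fun _ => 0) measurableSet_Ioi fun s hs => ?_).trans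
    (integral_zero _ _)
  obtain ⟨h1, h2⟩ := fderiv_casimir_W A
  change interiorProduct W (pullback (flow s) (ePhi 0 β.1)) A = 0
  rw [pullback_flow_ePhi (le_of_lt hs), interiorProduct_ePhi_zero h1 h2]

theorem hSkeleton_ePhiFlat (n : ℕ) (β : flatForms (n + 1)) :
    hSkeleton (n + 2) (ePhiFlat (n + 1) β) = ePhiFlat n (hSkeleton n β) := by
  refine Subtype.ext (funext fun A => ?_)
  obtain ⟨h1, h2⟩ := fderiv_casimir_W A
  change _ = ePhi n (hSkeleton n β).1 A
  rw [hSkeleton_apply, ePhi_eq_ePhiL, hSkeleton_apply, ← (ePhiL n A).integral_comp_comm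
    ((isFlatKernel_flowKernel n measurableSet_Ioi Subset.rfl).integrable_apply β A)]
  refine setIntegral_congr_fun measurableSet_Ioi fun s hs => ?_
  change interiorProduct W (pullback (flow s) (ePhi (n + 1) β.1)) A = _
  rw [pullback_flow_ePhi (le_of_lt hs), interiorProduct_ePhi h1 h2]
  rfl

/-! ### Convergence of the flow to the retraction -/

/-- The flow and the retraction as members of one family:
`(1 + |A|² u + |f|² u²)^(-1/2) (A - u f A*)`. -/
def interp (q : ℝ × SL) : SL :=
  (√(1 + rho q.2 * q.1 + esq q.2 * q.1 ^ 2))⁻¹ • (q.2 - q.1 • casimirStar q.2)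

theorem contDiffAt_interp {q : ℝ × SL} (hq : 0 ≤ q.1) : ContDiffAt ℝ ∞ interp q := by
  have hy : 0 < 1 + rho q.2 * q.1 + esq q.2 * q.1 ^ 2 := by
    have := rho_nonneg q.2
    have := esq_nonneg q.2
    positivity
  have h1 : ContDiff ℝ ∞ fun q : ℝ × SL => 1 + rho q.2 * q.1 + esq q.2 * q.1 ^ 2 :=
    (contDiff_const.add ((contDiff_rho.comp contDiff_snd).mul contDiff_fst)).add
      ((contDiff_esq.comp contDiff_snd).mul (contDiff_fst.pow 2))
  exact ((h1.contDiffAt.sqrt hy.ne').inv (Real.sqrt_pos.2 hy).ne').smul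
    (contDiff_snd.sub (contDiff_fst.smul (contDiff_casimirStar.comp contDiff_snd))).contDiffAt

theorem flow_eq_interp {t : ℝ} (A : SL) : flow t A = interp (sF t A / cF t A, A) := by
  have hc : 0 < cF t A := zero_lt_one.trans_le (one_le_cF t A)
  have e : yF t A = cF t A ^ 2 * (1 + rho A * (sF t A / cF t A) + esq A * (sF t A / cF t A) ^ 2) := by
    rw [yF]; field_simp; ring
  have e2 : cF t A • A - sF t A • casimirStar A
      = cF t A • (A - (sF t A / cF t A) • casimirStar A) := by
    rw [smul_sub, smul_smul, mul_div_cancel₀ _ hc.ne']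
  rw [flow, interp, e, Real.sqrt_mul (sq_nonneg _), Real.sqrt_sq hc.le, e2, smul_smul, mul_inv,
    mul_right_comm, inv_mul_cancel₀ hc.ne', one_mul]

theorem retraction_eq_interp {A : SL} (hA : casimir A ≠ 0) :
    retraction A = interp (‖casimir A‖⁻¹, A) := by
  have hx : ‖casimir A‖ ≠ 0 := norm_ne_zero_iff.2 hA
  have e : 1 + rho A * ‖casimir A‖⁻¹ + esq A * ‖casimir A‖⁻¹ ^ 2 = 2 + rho A / ‖casimir A‖ := by
    rw [esq_eq]; field_simp; ring
  rw [retraction_eq_comb hA, interp, e, smul_sub, smul_smul]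

/-- `tanh (t x) / x`. -/
def tanhDiv (t x : ℝ) : ℝ := Real.sinh (t * x) / Real.cosh (t * x) / x

theorem sF_div_cF {t : ℝ} {A : SL} (hA : casimir A ≠ 0) :
    sF t A / cF t A = tanhDiv t ‖casimir A‖ := by
  have hx : ‖casimir A‖ ≠ 0 := norm_ne_zero_iff.2 hA
  rw [tanhDiv, ← sF_eq, ← cF_eq]
  field_simp

theorem hasDerivAt_tanhDiv (t : ℝ) {x : ℝ} (hx : x ≠ 0) : HasDerivAt (tanhDiv t)
    (t / Real.cosh (t * x) ^ 2 / x - Real.sinh (t * x) / Real.cosh (t * x) / x ^ 2) x := by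
  have h1 : HasDerivAt (fun x => t * x) t x := by simpa using (hasDerivAt_id x).const_mul t
  have hc := (Real.cosh_pos (t * x)).ne'
  refine ((h1.sinh.div h1.cosh hc).div (hasDerivAt_id x) hx).congr_deriv ?_
  have := Real.cosh_sq (t * x)
  simp only [id, Pi.div_apply]
  field_simp
  linear_combination t * x * this

theorem tendsto_div_cosh_sq {x : ℝ} (hx : 0 < x) :
    Tendsto (fun t => t / Real.cosh (t * x) ^ 2) atTop (𝓝 0) := by
  obtain ⟨K, hK0, hK⟩ := exists_one_add_pow_le_cosh_sq 2
  have h1 : Tendsto (fun t : ℝ => K / x ^ 2 * t⁻¹) atTop (𝓝 0) := by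
    simpa using tendsto_inv_atTop_zero.const_mul (K / x ^ 2)
  refine squeeze_zero' ?_ ?_ h1
  · filter_upwards [eventually_ge_atTop 0] with t ht using by positivity
  · filter_upwards [eventually_gt_atTop 0] with t ht
    have h2 := hK (t * x) (by positivity)
    have hc : 0 < Real.cosh (t * x) ^ 2 := by positivity
    have h3 : (t * x) ^ 2 ≤ K * Real.cosh (t * x) ^ 2 := by
      refine le_trans ?_ h2
      have : 0 ≤ t * x := by positivity
      nlinarith
    rw [div_le_iff₀ hc]
    calc t = (t * x) ^ 2 * (1 / x ^ 2 * t⁻¹) := by field_simp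
      _ ≤ K * Real.cosh (t * x) ^ 2 * (1 / x ^ 2 * t⁻¹) := by gcongr
      _ = _ := by ring

theorem tendsto_sinh_div_cosh {x : ℝ} (hx : 0 < x) :
    Tendsto (fun t => Real.sinh (t * x) / Real.cosh (t * x)) atTop (𝓝 1) := by
  have h1 : Tendsto (fun t : ℝ => 1 - (x⁻¹ * t⁻¹)) atTop (𝓝 1) := by
    simpa using (tendsto_inv_atTop_zero.const_mul x⁻¹).const_sub 1
  refine tendsto_of_tendsto_of_tendsto_of_le_of_le' h1 tendsto_const_nhds ?_ ?_
  · filter_upwards [eventually_gt_atTop 0] with t ht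
    have hc := Real.cosh_pos (t * x)
    have h2 := mul_cosh_le (y := t * x) (by positivity)
    have hs := Real.sinh_lt_cosh (t * x)
    have htx : 0 < t * x := by positivity
    rw [le_div_iff₀ hc, ← mul_inv, mul_comm x t]
    refine le_of_mul_le_mul_left ?_ htx
    have e : t * x * ((1 - (t * x)⁻¹) * Real.cosh (t * x)) = (t * x - 1) * Real.cosh (t * x) := by
      field_simp
    rw [e]
    nlinarith
  · filter_upwards with t
    rw [div_le_one (Real.cosh_pos _)]
    exact (Real.sinh_lt_cosh _).le

theorem tendsto_tanhDiv {x : ℝ} (hx : 0 < x) : Tendsto (fun t => tanhDiv t x) atTop (𝓝 x⁻¹) := by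
  have := (tendsto_sinh_div_cosh hx).div_const x
  rwa [one_div] at this

theorem tendsto_deriv_tanhDiv {x : ℝ} (hx : 0 < x) :
    Tendsto (fun t => t / Real.cosh (t * x) ^ 2 / x
      - Real.sinh (t * x) / Real.cosh (t * x) / x ^ 2) atTop (𝓝 (-(x ^ 2)⁻¹)) := by
  have := ((tendsto_div_cosh_sq hx).div_const x).sub ((tendsto_sinh_div_cosh hx).div_const (x ^ 2))
  simpa using this

theorem hasFDerivAt_norm_casimir {A : SL} (hA : casimir A ≠ 0) :
    ∃ X : SL →L[ℝ] ℝ, HasFDerivAt (fun B => ‖casimir B‖) X A := by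
  have h : ContDiffAt ℝ 1 (fun B => ‖casimir B‖) A :=
    (contDiff_casimir.of_le (natCast_le_infty 1)).contDiffAt.norm ℝ hA
  exact ⟨_, (h.differentiableAt one_ne_zero).hasFDerivAt⟩

/-- The derivative of `interp (g (‖f‖), ·)`. -/
theorem hasFDerivAt_interp_comp {A : SL} {X : SL →L[ℝ] ℝ}
    (hX : HasFDerivAt (fun B => ‖casimir B‖) X A) {g : ℝ → ℝ} {g' : ℝ}
    (hg : HasDerivAt g g' ‖casimir A‖) (hg0 : 0 ≤ g ‖casimir A‖) :
    HasFDerivAt (fun B => interp (g ‖casimir B‖, B))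
      ((fderiv ℝ interp (g ‖casimir A‖, A)).comp ((g' • X).prod (ContinuousLinearMap.id ℝ SL))) A := by
  have h1 : HasFDerivAt (fun B => (g ‖casimir B‖, B)) ((g' • X).prod (ContinuousLinearMap.id ℝ SL)) A :=
    (hg.comp_hasFDerivAt A hX).prodMk (hasFDerivAt_id A)
  exact HasFDerivAt.comp (g := interp) A ((contDiffAt_interp (q := (g ‖casimir A‖, A))
    hg0).differentiableAt (by simp)).hasFDerivAt h1

theorem tanhDiv_nonneg {t x : ℝ} (ht : 0 ≤ t) (hx : 0 ≤ x) : 0 ≤ tanhDiv t x := by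
  have h1 := Real.sinh_nonneg_iff.2 (mul_nonneg ht hx)
  have h2 := Real.cosh_pos (t * x)
  rw [tanhDiv]
  positivity

/-- Near `A` both maps have the form `B ↦ interp (g(|f(B)|), B)`, with `g(x) = tanh(tx)/x` for the
flow and `g(x) = 1/x` for `r`. Convergence of values and first derivatives thus reduces to that of
`g` and `g'` at the single point `|f(A)|`. -/
theorem tendsto_pullback_flow {n : ℕ} {α : Form n} (hα : ContDiff ℝ ∞ α) {A : SL}
    (hA : casimir A ≠ 0) :
    Tendsto (fun t => pullback (flow t) α A) atTop (𝓝 (pullback retraction α A)) := by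
  obtain ⟨X, hX⟩ := hasFDerivAt_norm_casimir hA
  have hx : 0 < ‖casimir A‖ := norm_pos_iff.2 hA
  have hnhds : {B : SL | casimir B ≠ 0} ∈ 𝓝 A := isOpen_casimir_ne_zero.mem_nhds hA
  have hflow : ∀ t, 0 ≤ t → fderiv ℝ (flow t) A = (fderiv ℝ interp (tanhDiv t ‖casimir A‖, A)).comp
      (((t / Real.cosh (t * ‖casimir A‖) ^ 2 / ‖casimir A‖
        - Real.sinh (t * ‖casimir A‖) / Real.cosh (t * ‖casimir A‖) / ‖casimir A‖ ^ 2) • X).prod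
          (ContinuousLinearMap.id ℝ SL)) := fun t ht => by
    refine ((hasFDerivAt_interp_comp hX (hasDerivAt_tanhDiv t hx.ne')
      (tanhDiv_nonneg ht hx.le)).congr_of_eventuallyEq ?_).fderiv
    filter_upwards [hnhds] with B hB
    rw [flow_eq_interp, sF_div_cF hB]
  have hretr : fderiv ℝ retraction A = (fderiv ℝ interp (‖casimir A‖⁻¹, A)).comp
      (((-(‖casimir A‖ ^ 2)⁻¹) • X).prod (ContinuousLinearMap.id ℝ SL)) := by
    refine ((hasFDerivAt_interp_comp hX (hasDerivAt_inv hx.ne')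
      (inv_nonneg.2 hx.le)).congr_of_eventuallyEq ?_).fderiv
    filter_upwards [hnhds] with B hB using retraction_eq_interp hB
  have hq : ContDiffAt ℝ ∞ interp (‖casimir A‖⁻¹, A) :=
    contDiffAt_interp (inv_nonneg.2 hx.le)
  have h1 : Tendsto (fun t => (tanhDiv t ‖casimir A‖, A)) atTop (𝓝 (‖casimir A‖⁻¹, A)) :=
    (tendsto_tanhDiv hx).prodMk_nhds tendsto_const_nhds
  have h2 : Tendsto (fun t => fderiv ℝ (flow t) A) atTop (𝓝 (fderiv ℝ retraction A)) := by
    rw [hretr]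
    have h3 : Tendsto (fun t => fderiv ℝ interp (tanhDiv t ‖casimir A‖, A)) atTop
        (𝓝 (fderiv ℝ interp (‖casimir A‖⁻¹, A))) :=
      ((hq.fderiv_right (m := 0) (natCast_le_infty 1)).continuousAt.tendsto).comp h1
    have h4 : Tendsto (fun t : ℝ => ((t / Real.cosh (t * ‖casimir A‖) ^ 2 / ‖casimir A‖
        - Real.sinh (t * ‖casimir A‖) / Real.cosh (t * ‖casimir A‖) / ‖casimir A‖ ^ 2) • X).prod
          (ContinuousLinearMap.id ℝ SL)) atTop
        (𝓝 (((-(‖casimir A‖ ^ 2)⁻¹) • X).prod (ContinuousLinearMap.id ℝ SL))) := by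
      have hc : Continuous fun c : ℝ => (c • X).prod (ContinuousLinearMap.id ℝ SL) := by
        have e : ∀ c : ℝ, (c • X).prod (ContinuousLinearMap.id ℝ SL)
            = c • X.prod (0 : SL →L[ℝ] SL) + (0 : SL →L[ℝ] ℝ).prod (ContinuousLinearMap.id ℝ SL) :=
          fun c => by ext v <;> simp
        simp only [e]
        exact (continuous_id.smul continuous_const).add continuous_const
      exact (hc.tendsto _).comp (tendsto_deriv_tanhDiv hx)
    refine Tendsto.congr' ?_ (((ContinuousLinearMap.compL ℝ SL (ℝ × SL) SL).continuous₂.tendsto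
      (_, _)).comp (h3.prodMk_nhds h4))
    filter_upwards [eventually_ge_atTop 0] with t ht
    exact (hflow t ht).symm
  have h5 : Tendsto (fun t => α (flow t A)) atTop (𝓝 (α (retraction A))) := by
    refine (hα.continuous.tendsto _).comp ?_
    rw [retraction_eq_interp hA]
    refine Tendsto.congr (fun t => ?_) (hq.continuousAt.tendsto.comp h1)
    rw [flow_eq_interp, sF_div_cF hA]; rfl
  exact ((contDiff_compCLM_uncurry n).continuous.tendsto _).comp (h5.prodMk_nhds h2)

theorem pSkeleton_eq_pullback {n : ℕ} (α : flatForms n) {A : SL} (hA : casimir A ≠ 0) :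
    (pSkeleton n α).1 A = pullback retraction α.1 A :=
  pSkeleton_eq_of_tendsto α (tendsto_pullback_flow α.2.1 hA)

/-- Flat forms that agree off the cone `f = 0` are equal. -/
theorem flatForms_ext {n : ℕ} {α β : flatForms n} (h : ∀ A, casimir A ≠ 0 → α.1 A = β.1 A) :
    α = β :=
  Subtype.ext (Continuous.ext_on dense_casimir_ne_zero α.2.1.continuous β.2.1.continuous
    fun A hA => h A hA)

/-- By density it suffices to argue off the cone, where `r ∘ r = r` and `r` preserves `f`. -/
theorem pSkeleton_idem (n : ℕ) (α : flatForms n) :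
    pSkeleton n (pSkeleton n α) = pSkeleton n α := by
  refine flatForms_ext fun A hA => ?_
  have hr : casimir (retraction A) ≠ 0 := by rwa [casimir_retraction]
  rw [pSkeleton_eq_pullback _ hA, pSkeleton_eq_pullback _ hA]
  have h1 : pullback retraction (pSkeleton n α).1 A
      = pullback retraction (pullback retraction α.1) A := by
    rw [pullback, pullback, pSkeleton_eq_pullback α hr]
  have h2 : retraction ∘ retraction = retraction :=
    funext fun B => retraction_of_mem_skeleton (retraction_mem_skeleton B)
  rw [h1, pullback_comp ((contDiffAt_retraction hA).differentiableAt (by simp))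
    ((contDiffAt_retraction hr).differentiableAt (by simp)), h2]

theorem isDeformationRetraction_skeleton :
    IsDeformationRetraction (fun _ => ⊤) pSkeleton hSkeleton :=
  isDeformationRetraction_of_homotopy (fun _ _ _ => trivial) (fun _ _ _ => trivial)
    (fun _ _ => rfl) (fun _ _ _ => rfl) fun n α _ => pSkeleton_idem n α

theorem isDeformationRetraction_skeleton_foliated :
    IsDeformationRetraction foliated pSkeleton hSkeleton :=
  isDeformationRetraction_of_homotopy d_mem_foliated
    (mem_foliated_of_commute hSkeleton_ePhiFlat_zero hSkeleton_ePhiFlat)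
    (fun _ _ => rfl) (fun _ _ _ => rfl) fun n α _ => pSkeleton_idem n α

theorem pointwiseSLB_hSkeleton (n : ℕ) : PointwiseSLB (hSkeleton n) 5 35 :=
  (isFlatKernel_flowKernel n measurableSet_Ioi Subset.rfl).pointwiseSLB_op

/-! ### Kernels given by linear contractions -/

section LinearKernels

variable {Ω : Type*} [MeasurableSpace Ω] {ν : Measure Ω} {n : ℕ}

theorem JetBound.jet_clm {ι : Type*} {n : ℕ} {R K : ℝ} {a : ι → SL} {L : ι → SL →L[ℝ] SL}
    (ha : ∀ i, ‖a i‖ ≤ R) (hL : ∀ i, ‖L i‖ ≤ K) :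
    JetBound n (fun i x => L i x) a (fun _ => 1) (fun _ => 1) := by
  have h1 : JetBound n (fun i (_ : SL) => L i) a (fun i => ‖L i‖) (fun _ => 1) :=
    JetBound.const fun _ => le_rfl
  have h2 := h1.bilinear (ContinuousLinearMap.id ℝ (SL →L[ℝ] SL))
    (JetBound.of_contDiff_one contDiff_id ha fun _ => le_rfl)
  exact h2.mono (fun _ => zero_le_one) K fun i => by simpa using hL i

/-- Flat bounds for pullbacks along linear contractions. -/
theorem exists_pullback_bound (m : ℕ) (R : ℝ) (n k : ℕ) : ∃ C : ℝ, 0 ≤ C ∧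
    ∀ P : SL →L[ℝ] SL, (∀ A, ‖P A‖ ≤ ‖A‖) → ∀ r ≤ R, ∀ α : Form m, ContDiff ℝ ∞ α →
      ∀ M : ℝ, 0 ≤ M → FlatBound α n k r M → FlatBound (pullback P α) n k r (C * M) := by
  let ι := {p : ((SL →L[ℝ] SL) × SL) × (Form m × ℝ) // (∀ A, ‖p.1.1 A‖ ≤ ‖A‖) ∧ ‖p.1.2‖ ≤ R ∧
    ContDiff ℝ ∞ p.2.1 ∧ 0 ≤ p.2.2 ∧ FlatBound p.2.1 n k ‖p.1.2‖ p.2.2}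
  let L : ι → SL →L[ℝ] SL := fun i => i.1.1.1
  let a : ι → SL := fun i => i.1.1.2
  let al : ι → Form m := fun i => i.1.2.1
  let M : ι → ℝ := fun i => i.1.2.2
  have ha : ∀ i, ‖a i‖ ≤ R := fun i => i.2.2.1
  have hL : ∀ i, ‖L i‖ ≤ 1 := fun i =>
    ContinuousLinearMap.opNorm_le_bound _ zero_le_one fun A => by simpa using i.2.1 A
  have h1 := JetBound.flat_comp (n := n) (JetBound.jet_clm ha hL) (α := al) (M := M)
    (fun i => i.2.2.2.1) (fun i => i.2.2.2.2.1) (fun i => i.2.1 _) fun i => i.2.2.2.2.2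
  obtain ⟨-, -, -, C, hC0, hC⟩ :=
    JetBound.jet_pullback (α := al) h1 (JetBound.jet_clm (n := n + 1) ha hL).jet_fderiv
  refine ⟨C, hC0, fun P hP r hr α hα M' hM' hb A hA j hj => ?_⟩
  refine (hC ⟨((P, A), (α, M')), hP, hA.trans hr, hα, hM', fun B hB => hb B (hB.trans hA)⟩
    j hj).trans ?_
  simp only [L, a, M, one_pow, mul_one, mul_assoc]
  have := hP A
  gcongr

/-- Flat bounds for contracted pullbacks along linear contractions. -/
theorem exists_interiorProduct_pullback_bound (m : ℕ) (K R : ℝ) (n k : ℕ) : ∃ C : ℝ, 0 ≤ C ∧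
    ∀ P Z : SL →L[ℝ] SL, (∀ A, ‖P A‖ ≤ ‖A‖) → ‖Z‖ ≤ K → ∀ r ≤ R, ∀ α : Form (m + 1),
      ContDiff ℝ ∞ α → ∀ M : ℝ, 0 ≤ M → FlatBound α n k r M →
      FlatBound (interiorProduct Z (pullback P α)) n k r (C * M) := by
  let ι := {p : (((SL →L[ℝ] SL) × (SL →L[ℝ] SL)) × SL) × (Form (m + 1) × ℝ) //
    (∀ A, ‖p.1.1.1 A‖ ≤ ‖A‖) ∧ ‖p.1.1.2‖ ≤ K ∧ ‖p.1.2‖ ≤ R ∧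
    ContDiff ℝ ∞ p.2.1 ∧ 0 ≤ p.2.2 ∧ FlatBound p.2.1 n k ‖p.1.2‖ p.2.2}
  let L : ι → SL →L[ℝ] SL := fun i => i.1.1.1.1
  let Z : ι → SL →L[ℝ] SL := fun i => i.1.1.1.2
  let a : ι → SL := fun i => i.1.1.2
  let al : ι → Form (m + 1) := fun i => i.1.2.1
  let M : ι → ℝ := fun i => i.1.2.2
  have ha : ∀ i, ‖a i‖ ≤ R := fun i => i.2.2.2.1
  have hL : ∀ i, ‖L i‖ ≤ 1 := fun i =>
    ContinuousLinearMap.opNorm_le_bound _ zero_le_one fun A => by simpa using i.2.1 A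
  have hLZ : ∀ i, ‖(L i).comp (Z i)‖ ≤ 1 * K := fun i =>
    (ContinuousLinearMap.opNorm_comp_le _ _).trans
      (mul_le_mul (hL i) i.2.2.1 (norm_nonneg _) zero_le_one)
  have h1 := JetBound.flat_comp (n := n) (JetBound.jet_clm ha hL) (α := al) (M := M)
    (fun i => i.2.2.2.2.1) (fun i => i.2.2.2.2.2.1) (fun i => i.2.1 _) fun i => i.2.2.2.2.2.2
  obtain ⟨-, -, -, C, hC0, hC⟩ := JetBound.jet_interiorProduct (α := al) (V := fun i => Z i) h1
    (JetBound.jet_clm ha hLZ) (fun i => (Z i).contDiff) (fun i A => by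
      rw [(L i).fderiv]; rfl)
    (JetBound.jet_clm (n := n + 1) ha hL).jet_fderiv
  refine ⟨C, hC0, fun P Z hP hZ r hr α hα M' hM' hb A hA j hj => ?_⟩
  refine (hC ⟨(((P, Z), A), (α, M')), hP, hZ, hA.trans hr, hα, hM',
    fun B hB => hb B (hB.trans hA)⟩ j hj).trans ?_
  simp only [L, a, M, one_pow, mul_one, mul_assoc]
  have := hP A
  gcongr

theorem stronglyMeasurable_iteratedFDeriv {X : Type*} [NormedAddCommGroup X] [NormedSpace ℝ X]
    {u : X → Form n} (hu : ContDiff ℝ ∞ fun p : X × SL => u p.1 p.2) {x : Ω → X}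
    (hx : StronglyMeasurable x) (j : ℕ) (A : SL) :
    StronglyMeasurable fun z => iteratedFDeriv ℝ j (u (x z)) A := by
  have h : Continuous fun y => iteratedFDeriv ℝ j (u y) A := by
    refine continuous_iff_continuousAt.2 fun y => ?_
    have h1 := contDiffAt_iteratedFDeriv_right (S := univ) (u := u)
      (fun p _ => hu.contDiffAt) j (y, A) (mem_univ _)
    exact ContinuousAt.comp (g := fun p : X × SL => iteratedFDeriv ℝ j (u p.1) p.2)
      (f := fun y => (y, A)) h1.continuousAt (continuousAt_id.prodMk continuousAt_const)
  exact h.comp_stronglyMeasurable hx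

theorem contDiff_pullback_uncurry {α : Form n} (hα : ContDiff ℝ ∞ α) :
    ContDiff ℝ ∞ fun p : (SL →L[ℝ] SL) × SL => pullback p.1 α p.2 := by
  have e : (fun p : (SL →L[ℝ] SL) × SL => pullback p.1 α p.2)
      = fun p => (α (p.1 p.2)).compContinuousLinearMap p.1 := by
    funext p
    rw [pullback, p.1.fderiv]
  rw [e]
  exact ContDiff.compCLM (hα.comp (contDiff_fst.clm_apply contDiff_snd)) contDiff_fst

theorem contDiff_interiorProduct_uncurry {α : Form (n + 1)} (hα : ContDiff ℝ ∞ α) :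
    ContDiff ℝ ∞ fun p : ((SL →L[ℝ] SL) × (SL →L[ℝ] SL)) × SL =>
      interiorProduct p.1.2 (pullback p.1.1 α) p.2 := by
  have h1 : ContDiff ℝ ∞ fun p : ((SL →L[ℝ] SL) × (SL →L[ℝ] SL)) × SL => pullback p.1.1 α p.2 :=
    (contDiff_pullback_uncurry hα).comp ((contDiff_fst.comp contDiff_fst).prodMk contDiff_snd)
  have h2 : ContDiff ℝ ∞ fun p : ((SL →L[ℝ] SL) × (SL →L[ℝ] SL)) × SL => p.1.2 p.2 :=
    (contDiff_snd.comp contDiff_fst).clm_apply contDiff_snd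
  exact ContDiff.comp (g := fun p : (SL [⋀^Fin (n + 1)]→L[ℝ] ℝ) × SL => p.1.curryLeft p.2)
    (f := fun p : ((SL →L[ℝ] SL) × (SL →L[ℝ] SL)) × SL => (pullback p.1.1 α p.2, p.1.2 p.2))
    (contDiff_curryLeft_uncurry n) (h1.prodMk h2)

/-- Averages of pullbacks along linear contractions. -/
theorem isFlatKernel_pullback [IsFiniteMeasure ν] {P : Ω → SL →L[ℝ] SL} (hP : StronglyMeasurable P)
    (hle : ∀ z A, ‖P z A‖ ≤ ‖A‖) :
    IsFlatKernel ν univ (fun (α : Form n) z => pullback (P z) α) 0 0 where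
  ae_mem := Eventually.of_forall fun _ => mem_univ _
  smooth α hα z _ := contDiff_pullback hα.1 (P z).contDiff
  meas α hα j A := (stronglyMeasurable_iteratedFDeriv (u := fun L : SL →L[ℝ] SL => pullback L α)
    (contDiff_pullback_uncurry hα.1) hP j A).aestronglyMeasurable
  bound R N k := by
    obtain ⟨C, hC0, hC⟩ := exists_pullback_bound n R N k
    exact ⟨fun _ => C, integrable_const C, fun _ => hC0, fun r hr α hα M hM hb z _ =>
      hC (P z) (hle z) r hr α hα.1 M hM (by simpa using hb)⟩
  map_add α β z := pullback_add _ α β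
  map_smul c α z := pullback_smul _ c α

/-- Averages of contracted pullbacks along linear contractions. -/
theorem isFlatKernel_interiorProduct [IsFiniteMeasure ν] {P Z : Ω → SL →L[ℝ] SL}
    (hP : StronglyMeasurable P) (hZ : StronglyMeasurable Z)
    (hle : ∀ z A, ‖P z A‖ ≤ ‖A‖) {K : ℝ} (hK : ∀ z, ‖Z z‖ ≤ K) :
    IsFlatKernel ν univ (fun (α : Form (n + 1)) z => interiorProduct (Z z) (pullback (P z) α))
      0 0 where
  ae_mem := Eventually.of_forall fun _ => mem_univ _
  smooth α hα z _ := contDiff_interiorProduct (contDiff_pullback hα.1 (P z).contDiff) (Z z).contDiff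
  meas α hα j A := (stronglyMeasurable_iteratedFDeriv
    (u := fun L : (SL →L[ℝ] SL) × (SL →L[ℝ] SL) => interiorProduct L.2 (pullback L.1 α))
    (contDiff_interiorProduct_uncurry hα.1) (hP.prodMk hZ) j A).aestronglyMeasurable
  bound R N k := by
    obtain ⟨C, hC0, hC⟩ := exists_interiorProduct_pullback_bound n K R N k
    exact ⟨fun _ => C, integrable_const C, fun _ => hC0, fun r hr α hα M hM hb z _ =>
      hC (P z) (Z z) (hle z) (hK z) r hr α hα.1 M hM (by simpa using hb)⟩
  map_add α β z := by rw [pullback_add, interiorProduct_add]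
  map_smul c α z := by rw [pullback_smul, interiorProduct_smul]

end LinearKernels

section Paths

/-! ### Paths in the adjoint group -/

/-- The Lie bracket as a bilinear map. -/
def adLM : SL →ₗ[ℝ] SL →ₗ[ℝ] SL :=
  LinearMap.mk₂ ℝ bracket
    (fun A B C => Subtype.ext (by
      change (A.mat + B.mat) * C.mat - C.mat * (A.mat + B.mat)
        = (A.mat * C.mat - C.mat * A.mat) + (B.mat * C.mat - C.mat * B.mat)
      noncomm_ring))
    (fun c A B => Subtype.ext (by
      change (c • A.mat) * B.mat - B.mat * (c • A.mat) = c • (A.mat * B.mat - B.mat * A.mat)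
      rw [Matrix.smul_mul, Matrix.mul_smul, smul_sub]))
    (fun A B C => Subtype.ext (by
      change A.mat * (B.mat + C.mat) - (B.mat + C.mat) * A.mat
        = (A.mat * B.mat - B.mat * A.mat) + (A.mat * C.mat - C.mat * A.mat)
      noncomm_ring))
    (fun c A B => Subtype.ext (by
      change A.mat * (c • B.mat) - (c • B.mat) * A.mat = c • (A.mat * B.mat - B.mat * A.mat)
      rw [Matrix.smul_mul, Matrix.mul_smul, smul_sub]))

/-- The Lie bracket as a continuous bilinear map. -/
def adL : SL →L[ℝ] SL →L[ℝ] SL :=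
  LinearMap.toContinuousLinearMap
    ((LinearMap.toContinuousLinearMap (𝕜 := ℝ) (E := SL) (F' := SL)).toLinearMap ∘ₗ adLM)

theorem mat_adL (Q A : SL) : (adL Q A).mat = Q.mat * A.mat - A.mat * Q.mat := rfl

theorem mat_adL_adL {c : ℝ} {Q : SL} (hQ : casimir Q = c) (A : SL) :
    (adL Q (adL Q A)).mat = -((2 * c) • A.mat) - (2 : ℝ) • (Q.mat * A.mat * Q.mat) := by
  have h := mat_mul_mat Q
  rw [hQ] at h
  have h1 : Q.mat * (Q.mat * A.mat) = -(c • A.mat) := by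
    rw [← mul_assoc, h, neg_mul, smul_mul_assoc, one_mul]; rfl
  have h2 : A.mat * Q.mat * Q.mat = -(c • A.mat) := by
    rw [mul_assoc, h, mul_neg, mul_smul_comm, mul_one]; rfl
  rw [mat_adL, mat_adL, mul_sub, sub_mul, h1, h2, ← mul_assoc]
  module

/-- Since `Q² = -c`, the eigenvalues of `ad Q` are `0` and `±2√(-c)`. Conjugation by an element of
`ℝ[Q]` is therefore a quadratic polynomial in `ad Q`. -/
theorem adL_adL_adL {c : ℝ} {Q : SL} (hQ : casimir Q = c) (A : SL) :
    adL Q (adL Q (adL Q A)) = -(4 * c) • adL Q A := by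
  have h := mat_mul_mat Q
  rw [hQ] at h
  refine Subtype.ext ?_
  change (adL Q (adL Q (adL Q A))).mat = -(4 * c) • (adL Q A).mat
  have h1 : Q.mat * (adL Q A).mat * Q.mat = c • (adL Q A).mat := by
    have h2 : A.mat * Q.mat * Q.mat = -(c • A.mat) := by
      rw [mul_assoc, h, mul_neg, mul_smul_comm, mul_one]; rfl
    have h3 : Q.mat * (Q.mat * (A.mat * Q.mat)) = -(c • (A.mat * Q.mat)) := by
      rw [← mul_assoc, h, neg_mul, smul_mul_assoc, one_mul]; rfl
    have h4 : Q.mat * (A.mat * Q.mat * Q.mat) = -(c • (Q.mat * A.mat)) := by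
      rw [h2, mul_neg, mul_smul_comm]
    rw [mat_adL, mul_sub, sub_mul, mul_assoc Q.mat (A.mat * Q.mat), h4, mul_assoc Q.mat, mul_assoc Q.mat,
      h3]
    module
  rw [mat_adL_adL hQ, h1]
  module

/-- `a + Q` is an element of `SU(2)` with nonnegative trace. -/
structure IsHalf (a : ℝ) (Q : SL) : Prop where
  nonneg : 0 ≤ a
  le_one : a ≤ 1
  skew : conjTr Q = -Q
  casimir_eq : casimir Q = ((1 - a ^ 2 : ℝ) : ℂ)

/-- The determinant of `(1 - s) + s (a + Q)`. -/
def pathDet (a s : ℝ) : ℝ := 1 - 2 * (1 - a) * s + 2 * (1 - a) * s ^ 2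

/-- The adjoint action of the normalization of `(1 - s) + s (a + Q)`. -/
def pathP (a : ℝ) (Q : SL) (s : ℝ) : SL →L[ℝ] SL :=
  ContinuousLinearMap.id ℝ SL + ((1 - (1 - a) * s) * s / pathDet a s) • adL Q
    + (s ^ 2 / (2 * pathDet a s)) • (adL Q).comp (adL Q)

/-- The velocity of `pathP`. -/
def pathZ (a : ℝ) (Q : SL) (s : ℝ) : SL →L[ℝ] SL := (pathDet a s)⁻¹ • adL Q

theorem pathP_apply (a : ℝ) (Q : SL) (s : ℝ) (A : SL) : pathP a Q s A =
    A + ((1 - (1 - a) * s) * s / pathDet a s) • adL Q A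
      + (s ^ 2 / (2 * pathDet a s)) • adL Q (adL Q A) := rfl

theorem pathZ_apply (a : ℝ) (Q : SL) (s : ℝ) (A : SL) :
    pathZ a Q s A = (pathDet a s)⁻¹ • adL Q A := rfl

variable {a s : ℝ} {Q : SL}

/-- The minimum, at `s = 1/2`, is `(1 + a)/2`: the sign condition `0 ≤ a` keeps the segment from `1`
to `a + Q` uniformly away from zero. -/
theorem IsHalf.half_le_pathDet (h : IsHalf a Q) (s : ℝ) : 1 / 2 ≤ pathDet a s := by
  have h0 := h.nonneg
  have h1 := h.le_one
  unfold pathDet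
  nlinarith [mul_nonneg (sub_nonneg.2 h1) (sq_nonneg (2 * s - 1))]

theorem IsHalf.pathDet_pos (h : IsHalf a Q) (s : ℝ) : 0 < pathDet a s :=
  lt_of_lt_of_le (by norm_num) (h.half_le_pathDet s)

theorem pathP_zero : pathP a Q 0 = ContinuousLinearMap.id ℝ SL := by
  ext1 A
  simp [pathP_apply]

theorem hasDerivAt_pathDet (a s : ℝ) :
    HasDerivAt (pathDet a) (-(2 * (1 - a)) + 4 * (1 - a) * s) s := by
  have h := (((hasDerivAt_id s).const_mul (2 * (1 - a))).const_sub 1).add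
    (((hasDerivAt_id s).pow 2).const_mul (2 * (1 - a)))
  refine h.congr_deriv ?_
  simp
  ring

/-- For `μ_s = (1 - s) + s(a + Q)` the trace-free part of `μ_s⁻¹ μ_s'` is `Q/pathDet`, so
conjugation by `μ_s` has velocity `pathZ`. -/
theorem IsHalf.hasDerivAt_pathP (h : IsHalf a Q) (s : ℝ) (B : SL) :
    HasDerivAt (fun s => pathP a Q s B) (pathP a Q s (pathZ a Q s B)) s := by
  have hN := h.pathDet_pos s
  have hd := hasDerivAt_pathDet a s
  have hp : HasDerivAt (fun s : ℝ => (1 - (1 - a) * s) * s) (1 - 2 * (1 - a) * s) s := by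
    refine ((((hasDerivAt_id s).const_mul (1 - a)).const_sub 1).mul
      (hasDerivAt_id s)).congr_deriv ?_
    simp
    ring
  have hx : HasDerivAt (fun s => (1 - (1 - a) * s) * s / pathDet a s)
      ((1 - 4 * (1 - a ^ 2) * (s ^ 2 / (2 * pathDet a s))) * (pathDet a s)⁻¹) s := by
    refine (hp.div hd hN.ne').congr_deriv ?_
    field_simp
    unfold pathDet
    ring
  have hy : HasDerivAt (fun s => s ^ 2 / (2 * pathDet a s))
      ((1 - (1 - a) * s) * s / pathDet a s * (pathDet a s)⁻¹) s := by
    refine (((hasDerivAt_id s).pow 2).div (hd.const_mul 2) (by positivity)).congr_deriv ?_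
    simp only [id, Pi.pow_apply]
    field_simp
    unfold pathDet
    ring
  have h1 := (hx.smul_const (adL Q B)).add (hy.smul_const (adL Q (adL Q B)))
  have h2 := h1.const_add B
  have e : (fun s => pathP a Q s B) = fun s => B + (((1 - (1 - a) * s) * s / pathDet a s) • adL Q B
      + (s ^ 2 / (2 * pathDet a s)) • adL Q (adL Q B)) := by
    funext s
    rw [pathP_apply, add_assoc]
  rw [e]
  refine h2.congr_deriv ?_
  rw [pathP_apply, pathZ_apply, map_smul, map_smul, adL_adL_adL h.casimir_eq]
  module

theorem IsHalf.contDiff_pathP (h : IsHalf a Q) :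
    ContDiff ℝ ∞ fun q : ℝ × SL => pathP a Q q.1 q.2 := by
  have hN : ContDiff ℝ ∞ fun q : ℝ × SL => pathDet a q.1 :=
    (contDiff_const.sub (contDiff_const.mul contDiff_fst)).add
      (contDiff_const.mul (contDiff_fst.pow 2))
  have h1 : ContDiff ℝ ∞ fun q : ℝ × SL => (1 - (1 - a) * q.1) * q.1 / pathDet a q.1 :=
    ((contDiff_const.sub (contDiff_const.mul contDiff_fst)).mul contDiff_fst).div hN
      fun q => (h.pathDet_pos q.1).ne'
  have h2 : ContDiff ℝ ∞ fun q : ℝ × SL => q.1 ^ 2 / (2 * pathDet a q.1) :=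
    (contDiff_fst.pow 2).div (contDiff_const.mul hN)
      fun q => (mul_pos two_pos (h.pathDet_pos q.1)).ne'
  have h3 : ContDiff ℝ ∞ fun q : ℝ × SL => adL Q q.2 := (adL Q).contDiff.comp contDiff_snd
  exact (contDiff_snd.add (h1.smul h3)).add (h2.smul ((adL Q).contDiff.comp h3))

/-- Conjugation by `p + q Q`. -/
theorem conj_mat {c : ℝ} (hQ : casimir Q = c) (p q : ℝ) (A : SL) :
    (p • (1 : Matrix (Fin 2) (Fin 2) ℂ) + q • Q.mat) * A.mat
        * (p • (1 : Matrix (Fin 2) (Fin 2) ℂ) - q • Q.mat)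
      = (p ^ 2 + q ^ 2 * c) • A.mat + (p * q) • (adL Q A).mat
        + (q ^ 2 / 2) • (adL Q (adL Q A)).mat := by
  rw [mat_adL_adL hQ, mat_adL]
  simp only [add_mul, mul_sub, smul_mul_assoc, mul_smul_comm, one_mul, mul_one, smul_sub, smul_smul]
  module

theorem det_comb (p q : ℝ) : (p • (1 : Matrix (Fin 2) (Fin 2) ℂ) + q • Q.mat).det
    = p ^ 2 + q ^ 2 * casimir Q := by
  rw [casimir_eq, Matrix.det_fin_two]
  simp [Q.mat_one_one]
  ring

theorem mul_comb {c : ℝ} (hQ : casimir Q = c) (p q : ℝ) :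
    (p • (1 : Matrix (Fin 2) (Fin 2) ℂ) - q • Q.mat) * (p • (1 : Matrix (Fin 2) (Fin 2) ℂ) + q • Q.mat)
      = (p ^ 2 + q ^ 2 * c) • (1 : Matrix (Fin 2) (Fin 2) ℂ) := by
  have h := mat_mul_mat Q
  rw [hQ] at h
  have h' : Q.mat * Q.mat = -(c • (1 : Matrix (Fin 2) (Fin 2) ℂ)) := h
  simp only [sub_mul, mul_add, smul_mul_assoc, mul_smul_comm, one_mul, mul_one, smul_smul, h',
    smul_neg]
  module

theorem pathDet_eq (a s : ℝ) :
    pathDet a s = (1 - (1 - a) * s) ^ 2 + s ^ 2 * (1 - a ^ 2) := by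
  unfold pathDet; ring

/-- This identifies the polynomial in `ad Q` with conjugation, the inverse of `p + sQ` being `p -
sQ` divided by `pathDet`. -/
theorem IsHalf.smul_mat_pathP (h : IsHalf a Q) (s : ℝ) (A : SL) :
    pathDet a s • (pathP a Q s A).mat
      = ((1 - (1 - a) * s) • (1 : Matrix (Fin 2) (Fin 2) ℂ) + s • Q.mat) * A.mat
        * ((1 - (1 - a) * s) • (1 : Matrix (Fin 2) (Fin 2) ℂ) - s • Q.mat) := by
  have hN := (h.pathDet_pos s).ne'
  rw [conj_mat h.casimir_eq, ← pathDet_eq, pathP_apply, SL.mat_add, SL.mat_add, SL.mat_smul,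
    SL.mat_smul, smul_add, smul_add, smul_smul, smul_smul, mul_div_cancel₀ _ hN]
  have e : pathDet a s * (s ^ 2 / (2 * pathDet a s)) = s ^ 2 / 2 := by field_simp
  rw [e]

theorem IsHalf.casimir_pathP (h : IsHalf a Q) (s : ℝ) (A : SL) :
    casimir (pathP a Q s A) = casimir A := by
  have hN : ((pathDet a s : ℝ) : ℂ) ≠ 0 := Complex.ofReal_ne_zero.2 (h.pathDet_pos s).ne'
  have h1 := congrArg Matrix.det (h.smul_mat_pathP s A)
  have e : (1 - (1 - a) * s) • (1 : Matrix (Fin 2) (Fin 2) ℂ) - s • Q.mat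
      = (1 - (1 - a) * s) • (1 : Matrix (Fin 2) (Fin 2) ℂ) + (-s) • Q.mat := by
    rw [neg_smul, sub_eq_add_neg]
  have e2 : (pathDet a s • (pathP a Q s A).mat)
      = ((pathDet a s : ℝ) : ℂ) • (pathP a Q s A).mat := rfl
  rw [e2, Matrix.det_smul, e, Matrix.det_mul, Matrix.det_mul, det_comb, det_comb, h.casimir_eq,
    Fintype.card_fin] at h1
  have e3 : ((pathDet a s : ℝ) : ℂ) = ((1 - (1 - a) * s : ℝ) : ℂ) ^ 2 + (s : ℂ) ^ 2 * ((1 - a ^ 2 : ℝ) : ℂ) := by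
    rw [pathDet_eq]; push_cast; ring
  have e4 : (((-s : ℝ)) : ℂ) ^ 2 = (s : ℂ) ^ 2 := by push_cast; ring
  rw [e4, ← e3] at h1
  have h2 : ((pathDet a s : ℝ) : ℂ) ^ 2 * casimir (pathP a Q s A)
      = ((pathDet a s : ℝ) : ℂ) ^ 2 * casimir A := by
    refine h1.trans ?_
    change _ * A.mat.det * _ = _ * A.mat.det
    ring
  exact mul_left_cancel₀ (pow_ne_zero 2 hN) h2

/-- As `Q` is skew-Hermitian, `μ' = μ*` and `μ' μ = pathDet`. The path thus consists of conjugations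
by unitary matrices. -/
theorem IsHalf.norm_pathP (h : IsHalf a Q) (s : ℝ) (A : SL) : ‖pathP a Q s A‖ = ‖A‖ := by
  have hN : ((pathDet a s : ℝ) : ℂ) ≠ 0 := Complex.ofReal_ne_zero.2 (h.pathDet_pos s).ne'
  have h1 := h.smul_mat_pathP s A
  set p : ℝ := 1 - (1 - a) * s with hp
  set μ : Matrix (Fin 2) (Fin 2) ℂ := p • (1 : Matrix (Fin 2) (Fin 2) ℂ) + s • Q.mat with hμ
  set μ' : Matrix (Fin 2) (Fin 2) ℂ := p • (1 : Matrix (Fin 2) (Fin 2) ℂ) - s • Q.mat with hμ'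
  have hskew : Q.mat.conjTranspose = -Q.mat := by
    have := congrArg SL.mat h.skew
    exact this
  have hstar : μ'.conjTranspose = μ := by
    rw [hμ', Matrix.conjTranspose_sub, Matrix.conjTranspose_smul, Matrix.conjTranspose_smul, hskew,
      Matrix.conjTranspose_one, smul_neg, sub_neg_eq_add]
    simp [hμ]
  have hstar2 : μ.conjTranspose = μ' := by rw [← hstar, Matrix.conjTranspose_conjTranspose]
  have hmul : μ' * μ = pathDet a s • (1 : Matrix (Fin 2) (Fin 2) ℂ) := by
    rw [hμ, hμ', mul_comb h.casimir_eq, pathDet_eq]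
  have h2 : (pathDet a s : ℂ) ^ 2 * ((‖pathP a Q s A‖ ^ 2 : ℝ) : ℂ)
      = (pathDet a s : ℂ) ^ 2 * ((‖A‖ ^ 2 : ℝ) : ℂ) := by
    rw [norm_sq_eq_trace, norm_sq_eq_trace]
    have e1 : (pathDet a s : ℂ) ^ 2 * ((pathP a Q s A).mat * (pathP a Q s A).mat.conjTranspose).trace
        = ((pathDet a s • (pathP a Q s A).mat)
          * (pathDet a s • (pathP a Q s A).mat).conjTranspose).trace := by
      rw [Matrix.conjTranspose_smul, smul_mul_assoc, mul_smul_comm, smul_smul, star_trivial,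
        Matrix.trace_smul, Complex.real_smul]
      push_cast
      ring
    rw [e1, h1, Matrix.conjTranspose_mul, Matrix.conjTranspose_mul, hstar, hstar2]
    have e2 : μ * A.mat * μ' * (μ * (A.mat.conjTranspose * μ'))
        = pathDet a s • (μ * (A.mat * A.mat.conjTranspose * μ')) := by
      calc _ = μ * A.mat * (μ' * μ) * (A.mat.conjTranspose * μ') := by noncomm_ring
        _ = _ := by
          rw [hmul, mul_smul_comm, mul_one, smul_mul_assoc]
          congr 1
          noncomm_ring
    rw [e2, Matrix.trace_smul, Matrix.trace_mul_comm, mul_assoc, hmul, mul_smul_comm, mul_one,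
      Matrix.trace_smul, Complex.real_smul, Complex.real_smul]
    ring
  have h3 := mul_left_cancel₀ (pow_ne_zero 2 hN) h2
  have h4 : ‖pathP a Q s A‖ ^ 2 = ‖A‖ ^ 2 := by exact_mod_cast h3
  exact (pow_left_inj₀ (norm_nonneg _) (norm_nonneg _) two_ne_zero).1 h4

theorem IsHalf.norm_le (h : IsHalf a Q) : ‖Q‖ ≤ 2 := by
  have h1 := norm_sq_eq_trace Q
  have hskew : Q.mat.conjTranspose = -Q.mat := congrArg SL.mat h.skew
  rw [hskew, mul_neg, mat_mul_mat, neg_neg, h.casimir_eq, Matrix.trace_smul, Matrix.trace_one] at h1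
  have h2 : ‖Q‖ ^ 2 = 2 * (1 - a ^ 2) := by
    have : ((‖Q‖ ^ 2 : ℝ) : ℂ) = ((2 * (1 - a ^ 2) : ℝ) : ℂ) := by
      rw [h1]; simp; ring
    exact_mod_cast this
  nlinarith [norm_nonneg Q, sq_nonneg a]

theorem IsHalf.norm_pathZ_le (h : IsHalf a Q) (s : ℝ) : ‖pathZ a Q s‖ ≤ 4 * ‖adL‖ := by
  rw [pathZ, norm_smul, norm_inv, Real.norm_of_nonneg (h.pathDet_pos s).le]
  have h1 : (pathDet a s)⁻¹ ≤ 2 := by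
    rw [inv_le_comm₀ (h.pathDet_pos s) two_pos]
    simpa using h.half_le_pathDet s
  calc _ ≤ 2 * (‖adL‖ * 2) := by
        have h2 : ‖adL Q‖ ≤ ‖adL‖ * 2 :=
          (adL.le_opNorm Q).trans (mul_le_mul_of_nonneg_left h.norm_le (norm_nonneg adL))
        gcongr
    _ = _ := by ring

/-- At every time the velocity is a multiple of `ad Q`, the initial velocity of a path along which
`f` is constant. -/
theorem IsHalf.fderiv_casimir_pathZ (h : IsHalf a Q) (s : ℝ) (A : SL) :
    fderiv ℝ casimirRe A (pathZ a Q s A) = 0 ∧ fderiv ℝ casimirIm A (pathZ a Q s A) = 0 := by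
  have hd : HasDerivAt (fun t => pathP a Q t A) (adL Q A) 0 := by
    have := h.hasDerivAt_pathP 0 A
    rw [pathP_zero, pathZ_apply] at this
    simpa [pathDet] using this
  have key : ∀ {u : SL → ℝ}, ContDiff ℝ ∞ u → (∀ t, u (pathP a Q t A) = u A) →
      fderiv ℝ u A (pathZ a Q s A) = 0 := by
    intro u hu hc
    have h1 : HasFDerivAt u (fderiv ℝ u A) (pathP a Q 0 A) := by
      rw [pathP_zero]; exact (hu.differentiable (by simp) A).hasFDerivAt
    have h2 := h1.comp_hasDerivAt (0 : ℝ) hd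
    have h3 : HasDerivAt (u ∘ fun t => pathP a Q t A) 0 0 := by
      have e : (u ∘ fun t => pathP a Q t A) = fun _ => u A := funext hc
      rw [e]; exact hasDerivAt_const _ _
    rw [pathZ_apply, map_smul, h2.unique h3, smul_zero]
  exact ⟨key contDiff_casimirRe fun t => congrArg Complex.re (h.casimir_pathP t A),
    key contDiff_casimirIm fun t => congrArg Complex.im (h.casimir_pathP t A)⟩

end Paths

/-! ### The adjoint action of `SU(2)` -/

theorem SU2.coe_inv (U : SU2) : (U⁻¹ : SU2).1 = U.1.conjTranspose := rfl

/-- The inverse of `U` is its conjugate transpose and, the determinant being one, also its adjugate.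
-/
theorem SU2.conjTranspose_eq (U : SU2) :
    U.1.conjTranspose = !![U.1 1 1, -U.1 0 1; -U.1 1 0, U.1 0 0] := by
  have h1 : U.1.conjTranspose * U.1 = 1 := by
    have := (Matrix.mem_specialUnitaryGroup_iff.1 U.2).1
    exact Matrix.mem_unitaryGroup_iff'.1 this
  have h2 : U.1.det = 1 := (Matrix.mem_specialUnitaryGroup_iff.1 U.2).2
  have h3 : U.1 * U.1.adjugate = 1 := by rw [Matrix.mul_adjugate, h2, one_smul]
  rw [← Matrix.adjugate_fin_two]
  calc U.1.conjTranspose = U.1.conjTranspose * (U.1 * U.1.adjugate) := by rw [h3, mul_one]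
    _ = _ := by rw [← mul_assoc, h1, one_mul]

theorem SU2.entry_one_one (U : SU2) : U.1 1 1 = starRingEnd ℂ (U.1 0 0) :=
  (congrFun (congrFun U.conjTranspose_eq 0) 0).symm

theorem SU2.entry_one_zero (U : SU2) : U.1 1 0 = -starRingEnd ℂ (U.1 0 1) := by
  have := congrFun (congrFun U.conjTranspose_eq 1) 0
  simp only [Matrix.conjTranspose_apply, Matrix.of_apply, Matrix.cons_val', Matrix.cons_val_zero,
    Matrix.cons_val_one] at this
  rw [Complex.star_def] at this
  rw [this, neg_neg]

theorem SU2.normSq_add (U : SU2) :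
    U.1 0 0 * starRingEnd ℂ (U.1 0 0) + U.1 0 1 * starRingEnd ℂ (U.1 0 1) = 1 := by
  have h2 : U.1.det = 1 := (Matrix.mem_specialUnitaryGroup_iff.1 U.2).2
  rw [Matrix.det_fin_two, U.entry_one_one, U.entry_one_zero] at h2
  linear_combination h2

/-- Half the trace. -/
def halfTrace (U : SU2) : ℝ := (U.1 0 0).re

theorem conj_add_eq_two_mul_halfTrace (U : SU2) :
    starRingEnd ℂ (U.1 0 0) + U.1 0 0 = 2 * (halfTrace U : ℂ) := by
  rw [add_comm, Complex.add_conj]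
  push_cast
  rfl

/-- The sign making the trace nonnegative. -/
def traceSign (U : SU2) : ℝ := if 0 ≤ halfTrace U then 1 else -1

theorem traceSign_sq (U : SU2) : traceSign U * traceSign U = 1 := by
  unfold traceSign; split_ifs <;> norm_num

theorem traceSign_mul_halfTrace (U : SU2) : traceSign U * halfTrace U = |halfTrace U| := by
  unfold traceSign
  split_ifs with h
  · rw [abs_of_nonneg h, one_mul]
  · rw [abs_of_neg (not_le.1 h), neg_one_mul]

/-- The trace-free part of an element of `SU(2)`. -/
def tracelessPart (U : SU2) : SL :=
  cmul (U.1 0 0 - halfTrace U) (SL.ofMat !![1, 0; 0, -1] (by simp [Matrix.trace_fin_two]))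
    + cmul (U.1 0 1) (SL.ofMat !![0, 1; 0, 0] (by simp [Matrix.trace_fin_two]))
    + cmul (U.1 1 0) (SL.ofMat !![0, 0; 1, 0] (by simp [Matrix.trace_fin_two]))

theorem mat_tracelessPart (U : SU2) : (tracelessPart U).mat =
    !![U.1 0 0 - halfTrace U, U.1 0 1; U.1 1 0, -(U.1 0 0 - halfTrace U)] := by
  rw [tracelessPart, SL.mat_add, SL.mat_add, mat_cmul, mat_cmul, mat_cmul, SL.mat_ofMat,
    SL.mat_ofMat, SL.mat_ofMat]
  ext i j
  fin_cases i <;> fin_cases j <;> simp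

theorem SU2.coe_eq (U : SU2) : U.1 = halfTrace U • (1 : Matrix (Fin 2) (Fin 2) ℂ)
    + (tracelessPart U).mat := by
  rw [mat_tracelessPart]
  have h := conj_add_eq_two_mul_halfTrace U
  ext i j
  fin_cases i <;> fin_cases j
  · simp
  · simp
  · simp
  · simp only [Fin.mk_one, Fin.isValue, U.entry_one_one]
    simp
    linear_combination h

theorem conjTr_tracelessPart (U : SU2) : conjTr (tracelessPart U) = -tracelessPart U := by
  refine Subtype.ext ?_
  change (tracelessPart U).mat.conjTranspose = -(tracelessPart U).mat
  rw [mat_tracelessPart]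
  have h := conj_add_eq_two_mul_halfTrace U
  have h2 := U.entry_one_zero
  have h3 : starRingEnd ℂ (U.1 1 0) = -U.1 0 1 := by rw [h2, map_neg, Complex.conj_conj]
  ext i j
  fin_cases i <;> fin_cases j
  · simp; linear_combination h
  · simpa using h3
  · simp [h2]
  · simp; linear_combination -h

theorem casimir_tracelessPart (U : SU2) :
    casimir (tracelessPart U) = ((1 - halfTrace U ^ 2 : ℝ) : ℂ) := by
  have h := conj_add_eq_two_mul_halfTrace U
  have h2 := U.entry_one_zero
  have h3 := U.normSq_add
  rw [casimir_eq, mat_tracelessPart]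
  simp only [Matrix.of_apply, Matrix.cons_val', Matrix.cons_val_zero, Matrix.cons_val_one, h2]
  push_cast
  linear_combination h3 - U.1 0 0 * h

/-- The trace-free part of the representative of `± U` with nonnegative trace. -/
def halfQ (U : SU2) : SL := traceSign U • tracelessPart U

/-- `U` and `-U` act in the same way, so the sign is free to make the trace nonnegative. -/
theorem isHalf (U : SU2) : IsHalf |halfTrace U| (halfQ U) where
  nonneg := abs_nonneg _
  le_one := by
    have h := U.normSq_add
    rw [Complex.mul_conj, Complex.mul_conj] at h
    have h1 : Complex.normSq (U.1 0 0) + Complex.normSq (U.1 0 1) = 1 := by exact_mod_cast h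
    have h2 := Complex.normSq_nonneg (U.1 0 1)
    have h3 : halfTrace U ^ 2 ≤ Complex.normSq (U.1 0 0) := by
      rw [Complex.normSq_apply, halfTrace]; nlinarith [mul_self_nonneg (U.1 0 0).im]
    exact abs_le_one_iff_mul_self_le_one.2 (by nlinarith)
  skew := by rw [halfQ, conjTr_smul, conjTr_tracelessPart, smul_neg]
  casimir_eq := by
    have h : casimir (halfQ U) = (traceSign U * traceSign U : ℝ) * casimir (tracelessPart U) := by
      rw [halfQ, casimir_eq, casimir_eq, SL.mat_smul]
      simp
      ring
    rw [h, traceSign_sq, casimir_tracelessPart, sq_abs]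
    simp

/-- The adjoint action of `SU(2)`, as a linear map. -/
def AdL (U : SU2) : SL →L[ℝ] SL := pathP |halfTrace U| (halfQ U) 1

/-- The path ends at `traceSign U • U`, of determinant one, and the sign cancels in the conjugation.
-/
theorem AdL_apply (U : SU2) (A : SL) : AdL U A = Ad U A := by
  have h := (isHalf U).smul_mat_pathP 1 A
  have e1 : pathDet |halfTrace U| 1 = 1 := by unfold pathDet; ring
  have e2 : (1 - (1 - |halfTrace U|) * 1) = traceSign U * halfTrace U := by
    rw [traceSign_mul_halfTrace]; ring
  have e3 : (halfQ U).mat = traceSign U • (tracelessPart U).mat := rfl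
  have hU := U.coe_eq
  have hsq := traceSign_sq U
  have hstar : (U⁻¹ : SU2).1
      = halfTrace U • (1 : Matrix (Fin 2) (Fin 2) ℂ) - (tracelessPart U).mat := by
    have hskew : (tracelessPart U).mat.conjTranspose = -(tracelessPart U).mat :=
      congrArg SL.mat (conjTr_tracelessPart U)
    rw [SU2.coe_inv, hU, Matrix.conjTranspose_add, hskew, Matrix.conjTranspose_smul,
      Matrix.conjTranspose_one, star_trivial, ← sub_eq_add_neg]
  rw [e1, one_smul, one_smul, e2, e3, mul_smul, ← smul_add, ← smul_sub, ← hU, ← hstar] at h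
  refine Subtype.ext ?_
  change (AdL U A).mat = U.1 * A.mat * (U⁻¹ : SU2).1
  rw [AdL, h, smul_mul_assoc, smul_mul_assoc, mul_smul_comm, smul_smul, hsq, one_smul]

theorem coe_AdL (U : SU2) : ⇑(AdL U) = Ad U := funext (AdL_apply U)

theorem mat_Ad (U : SU2) (A : SL) : (Ad U A).mat = U.1 * A.mat * U.1.conjTranspose := rfl

theorem Ad_mul (U V : SU2) (A : SL) : Ad (U * V) A = Ad U (Ad V A) := by
  refine Subtype.ext ?_
  change (Ad (U * V) A).mat = (Ad U (Ad V A)).mat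
  rw [mat_Ad, mat_Ad, mat_Ad, Submonoid.coe_mul, Matrix.conjTranspose_mul]
  noncomm_ring

theorem casimir_Ad (U : SU2) (A : SL) : casimir (Ad U A) = casimir A := by
  rw [← AdL_apply]; exact (isHalf U).casimir_pathP 1 A

theorem norm_Ad (U : SU2) (A : SL) : ‖Ad U A‖ = ‖A‖ := by
  rw [← AdL_apply]; exact (isHalf U).norm_pathP 1 A

theorem conjTr_Ad (U : SU2) (A : SL) : conjTr (Ad U A) = Ad U (conjTr A) := by
  refine Subtype.ext ?_
  change (Ad U A).mat.conjTranspose = (Ad U (conjTr A)).mat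
  rw [mat_Ad, mat_Ad, Matrix.conjTranspose_mul, Matrix.conjTranspose_mul,
    Matrix.conjTranspose_conjTranspose, mat_conjTr, mul_assoc]

theorem Ad_cmul (U : SU2) (z : ℂ) (A : SL) : Ad U (cmul z A) = cmul z (Ad U A) := by
  refine Subtype.ext ?_
  change (Ad U (cmul z A)).mat = (cmul z (Ad U A)).mat
  rw [mat_Ad, mat_cmul, mat_cmul, mat_Ad, mul_smul_comm, smul_mul_assoc]

theorem casimirStar_Ad (U : SU2) (A : SL) : casimirStar (Ad U A) = Ad U (casimirStar A) := by
  rw [casimirStar, casimirStar, casimir_Ad, conjTr_Ad, Ad_cmul]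

theorem retraction_Ad (U : SU2) {A : SL} (hA : casimir A ≠ 0) :
    retraction (Ad U A) = Ad U (retraction A) := by
  have hA' : casimir (Ad U A) ≠ 0 := by rwa [casimir_Ad]
  have hρ : rho (Ad U A) = rho A := by rw [← norm_sq_eq_rho, norm_Ad, norm_sq_eq_rho]
  rw [retraction_eq_comb hA', retraction_eq_comb hA, casimir_Ad, hρ, casimirStar_Ad, ← AdL_apply,
    ← AdL_apply, ← AdL_apply, map_sub, map_smul, map_smul]

/-! ### Measurability -/

theorem continuous_halfTrace : Continuous halfTrace :=
  Complex.continuous_re.comp ((continuous_apply_apply (0 : Fin 2) (0 : Fin 2)).comp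
    continuous_subtype_val)

theorem continuous_tracelessPart : Continuous tracelessPart := by
  have he : ∀ i j : Fin 2, Continuous fun U : SU2 => U.1 i j := fun i j =>
    (continuous_apply_apply i j).comp continuous_subtype_val
  have h : ∀ {u : SU2 → ℂ} (A : SL), Continuous u → Continuous fun U => cmul (u U) A :=
    fun A hu => (cmul.continuous.comp hu).clm_apply continuous_const
  exact ((h _ ((he 0 0).sub (Complex.continuous_ofReal.comp continuous_halfTrace))).add
    (h _ (he 0 1))).add (h _ (he 1 0))

/-- The sign jumps where the trace vanishes, so the paths depend on `U` only measurably; this is all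
that integration over the group requires. -/
theorem stronglyMeasurable_halfQ : StronglyMeasurable halfQ := by
  have h : Measurable traceSign :=
    Measurable.ite (measurableSet_le measurable_const continuous_halfTrace.measurable)
      measurable_const measurable_const
  exact h.stronglyMeasurable.smul continuous_tracelessPart.stronglyMeasurable

theorem measurable_pathDet : Measurable fun z : SU2 × ℝ => pathDet |halfTrace z.1| z.2 := by
  have h1 : Measurable fun z : SU2 × ℝ => |halfTrace z.1| :=
    (continuous_halfTrace.comp continuous_fst).abs.measurable
  unfold pathDet
  fun_prop

theorem stronglyMeasurable_adL_halfQ :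
    StronglyMeasurable fun z : SU2 × ℝ => adL (halfQ z.1) :=
  adL.continuous.comp_stronglyMeasurable (stronglyMeasurable_halfQ.comp_measurable measurable_fst)

theorem stronglyMeasurable_pathZ :
    StronglyMeasurable fun z : SU2 × ℝ => pathZ |halfTrace z.1| (halfQ z.1) z.2 := by
  have h : StronglyMeasurable fun z : SU2 × ℝ => (pathDet |halfTrace z.1| z.2)⁻¹ :=
    measurable_pathDet.inv.stronglyMeasurable
  unfold pathZ
  exact h.smul stronglyMeasurable_adL_halfQ

theorem stronglyMeasurable_pathP :
    StronglyMeasurable fun z : SU2 × ℝ => pathP |halfTrace z.1| (halfQ z.1) z.2 := by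
  have hD := stronglyMeasurable_adL_halfQ
  have hD2 : StronglyMeasurable fun z : SU2 × ℝ => (adL (halfQ z.1)).comp (adL (halfQ z.1)) := by
    have h : Continuous fun L : SL →L[ℝ] SL => L.comp L := continuous_id.clm_comp continuous_id
    exact h.comp_stronglyMeasurable hD
  have h1 : Measurable fun z : SU2 × ℝ => |halfTrace z.1| :=
    (continuous_halfTrace.comp continuous_fst).abs.measurable
  have hx : StronglyMeasurable fun z : SU2 × ℝ =>
      (1 - (1 - |halfTrace z.1|) * z.2) * z.2 / pathDet |halfTrace z.1| z.2 :=
    (((measurable_const.sub ((measurable_const.sub h1).mul measurable_snd)).mul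
      measurable_snd).div measurable_pathDet).stronglyMeasurable
  have hy : StronglyMeasurable fun z : SU2 × ℝ => z.2 ^ 2 / (2 * pathDet |halfTrace z.1| z.2) :=
    ((measurable_snd.pow_const 2).div (measurable_const.mul measurable_pathDet)).stronglyMeasurable
  unfold pathP
  exact (stronglyMeasurable_const.add (hx.smul hD)).add (hy.smul hD2)

theorem stronglyMeasurable_AdL : StronglyMeasurable AdL := by
  have h : Measurable fun U : SU2 => (U, (1 : ℝ)) := measurable_id.prodMk measurable_const
  have h2 := stronglyMeasurable_pathP.comp_measurable h
  rw [Function.comp_def] at h2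
  exact h2

/-! ### The Haar measure -/

instance instIsProbabilityMeasureHaarSU2 : IsProbabilityMeasure haarSU2 :=
  ⟨Measure.haarMeasure_self (K₀ := (⊤ : TopologicalSpace.PositiveCompacts SU2))⟩

instance instIsHaarMeasureHaarSU2 : haarSU2.IsHaarMeasure :=
  Measure.isHaarMeasure_haarMeasure _

instance instIsMulRightInvariantHaarSU2 : haarSU2.IsMulRightInvariant where
  map_mul_right_eq_self g := by
    -- A right translate of Haar measure is again a Haar probability measure, and such a measure is
    -- unique.
    have : IsProbabilityMeasure (haarSU2.map (· * g)) :=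
      Measure.isProbabilityMeasure_map (measurable_mul_const g).aemeasurable
    exact Measure.isHaarMeasure_eq_of_isProbabilityMeasure _ _

/-! ### The retraction onto `SU(2)`-invariant forms -/

/-- The path from the identity to `Ad U`. -/
def adPath (U : SU2) (s : ℝ) : SL →L[ℝ] SL := pathP |halfTrace U| (halfQ U) s

/-- The velocity of the path from the identity to `Ad U`. -/
def adVel (U : SU2) (s : ℝ) : SL →L[ℝ] SL := pathZ |halfTrace U| (halfQ U) s

theorem isFlatKernel_average (n : ℕ) :
    IsFlatKernel haarSU2 univ (fun (α : Form n) U => pullback (AdL U) α) 0 0 :=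
  isFlatKernel_pullback stronglyMeasurable_AdL fun U A => by rw [AdL_apply, norm_Ad]

/-- The product of the Haar measure and the Lebesgue measure on the unit interval. -/
def pathMeasure : Measure (SU2 × ℝ) := haarSU2.prod (volume.restrict (Ioc (0 : ℝ) 1))

instance instIsFiniteMeasurePathMeasure : IsFiniteMeasure pathMeasure := by
  unfold pathMeasure; infer_instance

/-- The form `i_Z P^* α` for the path `P` from the identity to `Ad U` with velocity `Z`. -/
def pathKernel {n : ℕ} (α : Form (n + 1)) (z : SU2 × ℝ) : Form n :=
  interiorProduct (adVel z.1 z.2) (pullback (adPath z.1 z.2) α)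

theorem isFlatKernel_pathKernel (n : ℕ) :
    IsFlatKernel pathMeasure univ (pathKernel (n := n)) 0 0 :=
  isFlatKernel_interiorProduct stronglyMeasurable_pathP stronglyMeasurable_pathZ
    (fun z A => ((isHalf z.1).norm_pathP z.2 A).le) (fun z => (isHalf z.1).norm_pathZ_le z.2)

/-- Averaging over `SU(2)` on flat forms. -/
def pUnitary (n : ℕ) : flatForms n →ₗ[ℝ] flatForms n := (isFlatKernel_average n).op

/-- The homotopy operator of the averaging over `SU(2)`. -/
def hUnitary (n : ℕ) : flatForms (n + 1) →ₗ[ℝ] flatForms n := (isFlatKernel_pathKernel n).op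

theorem pUnitary_apply {n : ℕ} (α : flatForms n) (A : SL) :
    (pUnitary n α).1 A = ∫ U, pullback (AdL U) α.1 A ∂haarSU2 := rfl

theorem hUnitary_apply {n : ℕ} (α : flatForms (n + 1)) (A : SL) :
    (hUnitary n α).1 A = ∫ z, pathKernel α.1 z A ∂pathMeasure := rfl

theorem pUnitary_eq_haarAverage {n : ℕ} (α : flatForms n) :
    (pUnitary n α).1 = haarAverage α.1 := by
  funext A
  rw [pUnitary_apply, haarAverage]
  simp only [coe_AdL]

theorem pointwiseSLB_pUnitary (n : ℕ) : PointwiseSLB (pUnitary n) 0 0 :=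
  (isFlatKernel_average n).pointwiseSLB_op

theorem pointwiseSLB_hUnitary (n : ℕ) : PointwiseSLB (hUnitary n) 0 0 :=
  (isFlatKernel_pathKernel n).pointwiseSLB_op

theorem pullback_id {n : ℕ} (α : Form n) (A : SL) :
    pullback (ContinuousLinearMap.id ℝ SL) α A = α A := by
  rw [pullback, ContinuousLinearMap.fderiv]
  ext v
  rfl

theorem hasDerivAt_adPath (U : SU2) (s : ℝ) (B : SL) :
    HasDerivAt (fun t => adPath U t B) (fderiv ℝ (adPath U s) B (adVel U s B)) s := by
  rw [(adPath U s).fderiv]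
  exact (isHalf U).hasDerivAt_pathP s B

/-- Integration of the derivative along all paths. -/
theorem integral_path_eq {n : ℕ} (α : flatForms n) (A : SL)
    {u : SU2 × ℝ → SL [⋀^Fin n]→L[ℝ] ℝ} (hu : Integrable u pathMeasure)
    (h : ∀ U s, HasDerivAt (fun t => pullback (adPath U t) α.1 A) (u (U, s)) s) :
    (pUnitary n α).1 A = α.1 A + ∫ z, u z ∂pathMeasure := by
  have h1 : ∀ᵐ U ∂haarSU2, ∫ s in Ioc (0 : ℝ) 1, u (U, s) = pullback (AdL U) α.1 A - α.1 A := by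
    filter_upwards [Integrable.prod_right_ae (μ := haarSU2) (ν := volume.restrict (Ioc (0 : ℝ) 1))
      hu] with U hU
    rw [← intervalIntegral.integral_of_le zero_le_one,
      intervalIntegral.integral_eq_sub_of_hasDerivAt (fun s _ => h U s)
        ((intervalIntegrable_iff_integrableOn_Ioc_of_le zero_le_one).2 hU)]
    have e0 : adPath U 0 = ContinuousLinearMap.id ℝ SL := pathP_zero
    rw [e0, pullback_id]
    rfl
  rw [pathMeasure, integral_prod _ hu, integral_congr_ae h1, integral_sub
    ((isFlatKernel_average n).integrable_apply α A) (integrable_const _), integral_const,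
    probReal_univ, one_smul, pUnitary_apply, add_sub_cancel]

theorem pUnitary_zero (α : flatForms 0) : pUnitary 0 α = α + hUnitary 0 (d 0 α) :=
  Subtype.ext <| funext fun A =>
    integral_path_eq α A ((isFlatKernel_pathKernel 0).integrable_apply (d 0 α) A) fun U s =>
      hasDerivAt_pullback_zero (hasDerivAt_adPath U s) α.2.1 A

theorem pUnitary_succ (n : ℕ) (α : flatForms (n + 1)) : pUnitary (n + 1) α
    = α + (d n (hUnitary n α) + hUnitary (n + 1) (d (n + 1) α)) := by
  refine Subtype.ext <| funext fun A => ?_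
  have i1 := (isFlatKernel_pathKernel n).integrable_extDeriv α A
  have i2 := (isFlatKernel_pathKernel (n + 1)).integrable_apply (d (n + 1) α) A
  have e := integral_path_eq α A (i1.add i2) fun U s =>
    hasDerivAt_pullback_succ isOpen_univ (fun q _ => (isHalf U).contDiff_pathP.contDiffAt)
      (mem_univ s) (hasDerivAt_adPath U s) α.2.1 A
  rw [e]
  have e2 : ∫ z, ((fun z => extDeriv (pathKernel α.1 z) A)
      + fun z => pathKernel (d (n + 1) α).1 z A) z ∂pathMeasure
      = extDeriv (hUnitary n α).1 A + (hUnitary (n + 1) (d (n + 1) α)).1 A := by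
    rw [integral_add' i1 i2, hUnitary_apply]
    congr 1
    exact ((isFlatKernel_pathKernel n).extDeriv_op α A).symm
  rw [e2]
  rfl

theorem pullback_adPath_ePhi {n : ℕ} (U : SU2) (s : ℝ) (β : Form n) (A : SL) :
    pullback (adPath U s) (ePhi n β) A = ePhi n (pullback (adPath U s) β) A :=
  pullback_ePhi (adPath U s).differentiableAt
    (Eventually.of_forall fun B => (isHalf U).casimir_pathP s B)

theorem fderiv_casimir_adVel (U : SU2) (s : ℝ) (A : SL) :
    fderiv ℝ casimirRe A (adVel U s A) = 0 ∧ fderiv ℝ casimirIm A (adVel U s A) = 0 :=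
  (isHalf U).fderiv_casimir_pathZ s A

theorem hUnitary_ePhiFlat_zero (β : flatForms 0) : hUnitary 1 (ePhiFlat 0 β) = 0 := by
  refine Subtype.ext (funext fun A => ?_)
  rw [hUnitary_apply]
  refine (integral_congr_ae (g := fun _ => 0) (Eventually.of_forall fun z => ?_)).trans
    (integral_zero _ _)
  have ⟨h1, h2⟩ := fderiv_casimir_adVel z.1 z.2 A
  change interiorProduct _ (pullback (adPath z.1 z.2) (ePhi 0 β.1)) A = 0
  rw [funext (pullback_adPath_ePhi z.1 z.2 β.1), interiorProduct_ePhi_zero h1 h2]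

theorem hUnitary_ePhiFlat (n : ℕ) (β : flatForms (n + 1)) :
    hUnitary (n + 2) (ePhiFlat (n + 1) β) = ePhiFlat n (hUnitary n β) := by
  refine Subtype.ext (funext fun A => ?_)
  change _ = ePhi n (hUnitary n β).1 A
  rw [hUnitary_apply, ePhi_eq_ePhiL, hUnitary_apply, ← (ePhiL n A).integral_comp_comm
    ((isFlatKernel_pathKernel n).integrable_apply β A)]
  refine integral_congr_ae (Eventually.of_forall fun z => ?_)
  have ⟨h1, h2⟩ := fderiv_casimir_adVel z.1 z.2 A
  change interiorProduct _ (pullback (adPath z.1 z.2) (ePhi (n + 1) β.1)) A = _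
  rw [funext (pullback_adPath_ePhi z.1 z.2 β.1), interiorProduct_ePhi h1 h2]
  rfl

theorem pUnitary_ePhiFlat (n : ℕ) (β : flatForms n) :
    pUnitary (n + 2) (ePhiFlat n β) = ePhiFlat n (pUnitary n β) := by
  refine Subtype.ext (funext fun A => ?_)
  change _ = ePhi n (pUnitary n β).1 A
  rw [pUnitary_apply, ePhi_eq_ePhiL, pUnitary_apply, ← (ePhiL n A).integral_comp_comm
    ((isFlatKernel_average n).integrable_apply β A)]
  exact integral_congr_ae (Eventually.of_forall fun U => pullback_adPath_ePhi U 1 β.1 A)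

/-- Averages over `SU(2)` are invariant. -/
theorem pullback_Ad_pUnitary {n : ℕ} (V : SU2) (α : flatForms n) (A : SL) :
    pullback (Ad V) (pUnitary n α).1 A = (pUnitary n α).1 A := by
  rw [← coe_AdL]
  have h1 : ∀ U, pullback (AdL (U * V)) α.1 A
      = ContinuousAlternatingMap.compContinuousLinearMapCLM (AdL V)
        (pullback (AdL U) α.1 (AdL V A)) := fun U => by
    have e : (⇑(AdL (U * V)) : SL → SL) = AdL U ∘ AdL V := funext fun B => by
      rw [Function.comp_apply, AdL_apply, AdL_apply, AdL_apply, Ad_mul]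
    rw [e, ← pullback_comp (AdL V).differentiableAt (AdL U).differentiableAt, pullback,
      (AdL V).fderiv]
    rfl
  rw [pUnitary_apply, ← integral_mul_right_eq_self _ V]
  simp only [h1]
  rw [ContinuousLinearMap.integral_comp_comm _ ((isFlatKernel_average n).integrable_apply α _),
    pullback, (AdL V).fderiv]
  rfl

theorem pUnitary_idem (n : ℕ) (α : flatForms n) : pUnitary n (pUnitary n α) = pUnitary n α := by
  refine Subtype.ext (funext fun A => ?_)
  rw [pUnitary_apply]
  simp only [coe_AdL, pullback_Ad_pUnitary]
  rw [integral_const, probReal_univ, one_smul]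

theorem isDeformationRetraction_unitary :
    IsDeformationRetraction (fun _ => ⊤) pUnitary hUnitary :=
  isDeformationRetraction_of_homotopy (fun _ _ _ => trivial) (fun _ _ _ => trivial)
    (fun α _ => pUnitary_zero α) (fun n α _ => pUnitary_succ n α) fun n α _ => pUnitary_idem n α

theorem isDeformationRetraction_unitary_foliated :
    IsDeformationRetraction foliated pUnitary hUnitary :=
  isDeformationRetraction_of_homotopy d_mem_foliated
    (mem_foliated_of_commute hUnitary_ePhiFlat_zero hUnitary_ePhiFlat)
    (fun α _ => pUnitary_zero α) (fun n α _ => pUnitary_succ n α) fun n α _ => pUnitary_idem n α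

/-! ### Vanishing of the exterior product with `φ` -/

/-- If `β` vanishes on the common kernel of two covectors, then so does its exterior product with
both of them. -/
theorem wedge_wedge_eq_zero {n : ℕ} {θ₁ θ₂ : SL → SL →L[ℝ] ℝ} {β : Form n} {A : SL}
    (h : ∀ v : Fin n → SL, (∀ i, θ₁ A (v i) = 0 ∧ θ₂ A (v i) = 0) → β A v = 0) :
    wedge θ₁ (wedge θ₂ β) A = 0 := by
  let K : Submodule ℝ SL := LinearMap.ker (θ₁ A).toLinearMap ⊓ LinearMap.ker (θ₂ A).toLinearMap
  -- Two covectors cut out `K`, so a complement `L` has dimension at most two. The form is tested on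
  -- distinct vectors of a basis adapted to `K ⊕ L`.
  obtain ⟨L, hL⟩ := Submodule.exists_isCompl K
  have hdim : Module.finrank ℝ L ≤ 2 := by
    let F : L →ₗ[ℝ] ℝ × ℝ := ((θ₁ A).toLinearMap.prod (θ₂ A).toLinearMap).comp L.subtype
    have hF : Function.Injective F := by
      rw [← LinearMap.ker_eq_bot, Submodule.eq_bot_iff]
      intro x hx
      have hx' : ((θ₁ A x.1, θ₂ A x.1) : ℝ × ℝ) = 0 := hx
      have hK : x.1 ∈ K := ⟨congrArg Prod.fst hx', congrArg Prod.snd hx'⟩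
      exact Subtype.ext (Submodule.disjoint_def.1 hL.disjoint x.1 hK x.2)
    simpa using LinearMap.finrank_le_finrank_of_injective hF
  let e := ((Module.finBasis ℝ K).prod (Module.finBasis ℝ L)).map
    (Submodule.prodEquivOfIsCompl K L hL)
  have he : ∀ i, e (Sum.inl i) ∈ K := fun i => by
    simp only [e, Module.Basis.map_apply, Submodule.coe_prodEquivOfIsCompl',
      Module.Basis.prod_apply_inl_fst, Module.Basis.prod_apply_inl_snd]
    simp
  have hθ : ∀ i, θ₁ A (e (Sum.inl i)) = 0 ∧ θ₂ A (e (Sum.inl i)) = 0 := fun i => he i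
  refine ContinuousAlternatingMap.toAlternatingMap_injective
    (Module.Basis.ext_alternating e fun w hw => ?_)
  change wedge θ₁ (wedge θ₂ β) A (fun i => e (w i)) = 0
  rw [wedge_apply]
  refine Finset.sum_eq_zero fun i _ => ?_
  rcases hi : w i with x | x
  · rw [(hθ x).1, zero_mul, mul_zero]
  rw [wedge_apply, Finset.sum_eq_zero fun j _ => ?_, mul_zero, mul_zero]
  change _ * (θ₂ A (e (w (i.succAbove j))) * β A fun l => e (w (i.succAbove (j.succAbove l)))) = 0
  rcases hj : w (i.succAbove j) with y | y
  · rw [(hθ y).2, zero_mul, mul_zero]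
  rw [h, mul_zero, mul_zero]
  intro l
  rcases hl : w (i.succAbove (j.succAbove l)) with z | z
  · exact hθ z
  -- The arguments of `θ₁` and `θ₂` already lie in `L`; a third basis vector from `L` would exceed
  -- its dimension.
  · exfalso
    have h1 : x ≠ y := fun hxy => i.succAbove_ne j (hw (by rw [hi, hj, hxy]))
    have h2 : x ≠ z := fun hxz => i.succAbove_ne (j.succAbove l) (hw (by rw [hi, hl, hxz]))
    have h3 : y ≠ z := fun hyz => j.succAbove_ne l
      (Fin.succAbove_right_injective (hw (by rw [hj, hl, hyz])))
    have := x.2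
    have := y.2
    have := z.2
    rw [ne_eq, Fin.ext_iff] at h1 h2 h3
    omega

/-! ### Normal elements and the adjoint action -/

theorem fderiv_casimir_apply (A B : SL) :
    fderiv ℝ casimir A B = -(A.mat * B.mat).trace := by
  have h1 : HasDerivAt (fun t : ℝ => casimir (A + t • B)) (fderiv ℝ casimir A B) 0 := by
    have hd : HasDerivAt (fun t : ℝ => A + t • B) B 0 := by
      simpa using ((hasDerivAt_id (0 : ℝ)).smul_const B).const_add A
    have hf : HasFDerivAt casimir (fderiv ℝ casimir A) (A + (0 : ℝ) • B) := by
      rw [zero_smul, add_zero]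
      exact (contDiff_casimir.differentiable (by simp) A).hasFDerivAt
    exact hf.comp_hasDerivAt (0 : ℝ) hd
  have h2 : HasDerivAt (fun t : ℝ => casimir (A + t • B)) (-(A.mat * B.mat).trace) 0 := by
    have e : (fun t : ℝ => casimir (A + t • B)) = fun t : ℝ =>
        casimir A + ((t : ℂ) * (-(A.mat * B.mat).trace) + (t : ℂ) * (t : ℂ) * casimir B) := by
      funext t
      rw [casimir_eq, casimir_eq, casimir_eq, SL.mat_add, SL.mat_smul, Matrix.trace_fin_two]
      simp only [Matrix.add_apply, Matrix.smul_apply, Complex.real_smul, Matrix.mul_apply,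
        Fin.sum_univ_two, A.mat_one_one, B.mat_one_one]
      ring
    rw [e]
    have ht : HasDerivAt (fun t : ℝ => (t : ℂ)) 1 0 := Complex.ofRealCLM.hasDerivAt
    have h3 := (ht.mul_const (-(A.mat * B.mat).trace)).add ((ht.mul ht).mul_const (casimir B))
    refine (h3.const_add (casimir A)).congr_deriv ?_
    simp
  exact h1.unique h2

/-- Polarized Cayley-Hamilton: a tangent vector to the fibre of `f` through `N` anticommutes with
`N`. -/
theorem mat_mul_add_mat_mul (A B : SL) : A.mat * B.mat + B.mat * A.mat
    = (A.mat * B.mat).trace • (1 : Matrix (Fin 2) (Fin 2) ℂ) := by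
  ext i j
  fin_cases i <;> fin_cases j <;>
    simp [Matrix.mul_apply, Matrix.trace_fin_two, A.mat_one_one, B.mat_one_one] <;> ring

/-- A unitary element stabilizing the normal element `r(A)` and acting by `-1` on the tangent space
of the fibre of `f` through it. -/
theorem exists_unitary_stabilizer {A : SL} (hA : casimir A ≠ 0) : ∃ U : SU2,
    Ad U (retraction A) = retraction A ∧
      ∀ B, fderiv ℝ casimirRe (retraction A) B = 0 → fderiv ℝ casimirIm (retraction A) B = 0 →
        Ad U B = -B := by
  set N := retraction A with hN
  have hf : casimir N = casimir A := casimir_retraction A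
  have hstar : N.mat.conjTranspose
      = (-(starRingEnd ℂ (casimir A)) * (‖casimir A‖⁻¹ : ℝ)) • N.mat :=
    congrArg SL.mat (conjTr_retraction hA)
  have hsq : N.mat * N.mat = -(casimir A • (1 : Matrix (Fin 2) (Fin 2) ℂ)) := by
    rw [mat_mul_mat, hf]
  -- The group element is `w N`: `w² = 1/f` gives determinant one, and `|w|² |f| = 1` gives
  -- unitarity because `N*` is a multiple of `N`.
  obtain ⟨w, hw⟩ : ∃ w : ℂ, w ^ 2 = (casimir A)⁻¹ := IsAlgClosed.exists_pow_nat_eq _ two_pos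
  have hw1 : w * starRingEnd ℂ w * (‖casimir A‖ : ℂ) = 1 := by
    have h1 : ‖w‖ ^ 2 * ‖casimir A‖ = 1 := by
      rw [← norm_pow, hw, norm_inv, inv_mul_cancel₀ (norm_ne_zero_iff.2 hA)]
    rw [Complex.mul_conj, Complex.normSq_eq_norm_sq]
    exact_mod_cast h1
  have hff : starRingEnd ℂ (casimir A) * casimir A = (‖casimir A‖ : ℂ) ^ 2 := by
    rw [mul_comm, Complex.mul_conj, Complex.normSq_eq_norm_sq, Complex.ofReal_pow]
  have hx : (‖casimir A‖ : ℂ) ≠ 0 := Complex.ofReal_ne_zero.2 (norm_ne_zero_iff.2 hA)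
  have hUU : (w • N.mat) * (w • N.mat).conjTranspose = 1 := by
    rw [Matrix.conjTranspose_smul, hstar, smul_mul_assoc, mul_smul_comm, mul_smul_comm, hsq,
      ← neg_smul, smul_smul, smul_smul, smul_smul, Complex.star_def]
    have e : w * starRingEnd ℂ w * (-(starRingEnd ℂ (casimir A)) * (‖casimir A‖⁻¹ : ℝ))
        * -(casimir A) = 1 := by
      rw [Complex.ofReal_inv]
      calc _ = w * starRingEnd ℂ w * (starRingEnd ℂ (casimir A) * casimir A)
            * (‖casimir A‖ : ℂ)⁻¹ := by ring
        _ = w * starRingEnd ℂ w * (‖casimir A‖ : ℂ) := by rw [hff]; field_simp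
        _ = 1 := hw1
    rw [e, one_smul]
  have hdet : (w • N.mat).det = 1 := by
    rw [Matrix.det_smul, Fintype.card_fin, hw]
    change (casimir A)⁻¹ * casimir N = 1
    rw [hf, inv_mul_cancel₀ hA]
  let U : SU2 := ⟨w • N.mat, Matrix.mem_specialUnitaryGroup_iff.2
    ⟨Matrix.mem_unitaryGroup_iff.2 hUU, hdet⟩⟩
  refine ⟨U, Subtype.ext ?_, fun B h1 h2 => Subtype.ext ?_⟩
  · change (w • N.mat) * N.mat * (w • N.mat).conjTranspose = N.mat
    have e : (w • N.mat) * N.mat = N.mat * (w • N.mat) := by rw [smul_mul_assoc, mul_smul_comm]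
    rw [e, mul_assoc, hUU, mul_one]
  · change (w • N.mat) * B.mat * (w • N.mat).conjTranspose = -B.mat
    have hd := (contDiff_casimir.differentiable (by simp) N).hasFDerivAt
    have hre : fderiv ℝ casimirRe N B = (fderiv ℝ casimir N B).re :=
      congrArg (fun L => L B) (Complex.reCLM.hasFDerivAt.comp N hd).fderiv
    have him : fderiv ℝ casimirIm N B = (fderiv ℝ casimir N B).im :=
      congrArg (fun L => L B) (Complex.imCLM.hasFDerivAt.comp N hd).fderiv
    have h3 : fderiv ℝ casimir N B = 0 := Complex.ext (hre ▸ h1) (him ▸ h2)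
    have h4 := mat_mul_add_mat_mul N B
    rw [fderiv_casimir_apply, neg_eq_zero] at h3
    rw [h3, zero_smul] at h4
    have e : (w • N.mat) * B.mat = -(B.mat * (w • N.mat)) := by
      rw [smul_mul_assoc, mul_smul_comm, eq_neg_of_add_eq_zero_left h4, smul_neg]
    rw [e, neg_mul, mul_assoc, hUU, mul_one]

/-! ### The combined retraction -/

theorem pSkeleton_ePhiFlat (n : ℕ) (β : flatForms n) :
    pSkeleton (n + 2) (ePhiFlat n β) = ePhiFlat n (pSkeleton n β) := by
  refine flatForms_ext fun A hA => ?_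
  rw [pSkeleton_eq_pullback _ hA]
  change pullback retraction (ePhi n β.1) A = ePhi n (pSkeleton n β).1 A
  rw [pullback_ePhi ((contDiffAt_retraction hA).differentiableAt (by simp))
    (Eventually.of_forall casimir_retraction), ePhi_congr (pSkeleton_eq_pullback β hA)]

/-- The retraction `r` is equivariant under `Ad`. This commutation makes the composite of the two
projections idempotent. -/
theorem pUnitary_pSkeleton (n : ℕ) (α : flatForms n) :
    pUnitary n (pSkeleton n α) = pSkeleton n (pUnitary n α) := by
  refine flatForms_ext fun A hA => ?_
  have hr : DifferentiableAt ℝ retraction A := (contDiffAt_retraction hA).differentiableAt (by simp)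
  have h1 : ∀ U, pullback (AdL U) (pSkeleton n α).1 A
      = ContinuousAlternatingMap.compContinuousLinearMapCLM (fderiv ℝ retraction A)
        (pullback (AdL U) α.1 (retraction A)) := fun U => by
    have hUA : casimir (AdL U A) ≠ 0 := by rwa [AdL_apply, casimir_Ad]
    have e1 : pullback (AdL U) (pSkeleton n α).1 A = pullback (AdL U) (pullback retraction α.1) A := by
      rw [pullback, pSkeleton_eq_pullback α hUA]
      rfl
    have e2 : retraction ∘ AdL U =ᶠ[𝓝 A] AdL U ∘ retraction := by
      filter_upwards [isOpen_casimir_ne_zero.mem_nhds hA] with B hB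
      rw [Function.comp_apply, Function.comp_apply, AdL_apply, AdL_apply, retraction_Ad U hB]
    rw [e1, pullback_comp (AdL U).differentiableAt
      ((contDiffAt_retraction hUA).differentiableAt (by simp)), pullback_congr e2,
      ← pullback_comp hr (AdL U).differentiableAt]
    rfl
  rw [pUnitary_apply, pSkeleton_eq_pullback _ hA]
  simp only [h1]
  rw [ContinuousLinearMap.integral_comp_comm _ ((isFlatKernel_average n).integrable_apply α _)]
  rfl

/-- In odd degrees the combined retraction vanishes on the foliated complex. -/
theorem ePhiFlat_pUnitary_pSkeleton_eq_zero {n : ℕ} (hn : Odd n) (β : flatForms n) :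
    ePhiFlat n (pUnitary n (pSkeleton n β)) = 0 := by
  rw [pUnitary_pSkeleton, ← pSkeleton_ePhiFlat]
  refine flatForms_ext fun A hA => ?_
  rw [pSkeleton_eq_pullback _ hA, pullback]
  have h : ePhi n (pUnitary n β).1 (retraction A) = 0 := by
    rw [ePhi_apply]
    refine wedge_wedge_eq_zero fun v hv => ?_
    -- On `ker df` at `r(A)` invariance under `U` multiplies the form by `(-1)ⁿ = -1`, so it
    -- vanishes there.
    obtain ⟨U, hUN, hU⟩ := exists_unitary_stabilizer hA
    have h1 := congrArg (fun L => L v) (pullback_Ad_pUnitary U β (retraction A))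
    simp only [pullback_apply] at h1
    rw [← coe_AdL, (AdL U).fderiv, AdL_apply, hUN] at h1
    have h2 : (fun i => AdL U (v i)) = fun i => (-1 : ℝ) • v i := funext fun i => by
      rw [AdL_apply, hU _ (hv i).1 (hv i).2, neg_one_smul]
    have h3 : (pUnitary n β).1 (retraction A) (fun i => (-1 : ℝ) • v i)
        = (-1 : ℝ) ^ n * (pUnitary n β).1 (retraction A) v := by
      have := ((pUnitary n β).1 (retraction A)).map_smul_univ (fun _ => (-1 : ℝ)) v
      simpa using this
    have h4 : (pUnitary n β).1 (retraction A) (fun i => AdL U (v i))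
      = (pUnitary n β).1 (retraction A) v := h1
    rw [h2, h3, hn.neg_one_pow] at h4
    linarith
  change ((ePhi n (pUnitary n β).1) (retraction A)).compContinuousLinearMap _ = 0
  rw [h]
  rfl

/-- For odd `n` the retraction itself vanishes; for even `n` the derivative passes through both
projections into the odd degree `n + 1`. -/
theorem d_pUnitary_pSkeleton_eq_zero (n : ℕ) (α : flatForms n) (hα : α ∈ foliated n) :
    d n (pUnitary n (pSkeleton n α)) = 0 := by
  match n with
  | 0 => rw [(Submodule.mem_bot ℝ).1 hα]; simp only [map_zero]
  | 1 => rw [(Submodule.mem_bot ℝ).1 hα]; simp only [map_zero]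
  | n + 2 =>
    obtain ⟨β, rfl⟩ := mem_foliated_iff.1 hα
    rw [pSkeleton_ePhiFlat, pUnitary_ePhiFlat]
    rcases Nat.even_or_odd n with hn | hn
    · rw [d_ePhiFlat, ← isDeformationRetraction_unitary.cochain n _ trivial,
        ← isDeformationRetraction_skeleton.cochain n _ trivial]
      exact ePhiFlat_pUnitary_pSkeleton_eq_zero hn.add_one _
    · rw [ePhiFlat_pUnitary_pSkeleton_eq_zero hn, map_zero]

/-- `p_U p_S - id = p_U (d h_S + h_S d) + (p_U - id)`, and `p_U` commutes with `d`. -/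
theorem isDeformationRetraction_combined : IsDeformationRetraction foliated
    (fun n => pUnitary n ∘ₗ pSkeleton n) (fun n => pUnitary n ∘ₗ hSkeleton n + hUnitary n) := by
  have hS := isDeformationRetraction_skeleton_foliated
  have hU := isDeformationRetraction_unitary_foliated
  refine isDeformationRetraction_of_homotopy d_mem_foliated
    (fun n α hα => Submodule.add_mem _ (hU.p_mem _ _ (hS.h_mem _ _ hα)) (hU.h_mem _ _ hα))
    (fun α _ => ?_) (fun n α _ => ?_) fun n α _ => ?_
  · change pUnitary 0 (α + hSkeleton 0 (d 0 α))
      = α + (pUnitary 0 (hSkeleton 0 (d 0 α)) + hUnitary 0 (d 0 α))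
    rw [map_add, pUnitary_zero α]
    abel
  · change pUnitary (n + 1) (α + (d n (hSkeleton n α) + hSkeleton (n + 1) (d (n + 1) α)))
      = α + (d n (pUnitary n (hSkeleton n α) + hUnitary n α)
        + (pUnitary (n + 1) (hSkeleton (n + 1) (d (n + 1) α)) + hUnitary (n + 1) (d (n + 1) α)))
    rw [map_add, map_add, map_add, pUnitary_succ n α,
      isDeformationRetraction_unitary.cochain n _ trivial]
    abel
  · change pUnitary n (pSkeleton n (pUnitary n (pSkeleton n α))) = pUnitary n (pSkeleton n α)
    rw [← pUnitary_pSkeleton, pUnitary_idem, pSkeleton_idem]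

end FlatSL2

end

theorem proposition2p14 :
    -- the map `r` is a continuous retraction onto the normal matrices, smooth off the cone `f = 0`
    (Continuous retraction ∧ ContDiffOn ℝ ∞ retraction {A | casimir A ≠ 0} ∧
      range retraction = skeleton ∧ ∀ A ∈ skeleton, retraction A = A) ∧
    ∃ (φ : ℝ → SL → SL) (pS : ∀ n, flatForms n →ₗ[ℝ] flatForms n)
      (hS : ∀ n, flatForms (n + 1) →ₗ[ℝ] flatForms n),
      -- `pS` is the smooth flat extension of the pullback along `r`
      (∀ (n : ℕ) (α : flatForms n) (A : SL), casimir A ≠ 0 →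
        (pS n α).1 A = pullback retraction α.1 A) ∧
      -- `hS` is the infinite-time limit of the homotopies given by the flow `φ` of `W`
      IsForwardFlow W φ ∧
      (∀ (n : ℕ) (α : flatForms (n + 1)),
        (∀ t, 0 ≤ t → homotopyAt φ t α.1 ∈ flatForms n) ∧
        TendstoSmooth (fun t => homotopyAt φ t α.1) (hS n α).1) ∧
      -- `(pS, hS)` is a deformation retraction of the flat forms and of the foliated subcomplex
      IsDeformationRetraction (fun _ => ⊤) pS hS ∧
      IsDeformationRetraction foliated pS hS ∧
      (∀ n, PropertySLB ⊤ ⊤ (hS n) 0 5 35) ∧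
      -- averaging over `SU(2)`, and the combined deformation retraction
      ∃ (pU : ∀ n, flatForms n →ₗ[ℝ] flatForms n)
        (hU : ∀ n, flatForms (n + 1) →ₗ[ℝ] flatForms n),
        (∀ (n : ℕ) (α : flatForms n), (pU n α).1 = haarAverage α.1) ∧
        IsDeformationRetraction (fun _ => ⊤) pU hU ∧
        IsDeformationRetraction foliated pU hU ∧
        (∀ n, PropertySLB (foliated n) (foliated n) (pU n) 0 0 0) ∧
        (∀ n, PropertySLB (foliated (n + 1)) (foliated n) (hU n) 0 0 0) ∧
        IsDeformationRetraction foliated (fun n => pU n ∘ₗ pS n)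
          (fun n => pU n ∘ₗ hS n + hU n) ∧
        (∀ (n : ℕ), ∀ α ∈ foliated n, d n (pU n (pS n α)) = 0) ∧
        (∀ n, PropertySLB (foliated (n + 1)) (foliated n) (pU n ∘ₗ hS n + hU n) 0 5 35) := by
  refine ⟨⟨continuous_retraction, contDiffOn_retraction, range_retraction,
      fun A => retraction_of_mem_skeleton⟩, flow, pSkeleton, hSkeleton,
    fun n α A hA => pSkeleton_eq_pullback α hA, isForwardFlow_flow,
    fun n α => ⟨fun t ht => homotopyAt_mem ht α, tendstoSmooth_homotopyAt α⟩,
    isDeformationRetraction_skeleton, isDeformationRetraction_skeleton_foliated,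
    fun n => (pointwiseSLB_hSkeleton n).propertySLB fun _ _ => trivial, pUnitary, hUnitary,
    fun n α => pUnitary_eq_haarAverage α, isDeformationRetraction_unitary,
    isDeformationRetraction_unitary_foliated,
    fun n => (pointwiseSLB_pUnitary n).propertySLB
      (isDeformationRetraction_unitary_foliated.p_mem n),
    fun n => (pointwiseSLB_hUnitary n).propertySLB
      (isDeformationRetraction_unitary_foliated.h_mem n),
    isDeformationRetraction_combined, d_pUnitary_pSkeleton_eq_zero,
    fun n => (((pointwiseSLB_pUnitary n).comp (pointwiseSLB_hSkeleton n)).add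
      ((pointwiseSLB_hUnitary n).mono 5 35)).propertySLB
      (isDeformationRetraction_combined.h_mem n)⟩
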